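/- Let $\mathcal H\neq\{0\}$ be a separable complex Hilbert space with the set of states $\mathfrak S(\mathcal H)$ (positive operators of unit trace, with trace-norm convergence), and let $H(\rho)=\mathrm{Tr}\,\eta(\rho)$, $\eta(x)=-x\log x$, be the von Neumann entropy of a state $\rho$. Let $H$ be a positive (possibly unbounded) self-adjoint operator in $\mathcal H$, $E_0=\inf_{\|\varphi\|=1}\langle\varphi|H|\varphi\rangle$, and let $E>E_0$. For a state $\rho$ put $E_H(\rho)=\mathrm{Tr}\,H\rho=\lim_n \mathrm{Tr}\,P_nH\rho\in[0,+\infty]$, where $P_n$ is the spectral projector of $H$ for $[0,n]$, and let $\mathcal K_{H,E}=\{\rho\in\mathfrak S(\mathcal H): E_H(\rho)\le E\}$. Let $g(H)=\inf\{\lambda>0:\mathrm{Tr}\,e^{-\lambda H}<+\infty\}$, with $g(H)=+\infty$ if there is no such $\lambda$. For a nonnegative function $F$ of states and a sequence of states $\rho_n$ converging to a state $\rho_0$ put $\mathrm{dj}\{F(\rho_n)\}=\limsup_{n}F(\rho_n)-F(\rho_0)$, understood as $+\infty$ if $F(\rho_0)=+\infty$. A) If $g(H)<+\infty$, then $H$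 can be written as $H=\sum_{k}E_k|k\rangle\langle k|$ with an orthonormal basis $|0\rangle,|1\rangle,\dots$ of $\mathcal H$ and $E_k\le E_{k+1}$. For every such representation let $\rho^{\downarrow}=\sum_{k}\lambda_k|k\rangle\langle k|$, where $\{\lambda_k\}$ is the sequence of eigenvalues of $\rho$ in decreasing order (with multiplicity, continued by zeros). Then $$\mathrm{dj}\{H(\rho_n)\}\le g(H)\,\mathrm{dj}\{E_H(\rho_n^{\downarrow})\}\le g(H)\,\mathrm{dj}\{E_H(\rho_n)\}\le g(H)(E-E_0)$$ for every converging sequence $\{\rho_n\}\subset\mathcal K_{H,E}$. All these bounds are sharp: there is a converging sequence in $\mathcal K_{H,E}$ for which all three inequalities are equalities. B) In general (for finite or infinite $g(H)$), $$\sup_{\{\rho_n\}\subset\mathcal K_{H,E}}\mathrm{dj}\{H(\rho_n)\}=g(H)(E-E_0)\le+\infty,$$ where the supremum is over all converging sequences $\{\rho_n\}\subset\mathcal K_{H,E}$. -/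

import Mathlib

open Filter Topology
open scoped InnerProductSpace ENNReal

noncomputable section

namespace QEntropy

variable {𝓗 : Type*} [NormedAddCommGroup 𝓗] [InnerProductSpace ℂ 𝓗] [CompleteSpace 𝓗]

/-! ### Traces, states, convergence, entropy -/

variable (𝓗) in
/-- The index set of a fixed orthonormal basis of the Hilbert space. -/
def traceIndex : Set 𝓗 := (exists_hilbertBasis ℂ 𝓗).choose

variable (𝓗) in
/-- A fixed orthonormal basis of the Hilbert space, used to write traces. -/
def traceBasis : HilbertBasis (traceIndex 𝓗) ℂ 𝓗 := (exists_hilbertBasis ℂ 𝓗).choose_spec.choose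

/-- The trace `∑ ⟨i|A|i⟩`, for trace-class operators `A`. -/
def trace (A : 𝓗 →L[ℂ] 𝓗) : ℂ :=
  ∑' i, ⟪traceBasis 𝓗 i, A (traceBasis 𝓗 i)⟫_ℂ

/-- The trace in `[0, +∞]` of a positive bounded operator. -/
def posTrace (A : 𝓗 →L[ℂ] 𝓗) : ℝ≥0∞ :=
  ∑' i, ENNReal.ofReal (⟪traceBasis 𝓗 i, A (traceBasis 𝓗 i)⟫_ℂ).re

/-- The trace norm `‖A‖₁ = Tr |A|`, with `|A| = (A* A)^{1/2}`. -/
def traceNorm (A : 𝓗 →L[ℂ] 𝓗) : ℝ≥0∞ := posTrace (CFC.abs A)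

/-- Quantum states: positive operators with unit trace. -/
def IsState (ρ : 𝓗 →L[ℂ] 𝓗) : Prop := ρ.IsPositive ∧ posTrace ρ = 1

/-- Convergence in the trace norm. -/
def TraceTendsto (ρ : ℕ → 𝓗 →L[ℂ] 𝓗) (ρ₀ : 𝓗 →L[ℂ] 𝓗) : Prop :=
  Tendsto (fun n => traceNorm (ρ n - ρ₀)) atTop (𝓝 0)

/-- The von Neumann entropy `Tr η(ρ)`, `η(x) = -x log x`, of a state (`η(ρ) ≥ 0`). -/
def entropy (ρ : 𝓗 →L[ℂ] 𝓗) : ℝ≥0∞ := posTrace (cfc Real.negMulLog ρ)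

/-- The discontinuity jump `limsup F(ρₙ) - F(ρ₀)`, understood as `+∞` if `F(ρ₀) = +∞`. -/
def jump (F : (𝓗 →L[ℂ] 𝓗) → ℝ≥0∞) (ρ : ℕ → 𝓗 →L[ℂ] 𝓗) (ρ₀ : 𝓗 →L[ℂ] 𝓗) : EReal :=
  open Classical in
  if F ρ₀ = ⊤ then ⊤ else limsup (fun n => (F (ρ n) : EReal)) atTop - (F ρ₀ : EReal)

/-- The sequence of eigenvalues of a state in decreasing order, counted with multiplicity and
continued by zeros: its `k`-th term (`k = 0, 1, …`) is the largest `μ > 0` such that the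
eigenvalues `≥ μ` have total multiplicity at least `k + 1`, and `0` if there is none. -/
def decreasingEigenvalue (ρ : 𝓗 →L[ℂ] 𝓗) (k : ℕ) : ℝ :=
  sSup {μ : ℝ | 0 < μ ∧
    k + 1 ≤ Module.finrank ℂ
      ↥(⨆ ν ∈ Set.Ici μ, Module.End.eigenspace (ρ : 𝓗 →ₗ[ℂ] 𝓗) (ν : ℂ))}

/-! ### Hamiltonians -/

variable (𝓗) in
/-- A Hamiltonian: a positive, possibly unbounded, self-adjoint operator. -/
structure Hamiltonian where
  /-- the operator with its domain -/
  op : 𝓗 →ₗ.[ℂ] 𝓗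
  selfAdjoint : IsSelfAdjoint op
  nonneg : ∀ x : op.domain, 0 ≤ (⟪(x : 𝓗), op x⟫_ℂ).re

namespace Hamiltonian

variable (H : Hamiltonian 𝓗)

/-- The ground energy `inf ⟨φ|H|φ⟩` over the unit vectors of the domain. -/
def groundEnergy : ℝ := ⨅ φ : {φ : H.op.domain // ‖φ‖ = 1}, (⟪(φ.1 : 𝓗), H.op φ.1⟫_ℂ).re

theorem symm (x y : H.op.domain) : ⟪H.op x, (y : 𝓗)⟫_ℂ = ⟪(x : 𝓗), H.op y⟫_ℂ := by
  have h := H.op.adjoint_isFormalAdjoint H.selfAdjoint.dense_domain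
  have e : H.op.adjoint = H.op := H.selfAdjoint
  rw [e] at h
  exact h x y

theorem norm_le (x : H.op.domain) : ‖(x : 𝓗)‖ ≤ ‖(x : 𝓗) + H.op x‖ := by
  have h1 : ‖(x : 𝓗)‖ * ‖(x : 𝓗)‖ ≤ (⟪(x : 𝓗), (x : 𝓗) + H.op x⟫_ℂ).re := by
    have h2 := inner_self_eq_norm_mul_norm (𝕜 := ℂ) (x : 𝓗)
    have h3 := H.nonneg x
    rw [inner_add_right, Complex.add_re]
    simp only [RCLike.re_to_complex] at h2
    linarith
  have h4 : (⟪(x : 𝓗), (x : 𝓗) + H.op x⟫_ℂ).re ≤ ‖(x : 𝓗)‖ * ‖(x : 𝓗) + H.op x‖ :=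
    re_inner_le_norm (𝕜 := ℂ) _ _
  rcases (norm_nonneg (x : 𝓗)).eq_or_lt with h | h
  · rw [← h]; exact norm_nonneg _
  · exact le_of_mul_le_mul_left (h1.trans h4) h

/-- The operator `1 + H` on the domain of `H`. -/
def oneAdd : H.op.domain →ₗ[ℂ] 𝓗 := H.op.domain.subtype + H.op.toFun

theorem oneAdd_apply (x : H.op.domain) : H.oneAdd x = (x : 𝓗) + H.op x := rfl

theorem oneAdd_injective : Function.Injective H.oneAdd := by
  rw [injective_iff_map_eq_zero]
  intro x hx
  have h := H.norm_le x
  rw [← oneAdd_apply, hx, norm_zero] at h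
  exact Subtype.ext (norm_le_zero_iff.1 h)

theorem oneAdd_surjective : Function.Surjective H.oneAdd := by
  have hclosed : IsClosed (LinearMap.range H.oneAdd : Set 𝓗) := by
    refine isClosed_of_closure_subset fun y hy => ?_
    obtain ⟨u, hu, hlim⟩ := mem_closure_iff_seq_limit.1 hy
    choose v hv using hu
    have hc : CauchySeq fun n => (v n : 𝓗) := by
      have hu' := hlim.cauchySeq
      rw [Metric.cauchySeq_iff] at hu' ⊢
      intro ε hε
      obtain ⟨N, hN⟩ := hu' ε hε
      refine ⟨N, fun m hm n hn => lt_of_le_of_lt ?_ (hN m hm n hn)⟩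
      rw [dist_eq_norm, dist_eq_norm, ← hv m, ← hv n, ← map_sub]
      exact H.norm_le (v m - v n)
    obtain ⟨x, hx⟩ := cauchySeq_tendsto_of_complete hc
    have hH : Tendsto (fun n => H.op (v n)) atTop (𝓝 (y - x)) := by
      have : (fun n => H.op (v n)) = fun n => u n - (v n : 𝓗) := by
        funext n; rw [← hv n, oneAdd_apply]; abel
      rw [this]; exact hlim.sub hx
    have hg : (x, y - x) ∈ (H.op.graph : Set (𝓗 × 𝓗)) := by
      refine IsClosed.mem_of_tendsto (H.selfAdjoint.isClosed) (hx.prodMk_nhds hH)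
        (Eventually.of_forall fun n => H.op.mem_graph (v n))
    obtain ⟨z, hz1, hz2⟩ := (LinearPMap.mem_graph_iff _).1 hg
    refine ⟨z, ?_⟩
    rw [oneAdd_apply, hz2, hz1]
    simp
  have : CompleteSpace (LinearMap.range H.oneAdd) := hclosed.completeSpace_coe
  rw [← LinearMap.range_eq_top, ← Submodule.orthogonal_eq_bot_iff, Submodule.eq_bot_iff]
  intro y hy
  have h0 : ∀ x : H.op.domain, ⟪-y, (x : 𝓗)⟫_ℂ = ⟪y, H.op x⟫_ℂ := by
    intro x
    have h := (Submodule.mem_orthogonal' _ _).1 hy (H.oneAdd x) ⟨x, rfl⟩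
    rw [oneAdd_apply, inner_add_right] at h
    rw [inner_neg_left]
    exact neg_eq_of_add_eq_zero_right h
  have hmem : y ∈ H.op.adjoint.domain := LinearPMap.mem_adjoint_domain_of_exists y ⟨-y, h0⟩
  have e : H.op.adjoint = H.op := H.selfAdjoint
  have hmem' : y ∈ H.op.domain := by rw [← e]; exact hmem
  have h1 := h0 ⟨y, hmem'⟩
  rw [inner_neg_left] at h1
  have h2 := H.nonneg ⟨y, hmem'⟩
  rw [← h1, Complex.neg_re] at h2
  have h3 : (⟪y, y⟫_ℂ).re = ‖y‖ * ‖y‖ := inner_self_eq_norm_mul_norm (𝕜 := ℂ) y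
  rw [h3] at h2
  have : ‖y‖ = 0 := by nlinarith [norm_nonneg y]
  exact norm_eq_zero.1 this

/-- The bijection `1 + H` from the domain of `H` onto the space. -/
def oneAddEquiv : H.op.domain ≃ₗ[ℂ] 𝓗 :=
  LinearEquiv.ofBijective H.oneAdd ⟨H.oneAdd_injective, H.oneAdd_surjective⟩

/-- The bounded operator `(1 + H)⁻¹`. -/
def resolvent : 𝓗 →L[ℂ] 𝓗 :=
  LinearMap.mkContinuous (H.op.domain.subtype ∘ₗ H.oneAddEquiv.symm.toLinearMap) 1 fun y => by
    have h := H.norm_le (H.oneAddEquiv.symm y)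
    rw [← oneAdd_apply] at h
    have e : H.oneAdd (H.oneAddEquiv.symm y) = y := H.oneAddEquiv.apply_symm_apply y
    rw [e] at h
    simpa using h

theorem resolvent_mem (y : 𝓗) : H.resolvent y ∈ H.op.domain := (H.oneAddEquiv.symm y).2

theorem resolvent_spec (y : 𝓗) :
    H.resolvent y + H.op ⟨H.resolvent y, H.resolvent_mem y⟩ = y :=
  H.oneAddEquiv.apply_symm_apply y

theorem resolvent_selfAdjoint : IsSelfAdjoint H.resolvent := by
  rw [ContinuousLinearMap.isSelfAdjoint_iff_isSymmetric]
  intro x y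
  change ⟪H.resolvent x, y⟫_ℂ = ⟪x, H.resolvent y⟫_ℂ
  conv_lhs => rw [← H.resolvent_spec y]
  conv_rhs => rw [← H.resolvent_spec x]
  rw [inner_add_left, inner_add_right,
    H.symm ⟨_, H.resolvent_mem x⟩ ⟨_, H.resolvent_mem y⟩]

/-- The functional calculus of `H`: a function `f` of `H` is the function
`x ↦ f (x⁻¹ - 1)` of `(1 + H)⁻¹`, whose spectrum lies in `[0, 1]`. Here `f = e^{-λ ·}`, and the
function takes its limit `0` at `x = 0`, so that it is continuous for `λ > 0`. -/
def expNeg (l : ℝ) : 𝓗 →L[ℂ] 𝓗 :=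
  cfc (fun x : ℝ => if x ≤ 0 then 0 else Real.exp (-l * (x⁻¹ - 1))) H.resolvent

/-- `g(H) = inf {λ > 0 : Tr e^{-λ H} < +∞}`, equal to `+∞` if there is no such `λ`. -/
def g : ℝ≥0∞ := ⨅ l ∈ {l : ℝ | 0 < l ∧ posTrace (H.expNeg l) < ⊤}, ENNReal.ofReal l

/-- The spectral projector `Pₙ` of `H` for the interval `[0, n]`, that is, the spectral projector
of `(1 + H)⁻¹` for `[(n + 1)⁻¹, 1]`: the orthogonal projector onto the kernel of the negative part
of `(1 + H)⁻¹ - (n + 1)⁻¹`. -/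
def spectralProj (n : ℕ) : 𝓗 →L[ℂ] 𝓗 :=
  (cfc (fun x : ℝ => max 0 (((n : ℝ) + 1)⁻¹ - x)) H.resolvent : 𝓗 →L[ℂ] 𝓗).ker.starProjection

/-- The bounded operator `Pₙ H = H Pₙ`: the spectral projector `Pₙ` followed by `min(H, n)`. -/
def cutoff (n : ℕ) : 𝓗 →L[ℂ] 𝓗 :=
  cfc (fun x : ℝ => (max x ((n : ℝ) + 1)⁻¹)⁻¹ - 1) H.resolvent ∘L H.spectralProj n

/-- The range of `Pₙ` lies in the domain of `H`, and `cutoff n` is indeed `H Pₙ`. -/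
theorem cutoff_spec (n : ℕ) (x : 𝓗) :
    ∃ h : H.spectralProj n x ∈ H.op.domain, H.op ⟨H.spectralProj n x, h⟩ = H.cutoff n x := by
  set c : ℝ := ((n : ℝ) + 1)⁻¹ with hc
  have hc0 : 0 < c := by positivity
  set y := H.spectralProj n x with hy
  have hker : cfc (fun x : ℝ => max 0 (c - x)) H.resolvent y = 0 :=
    Submodule.starProjection_apply_mem
      (cfc (fun x : ℝ => max 0 (c - x)) H.resolvent : 𝓗 →L[ℂ] 𝓗).ker x
  have hcont : Continuous fun x : ℝ => (max x c)⁻¹ :=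
    (continuous_id.max continuous_const).inv₀ fun x => (lt_max_of_lt_right hc0).ne'
  set F := cfc (fun x : ℝ => (max x c)⁻¹) H.resolvent with hF
  have h1 : H.resolvent * F
      = 1 - c⁻¹ • cfc (fun x : ℝ => max 0 (c - x)) H.resolvent := by
    have ha := H.resolvent_selfAdjoint
    rw [hF]
    nth_rewrite 1 [← cfc_id ℝ H.resolvent ha]
    rw [← cfc_mul (fun x : ℝ => id x) _ H.resolvent continuousOn_id hcont.continuousOn,
      ← cfc_one ℝ H.resolvent ha,
      ← cfc_smul c⁻¹ _ H.resolvent (by fun_prop),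
      ← cfc_sub _ _ H.resolvent (by fun_prop) (by fun_prop)]
    congr 1
    funext t
    simp only [id, Pi.one_apply, smul_eq_mul]
    rcases le_total t c with h | h
    · rw [max_eq_right h, max_eq_right (by linarith)]; field_simp; ring
    · rw [max_eq_left h, max_eq_left (by linarith)]
      rw [mul_inv_cancel₀ (by linarith)]; simp
  have h2 : H.resolvent (F y) = y := by
    have := congrArg (fun A : 𝓗 →L[ℂ] 𝓗 => A y) h1
    simpa [hker] using this
  have h3 : H.cutoff n x = F y - y := by
    change cfc (fun x : ℝ => (max x c)⁻¹ - 1) H.resolvent y = _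
    rw [cfc_sub _ _ H.resolvent hcont.continuousOn (by fun_prop),
      cfc_const_one ℝ H.resolvent H.resolvent_selfAdjoint]
    rfl
  have hm := H.resolvent_mem (F y)
  have hs := H.resolvent_spec (F y)
  have hm' : y ∈ H.op.domain := h2 ▸ hm
  refine ⟨hm', ?_⟩
  have e : (⟨H.resolvent (F y), hm⟩ : H.op.domain) = ⟨y, hm'⟩ := Subtype.ext h2
  rw [e, h2] at hs
  rw [h3]
  exact eq_sub_of_add_eq' hs

/-- The mean energy `Tr Hρ`: the limit of the nondecreasing sequence `Tr Pₙ Hρ`. -/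
def energy (ρ : 𝓗 →L[ℂ] 𝓗) : ℝ≥0∞ :=
  ⨆ n : ℕ, ENNReal.ofReal (trace (H.cutoff n ∘L ρ)).re

/-- The set of states with mean energy not exceeding `E`. -/
def constrained (E : ℝ) : Set (𝓗 →L[ℂ] 𝓗) := {ρ | IsState ρ ∧ H.energy ρ ≤ ENNReal.ofReal E}

/-- A sequence in the energy-constrained set converging to the state `ρ₀`. -/
def ConvergesIn (E : ℝ) (ρ : ℕ → 𝓗 →L[ℂ] 𝓗) (ρ₀ : 𝓗 →L[ℂ] 𝓗) : Prop :=
  (∀ n, ρ n ∈ H.constrained E) ∧ IsState ρ₀ ∧ TraceTendsto ρ ρ₀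

/-- A representation `H = ∑ₖ Eₖ |k⟩⟨k|` with an orthonormal basis `|0⟩, |1⟩, …` and
`E₀ ≤ E₁ ≤ …`. There are `N` basis vectors, where `N = +∞` if the space is infinite-dimensional. -/
structure Eigenbasis where
  N : ℕ∞
  basis : HilbertBasis {k : ℕ // (k : ℕ∞) < N} ℂ 𝓗
  level : {k : ℕ // (k : ℕ∞) < N} → ℝ
  level_mono : Monotone level
  mem_domain : ∀ k, basis k ∈ H.op.domain
  eigen : ∀ k, H.op ⟨basis k, mem_domain k⟩ = (level k : ℂ) • basis k

variable {H}

/-- The rearrangement `ρ↓ = ∑ₖ λₖ |k⟩⟨k|`, where `λₖ` are the eigenvalues of `ρ` in decreasing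
order. -/
def Eigenbasis.rearrange (B : H.Eigenbasis) (ρ : 𝓗 →L[ℂ] 𝓗) : 𝓗 →L[ℂ] 𝓗 :=
  ∑' k : {k : ℕ // (k : ℕ∞) < B.N},
    (decreasingEigenvalue ρ k : ℂ) • InnerProductSpace.rankOne ℂ (B.basis k) (B.basis k)

end Hamiltonian

end QEntropy

end

noncomputable section

set_option linter.unusedSectionVars false

namespace QEntropy

variable {𝓗 : Type*} [NormedAddCommGroup 𝓗] [InnerProductSpace ℂ 𝓗] [CompleteSpace 𝓗]

/-! ### Operators that are diagonal in a Hilbert basis -/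

/-! Upper bounds. The first two come from exact identities `F(σ) + D(σ) = a · G(σ) + C` on states,
with finite constants `a`, `C` and a series `D` of nonnegative terms, each continuous in `σ`. By
Fatou `D` is lower semicontinuous, so along a converging sequence `F` jumps by at most `a` times the
jump of `G` (`limsup_sub_le`).

For the entropy against the energy of `σ↓`, take `l` with `Tr e^{-lH} < ∞`, `a = l` and `C = ∑
e^{-1-lEₖ}`. Here `D` is the relative entropy (in Lindblad's form for unnormalised operators) of
`σ↓` with respect to the weights `e^{-1-lEₖ}` (`entropy_add`); letting `l` tend to `g(H)` gives the
first bound. For the energy of `σ↓` against that of `σ`, take `a = 1` and `C = 0`. Summation by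
parts turns the difference into `∑ⱼ (Eⱼ₊₁ - Eⱼ)` times the excess of the first `j + 1` eigenvalues
over the first `j + 1` populations (`energy_rearrange_add`). Ky Fan's principle makes the excess
nonnegative, and also gives the continuity of the ordered eigenvalues. The last bound only says that
the energy is at most `E` along the sequence and at least `E₀` at the limit.

Sharpness. Mix a pure state `φ` with a fraction `pₙ → 0` of the uniform mixture of `dₙ` orthonormal
vectors of energy at most `xₙ`. The limit is pure and the entropies are at least `pₙ log dₙ`
(`exists_convergesIn_entropy_ge`). If some spectral subspace for `[0, m]` is infinite-dimensional,
`dₙ` is unrestricted and the jump is infinite. Otherwise `H` has an eigenbasis, and the divergence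
of `Tr e^{-l'H}` for `l' < g(H)` forces `l Eₖ < log k` for arbitrarily large `k` whenever `0 < l <
l'`. With `φ = |0⟩`, `dₙ = k` and `pₙ = (E - E₀)/(Eₖ - E₀)` the entropy is at least `l (E - E₀)`,
and `l` increases to `g(H)`; for `g(H) = 0` a constant sequence suffices. When `g(H)` is finite,
reaching the outermost bound collapses the whole chain to equalities, so one sequence settles both A
and B. -/

theorem hasSum_inner_apply {ι : Type*} (b : HilbertBasis ι ℂ 𝓗) (A : 𝓗 →L[ℂ] 𝓗) (x : 𝓗) (y : 𝓗) :
    HasSum (fun k => ⟪b k, x⟫_ℂ * ⟪y, A (b k)⟫_ℂ) ⟪y, A x⟫_ℂ := by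
  have h := (b.hasSum_repr x).mapL ((innerSL ℂ y).comp A)
  simpa [HilbertBasis.repr_apply_apply, inner_smul_right] using h

theorem hasSum_inner_self_apply {ι : Type*} (b : HilbertBasis ι ℂ 𝓗) {A : 𝓗 →L[ℂ] 𝓗} {a : ι → ℝ}
    (hA : ∀ k, A (b k) = (a k : ℂ) • b k) (x : 𝓗) :
    HasSum (fun k => a k * ‖⟪b k, x⟫_ℂ‖ ^ 2) (⟪x, A x⟫_ℂ).re := by
  have h := Complex.hasSum_re (hasSum_inner_apply b A x x)
  refine h.congr_fun fun k => ?_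
  rw [hA, inner_smul_right, ← inner_conj_symm x (b k), ← Complex.normSq_eq_norm_sq,
    mul_left_comm, Complex.mul_conj, ← Complex.ofReal_mul, Complex.ofReal_re]

theorem hasSum_norm_inner_sq {ι : Type*} (b : HilbertBasis ι ℂ 𝓗) (x : 𝓗) :
    HasSum (fun k => ‖⟪b k, x⟫_ℂ‖ ^ 2) (‖x‖ ^ 2) := by
  have h := hasSum_inner_self_apply b (A := ContinuousLinearMap.id ℂ 𝓗) (a := fun _ => 1)
    (fun k => by simp) x
  have h2 : (⟪x, x⟫_ℂ).re = ‖x‖ ^ 2 := by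
    rw [sq]; exact inner_self_eq_norm_mul_norm (𝕜 := ℂ) x
  rw [ContinuousLinearMap.id_apply, h2] at h
  simpa using h

theorem tsum_ofReal_norm_inner_sq {ι : Type*} (b : HilbertBasis ι ℂ 𝓗) (x : 𝓗) :
    ∑' k, ENNReal.ofReal (‖⟪b k, x⟫_ℂ‖ ^ 2) = ENNReal.ofReal (‖x‖ ^ 2) := by
  have h := hasSum_norm_inner_sq b x
  rw [← h.tsum_eq, ENNReal.ofReal_tsum_of_nonneg (fun _ => by positivity) h.summable]

theorem ofReal_inner_self_apply {ι : Type*} (b : HilbertBasis ι ℂ 𝓗) {A : 𝓗 →L[ℂ] 𝓗} {a : ι → ℝ}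
    (ha : ∀ k, 0 ≤ a k) (hA : ∀ k, A (b k) = (a k : ℂ) • b k) (x : 𝓗) :
    ENNReal.ofReal (⟪x, A x⟫_ℂ).re
      = ∑' k, ENNReal.ofReal (a k) * ENNReal.ofReal (‖⟪b k, x⟫_ℂ‖ ^ 2) := by
  have h := hasSum_inner_self_apply b hA x
  rw [← h.tsum_eq, ENNReal.ofReal_tsum_of_nonneg (fun k => mul_nonneg (ha k) (by positivity))
    h.summable]
  exact tsum_congr fun k => ENNReal.ofReal_mul (ha k)

/-- Evaluation at `e` is compatible with constants, the identity, sums, products and uniform limits,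
so Stone–Weierstrass gives every continuous function on the spectrum. This is how all functions of
`H` and of states are computed below. -/
theorem cfc_apply_eigenvector {A : 𝓗 →L[ℂ] 𝓗} (hA : IsSelfAdjoint A) {f : ℝ → ℝ}
    (hf : ContinuousOn f (spectrum ℝ A)) {e : 𝓗} {r : ℝ} (he : A e = (r : ℂ) • e) :
    cfc f A e = (f r : ℂ) • e := by
  by_cases he0 : e = 0
  · simp [he0]
  have hr : r ∈ spectrum ℝ A := by
    rw [spectrum.mem_iff]
    intro hu
    have h0 : (algebraMap ℝ (𝓗 →L[ℂ] 𝓗) r - A) e = 0 := by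
      rw [sub_apply, he, Algebra.algebraMap_eq_smul_one]
      simp
    obtain ⟨u, hu⟩ := hu
    have h1 : (↑u⁻¹ * (u : 𝓗 →L[ℂ] 𝓗)) e = 0 := by
      rw [hu, mul_apply_eq_comp, h0, map_zero]
    rw [Units.inv_mul] at h1
    exact he0 h1
  have key : ∀ g : C(spectrum ℝ A, ℝ), cfcHom hA g e = (g ⟨r, hr⟩ : ℂ) • e := by
    intro g
    induction g using ContinuousMap.induction_on_of_compact with
    | const s =>
      have : (ContinuousMap.const (spectrum ℝ A) s) = algebraMap ℝ C(spectrum ℝ A, ℝ) s := rfl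
      rw [this, AlgHomClass.commutes, Algebra.algebraMap_eq_smul_one]
      simp
    | id => rw [cfcHom_id]; simpa using he
    | star_id => rw [map_star, cfcHom_id, hA.star_eq]; simpa using he
    | add f g hf hg => rw [map_add, add_apply, hf, hg]; simp [add_smul]
    | mul f g hf hg =>
      rw [map_mul, mul_apply_eq_comp, hg, map_smul, hf, smul_smul]
      simp [mul_comm]
    | frequently f hf =>
      have hcl : IsClosed {g : C(spectrum ℝ A, ℝ) | cfcHom hA g e = (g ⟨r, hr⟩ : ℂ) • e} := by
        refine isClosed_eq ?_ ?_
        · exact (ContinuousLinearMap.apply ℂ 𝓗 e).continuous.comp (cfcHom_continuous hA)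
        · have : Continuous fun g : C(spectrum ℝ A, ℝ) => g ⟨r, hr⟩ :=
            continuous_eval_const _
          fun_prop
      exact hcl.mem_of_frequently_of_tendsto hf tendsto_id
  rw [cfc_apply f A hA hf, key]
  rfl

/-! ### The trace of positive operators -/

/-- With `S = √A` both sides are squared Hilbert–Schmidt norms `∑ ‖S bᵢ‖²`; expand by Parseval in
the other basis, interchange the sums, and use `S* = S`. -/
theorem tsum_inner_apply_eq {ι κ : Type*} (b : HilbertBasis ι ℂ 𝓗) (c : HilbertBasis κ ℂ 𝓗)
    {A : 𝓗 →L[ℂ] 𝓗} (hA : A.IsPositive) :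
    ∑' i, ENNReal.ofReal (⟪b i, A (b i)⟫_ℂ).re = ∑' i, ENNReal.ofReal (⟪c i, A (c i)⟫_ℂ).re := by
  have hA0 : 0 ≤ A := (ContinuousLinearMap.nonneg_iff_isPositive A).2 hA
  set S := CFC.sqrt A with hS
  have hSS : S * S = A := CFC.sqrt_mul_sqrt_self A hA0
  have hSp : S.IsPositive := (ContinuousLinearMap.nonneg_iff_isPositive S).1 (CFC.sqrt_nonneg A)
  have key : ∀ x : 𝓗, (⟪x, A x⟫_ℂ).re = ‖S x‖ ^ 2 := by
    intro x
    rw [← hSS, mul_apply_eq_comp, ← hSp.inner_left_eq_inner_right, sq]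
    exact inner_self_eq_norm_mul_norm (𝕜 := ℂ) (S x)
  simp only [key]
  calc ∑' i, ENNReal.ofReal (‖S (b i)‖ ^ 2)
      = ∑' i, ∑' j, ENNReal.ofReal (‖⟪c j, S (b i)⟫_ℂ‖ ^ 2) := by
        simp only [tsum_ofReal_norm_inner_sq]
    _ = ∑' j, ∑' i, ENNReal.ofReal (‖⟪c j, S (b i)⟫_ℂ‖ ^ 2) := ENNReal.tsum_comm
    _ = ∑' j, ∑' i, ENNReal.ofReal (‖⟪b i, S (c j)⟫_ℂ‖ ^ 2) := by
        refine tsum_congr fun j => tsum_congr fun i => ?_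
        rw [← hSp.inner_left_eq_inner_right, norm_inner_symm]
    _ = ∑' i, ENNReal.ofReal (‖S (c i)‖ ^ 2) := by
        simp only [tsum_ofReal_norm_inner_sq]

theorem posTrace_eq_tsum {ι : Type*} (b : HilbertBasis ι ℂ 𝓗) {A : 𝓗 →L[ℂ] 𝓗}
    (hA : A.IsPositive) : posTrace A = ∑' i, ENNReal.ofReal (⟪b i, A (b i)⟫_ℂ).re :=
  tsum_inner_apply_eq _ b hA

theorem re_inner_eigenvector {ι : Type*} (b : HilbertBasis ι ℂ 𝓗) {A : 𝓗 →L[ℂ] 𝓗} {i : ι} {a : ℝ}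
    (h : A (b i) = (a : ℂ) • b i) : (⟪b i, A (b i)⟫_ℂ).re = a := by
  rw [h, inner_smul_right, inner_self_eq_norm_sq_to_K, b.orthonormal.1 i]
  simp

theorem posTrace_eq_tsum_eigenvalue {ι : Type*} (b : HilbertBasis ι ℂ 𝓗) {A : 𝓗 →L[ℂ] 𝓗}
    (hA : A.IsPositive) {a : ι → ℝ} (h : ∀ i, A (b i) = (a i : ℂ) • b i) :
    posTrace A = ∑' i, ENNReal.ofReal (a i) := by
  rw [posTrace_eq_tsum b hA]
  exact tsum_congr fun i => by rw [re_inner_eigenvector b (h i)]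

theorem exists_hilbertBasis_extending {ι : Type*} {v : ι → 𝓗} (hv : Orthonormal ℂ v) :
    ∃ (w : Set 𝓗) (b : HilbertBasis w ℂ 𝓗) (j : ι → w), Function.Injective j ∧
      ∀ i, b (j i) = v i := by
  have h : Orthonormal ℂ (Subtype.val : Set.range v → 𝓗) := hv.toSubtypeRange
  obtain ⟨w, b, hw, hb⟩ := h.exists_hilbertBasis_extension
  refine ⟨w, b, fun i => ⟨v i, hw ⟨i, rfl⟩⟩, fun i i' hi => ?_, fun i => by rw [hb]⟩
  exact hv.linearIndependent.injective (by simpa using hi)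

theorem tsum_orthonormal_le_posTrace {ι : Type*} {v : ι → 𝓗} (hv : Orthonormal ℂ v)
    {A : 𝓗 →L[ℂ] 𝓗} (hA : A.IsPositive) :
    ∑' i, ENNReal.ofReal (⟪v i, A (v i)⟫_ℂ).re ≤ posTrace A := by
  obtain ⟨κ, b, j, hj, hb⟩ := exists_hilbertBasis_extending hv
  rw [posTrace_eq_tsum b hA]
  simp only [← hb]
  exact ENNReal.tsum_comp_le_tsum_of_injective hj
    fun i => ENNReal.ofReal (⟪b i, A (b i)⟫_ℂ).re

/-- A unit vector extends to an orthonormal basis, so `‖√A x‖² = ⟨x|A|x⟩` is one term of the trace;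
then `‖A‖ ≤ ‖√A‖²`. -/
theorem norm_le_posTrace {A : 𝓗 →L[ℂ] 𝓗} (hA : A.IsPositive) :
    ENNReal.ofReal ‖A‖ ≤ posTrace A := by
  have hA0 : 0 ≤ A := (ContinuousLinearMap.nonneg_iff_isPositive A).2 hA
  set S := CFC.sqrt A with hS
  have hSS : S * S = A := CFC.sqrt_mul_sqrt_self A hA0
  have hSp : S.IsPositive := (ContinuousLinearMap.nonneg_iff_isPositive S).1 (CFC.sqrt_nonneg A)
  have key : ∀ x : 𝓗, (⟪x, A x⟫_ℂ).re = ‖S x‖ ^ 2 := by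
    intro x
    rw [← hSS, mul_apply_eq_comp, ← hSp.inner_left_eq_inner_right, sq]
    exact inner_self_eq_norm_mul_norm (𝕜 := ℂ) (S x)
  by_cases htop : posTrace A = ⊤
  · rw [htop]; exact le_top
  have hunit : ∀ x : 𝓗, ‖x‖ = 1 → ‖S x‖ ^ 2 ≤ (posTrace A).toReal := by
    intro x hx
    have hv : Orthonormal ℂ (fun _ : Unit => x) :=
      ⟨fun _ => hx, fun i j hij => absurd (Subsingleton.elim i j) hij⟩
    have h := tsum_orthonormal_le_posTrace hv hA
    rw [tsum_fintype] at h
    simp only [key, Finset.univ_unique, Finset.sum_const, Finset.card_singleton, one_smul] at h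
    exact (ENNReal.ofReal_le_iff_le_toReal htop).1 h
  have hS2 : ‖S‖ ≤ √(posTrace A).toReal := by
    refine ContinuousLinearMap.opNorm_le_of_unit_norm (Real.sqrt_nonneg _) fun x hx => ?_
    exact Real.le_sqrt_of_sq_le (hunit x hx)
  rw [ENNReal.ofReal_le_iff_le_toReal htop]
  calc ‖A‖ = ‖S * S‖ := by rw [hSS]
    _ ≤ ‖S‖ * ‖S‖ := norm_mul_le _ _
    _ ≤ √(posTrace A).toReal * √(posTrace A).toReal := by gcongr
    _ = _ := Real.mul_self_sqrt ENNReal.toReal_nonneg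

theorem norm_le_traceNorm (A : 𝓗 →L[ℂ] 𝓗) : ENNReal.ofReal ‖A‖ ≤ traceNorm A := by
  have h := norm_le_posTrace
    ((ContinuousLinearMap.nonneg_iff_isPositive _).1 (CFC.abs_nonneg A))
  rwa [CFC.norm_abs] at h

/-- The upper bounds use trace-norm convergence only through this weaker consequence. -/
theorem TraceTendsto.tendsto {ρ : ℕ → 𝓗 →L[ℂ] 𝓗} {ρ₀ : 𝓗 →L[ℂ] 𝓗} (h : TraceTendsto ρ ρ₀) :
    Tendsto ρ atTop (𝓝 ρ₀) := by
  rw [tendsto_iff_norm_sub_tendsto_zero]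
  have h1 : Tendsto (fun n => ENNReal.ofReal ‖ρ n - ρ₀‖) atTop (𝓝 0) :=
    tendsto_of_tendsto_of_tendsto_of_le_of_le tendsto_const_nhds h (fun _ => zero_le)
      fun n => norm_le_traceNorm _
  have h2 := (ENNReal.tendsto_toReal ENNReal.zero_ne_top).comp h1
  simpa [Function.comp_def, ENNReal.toReal_ofReal (norm_nonneg _)] using h2

theorem traceNorm_eq_tsum {ι : Type*} (b : HilbertBasis ι ℂ 𝓗) {A : 𝓗 →L[ℂ] 𝓗}
    (hA : IsSelfAdjoint A) {a : ι → ℝ} (h : ∀ i, A (b i) = (a i : ℂ) • b i) :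
    traceNorm A = ∑' i, ENNReal.ofReal |a i| := by
  refine posTrace_eq_tsum_eigenvalue b
    ((ContinuousLinearMap.nonneg_iff_isPositive _).1 (CFC.abs_nonneg A)) fun i => ?_
  rw [CFC.abs_eq_cfc_norm A hA, cfc_apply_eigenvector hA (by fun_prop) (h i), Real.norm_eq_abs]

theorem sum_orthonormal_le_posTrace {ι : Type*} {v : ι → 𝓗} (hv : Orthonormal ℂ v)
    {A : 𝓗 →L[ℂ] 𝓗} (hA : A.IsPositive) (s : Finset ι) :
    ENNReal.ofReal (∑ i ∈ s, (⟪v i, A (v i)⟫_ℂ).re) ≤ posTrace A := by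
  rw [ENNReal.ofReal_sum_of_nonneg (f := fun i => (⟪v i, A (v i)⟫_ℂ).re)
    fun i _ => hA.re_inner_nonneg_right (v i)]
  exact (ENNReal.sum_le_tsum s).trans (tsum_orthonormal_le_posTrace hv hA)

/-! ### Compactness -/

/-- The truncations `(A - 1/(n+1))₊` converge to `A` in norm and are annihilated by `(1/(n+1) -
A)₊`, so each maps into a finite-dimensional kernel. -/
theorem isCompactOperator_of_finiteDimensional_ker {A : 𝓗 →L[ℂ] 𝓗} (hA : IsSelfAdjoint A)
    (hs : ∀ x ∈ spectrum ℝ A, 0 ≤ x)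
    (h : ∀ n : ℕ, FiniteDimensional ℂ
      (cfc (fun x : ℝ => max 0 (((n : ℝ) + 1)⁻¹ - x)) A : 𝓗 →L[ℂ] 𝓗).ker) :
    IsCompactOperator A := by
  set F : ℕ → 𝓗 →L[ℂ] 𝓗 := fun n => cfc (fun x : ℝ => max 0 (x - ((n : ℝ) + 1)⁻¹)) A with hF
  refine isCompactOperator_of_tendsto (l := atTop) (F := F) ?_ (Eventually.of_forall fun n => ?_)
  · rw [tendsto_iff_norm_sub_tendsto_zero]
    refine squeeze_zero (fun _ => norm_nonneg _) (fun n => ?_) tendsto_one_div_add_atTop_nhds_zero_nat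
    have : F n - A = cfc (fun x : ℝ => max 0 (x - ((n : ℝ) + 1)⁻¹) - id x) A := by
      rw [cfc_sub (fun x : ℝ => max 0 (x - ((n : ℝ) + 1)⁻¹)) id A (by fun_prop) (by fun_prop),
        cfc_id ℝ A hA]
    rw [this]
    have hn : 0 ≤ ((n : ℝ) + 1)⁻¹ := by positivity
    rw [one_div]
    refine norm_cfc_le hn fun x hx => ?_
    have hx0 := hs x hx
    rw [Real.norm_eq_abs, abs_le, id]
    rcases le_total 0 (x - ((n : ℝ) + 1)⁻¹) with h1 | h1
    · rw [max_eq_right h1]; constructor <;> linarith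
    · rw [max_eq_left h1]; constructor <;> linarith
  · set K := (cfc (fun x : ℝ => max 0 (((n : ℝ) + 1)⁻¹ - x)) A : 𝓗 →L[ℂ] 𝓗).ker with hK
    have hmem : ∀ x, F n x ∈ K := by
      intro x
      have h0 : cfc (fun x : ℝ => max 0 (((n : ℝ) + 1)⁻¹ - x)) A * F n = 0 := by
        rw [hF]
        simp only
        rw [← cfc_mul _ _ A (by fun_prop) (by fun_prop), ← cfc_zero ℝ A]
        congr 1
        funext t
        rcases le_total t ((n : ℝ) + 1)⁻¹ with h1 | h1
        · simp [max_eq_left (sub_nonpos.2 h1)]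
        · simp [max_eq_left (sub_nonpos.2 h1)]
      have := congrArg (fun T : 𝓗 →L[ℂ] 𝓗 => T x) h0
      simpa [hK] using this
    have hc : IsCompactOperator ((F n).codRestrict K hmem) := by
      have : ProperSpace K := FiniteDimensional.proper ℂ K
      exact isCompactOperator_of_locallyCompactSpace_dom ((F n).codRestrict K hmem)
    exact hc.clm_comp K.subtypeL

theorem exists_orthonormal_fin {V : Type*} [NormedAddCommGroup V] [InnerProductSpace ℂ V]
    (hV : ¬ FiniteDimensional ℂ V) (d : ℕ) : ∃ v : Fin d → V, Orthonormal ℂ v := by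
  obtain ⟨s, hs⟩ := exists_finset_linearIndependent_of_le_rank (R := ℂ) (M := V) (n := d)
    (by
      have : Cardinal.aleph0 ≤ Module.rank ℂ V := by
        rw [← not_lt, Module.rank_lt_aleph0_iff]; exact hV
      exact (Cardinal.natCast_le_aleph0).trans this)
  have hfin : FiniteDimensional ℂ (Submodule.span ℂ (s : Set V)) :=
    FiniteDimensional.span_finset ℂ s
  have hrank : Module.finrank ℂ (Submodule.span ℂ (s : Set V)) = d := by
    rw [finrank_span_finset_eq_card hs.2, hs.1]
  let b := stdOrthonormalBasis ℂ (Submodule.span ℂ (s : Set V))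
  let e : Fin d ≃ Fin (Module.finrank ℂ (Submodule.span ℂ (s : Set V))) := finCongr hrank.symm
  have h1 : Orthonormal ℂ fun i => b (e i) := b.orthonormal.comp e e.injective
  exact ⟨fun i => b (e i), h1.comp_linearIsometry (Submodule.span ℂ (s : Set V)).subtypeₗᵢ⟩

theorem spectrum_nonneg {A : 𝓗 →L[ℂ] 𝓗} (hA : A.IsPositive) : ∀ x ∈ spectrum ℝ A, 0 ≤ x :=
  fun _ hx => spectrum_nonneg_of_nonneg ((ContinuousLinearMap.nonneg_iff_isPositive A).2 hA) hx

/-- If `h(A)` has finite trace, where `h` is continuous, nonnegative and bounded away from `0` on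
each half-line `[c, ∞)` with `c > 0`, then the spectral subspaces of `A` for these half-lines are
finite-dimensional. -/
theorem finiteDimensional_ker_of_posTrace_lt_top {A : 𝓗 →L[ℂ] 𝓗} (hA : A.IsPositive)
    {h : ℝ → ℝ} (hc : ContinuousOn h (spectrum ℝ A)) (h0 : ∀ x ∈ spectrum ℝ A, 0 ≤ h x)
    (hpos : ∀ c > 0, ∃ δ > 0, ∀ x ∈ spectrum ℝ A, c ≤ x → δ ≤ h x)
    (htr : posTrace (cfc h A) < ⊤) {c : ℝ} (hcpos : 0 < c) :
    FiniteDimensional ℂ (cfc (fun x : ℝ => max 0 (c - x)) A : 𝓗 →L[ℂ] 𝓗).ker := by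
  by_contra hK
  obtain ⟨δ, hδ, hδh⟩ := hpos (c / 2) (by positivity)
  have hAs := hA.isSelfAdjoint
  -- On the spectrum `δ ≤ h(x) + (2δ/c) (c - x)₊`: the first term suffices for `x ≥ c/2`, the second
  -- for `x ≤ c/2`. The second operator vanishes on the kernel, so every unit vector there
  -- contributes at least `δ` to the trace of `h(A)`.
  have hle : (algebraMap ℝ (𝓗 →L[ℂ] 𝓗) δ : 𝓗 →L[ℂ] 𝓗)
      ≤ cfc h A + (2 * δ / c) • cfc (fun x : ℝ => max 0 (c - x)) A := by
    rw [← cfc_const δ A hAs, ← cfc_smul (2 * δ / c) _ A (by fun_prop),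
      ← cfc_add (R := ℝ) (a := A) h _ hc (by fun_prop)]
    refine cfc_mono (fun x hx => ?_) (by fun_prop) (by fun_prop)
    simp only [smul_eq_mul]
    rcases le_total (c / 2) x with h1 | h1
    · have := hδh x hx h1
      have : 0 ≤ 2 * δ / c * max 0 (c - x) := by positivity
      linarith
    · have h2 := h0 x hx
      have h3 : c / 2 ≤ max 0 (c - x) := le_max_of_le_right (by linarith)
      have h4 : 2 * δ / c * (c / 2) ≤ 2 * δ / c * max 0 (c - x) := by gcongr
      have h5 : 2 * δ / c * (c / 2) = δ := by field_simp
      linarith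
  have hpos' : (cfc h A : 𝓗 →L[ℂ] 𝓗).IsPositive :=
    (ContinuousLinearMap.nonneg_iff_isPositive _).1 (cfc_nonneg h0)
  have hbound : ∀ d : ℕ, ENNReal.ofReal (d * δ) ≤ posTrace (cfc h A) := by
    intro d
    obtain ⟨u, hu⟩ := exists_orthonormal_fin hK d
    set v : Fin d → 𝓗 := fun i => (u i : 𝓗)
    have hv : Orthonormal ℂ v := hu.comp_linearIsometry (Submodule.subtypeₗᵢ _)
    refine le_trans (ENNReal.ofReal_le_ofReal ?_) (sum_orthonormal_le_posTrace hv hpos' Finset.univ)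
    have : (d : ℝ) * δ = ∑ _i : Fin d, δ := by simp
    rw [this]
    refine Finset.sum_le_sum fun i _ => ?_
    have h1 := (ContinuousLinearMap.le_def _ _).1 hle |>.re_inner_nonneg_right (v i)
    have h2 : cfc (fun x : ℝ => max 0 (c - x)) A (v i) = 0 := (u i).2
    simp only [sub_apply, add_apply,
      smul_apply, h2, smul_zero, add_zero, inner_sub_right, map_sub] at h1
    have h3 : (⟪v i, (algebraMap ℝ (𝓗 →L[ℂ] 𝓗) δ) (v i)⟫_ℂ).re = δ := by
      rw [Algebra.algebraMap_eq_smul_one, smul_apply,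
        one_apply_eq_self, ← Complex.coe_smul, inner_smul_right,
        inner_self_eq_norm_sq_to_K, hv.1 i]
      simp
    simp only [RCLike.re_to_complex] at h1
    linarith
  have hreal : ∀ d : ℕ, (d : ℝ) * δ ≤ (posTrace (cfc h A)).toReal := fun d =>
    (ENNReal.ofReal_le_iff_le_toReal htr.ne).1 (hbound d)
  obtain ⟨d, hd⟩ := exists_nat_gt ((posTrace (cfc h A)).toReal / δ)
  rw [div_lt_iff₀ hδ] at hd
  exact absurd (hreal d) (not_le.2 hd)

theorem isCompactOperator_of_posTrace_lt_top {A : 𝓗 →L[ℂ] 𝓗} (hA : A.IsPositive)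
    {h : ℝ → ℝ} (hc : ContinuousOn h (spectrum ℝ A)) (h0 : ∀ x ∈ spectrum ℝ A, 0 ≤ h x)
    (hpos : ∀ c > 0, ∃ δ > 0, ∀ x ∈ spectrum ℝ A, c ≤ x → δ ≤ h x)
    (htr : posTrace (cfc h A) < ⊤) : IsCompactOperator A :=
  isCompactOperator_of_finiteDimensional_ker hA.isSelfAdjoint (spectrum_nonneg hA) fun n =>
    finiteDimensional_ker_of_posTrace_lt_top hA hc h0 hpos htr (by positivity)

theorem IsState.isCompactOperator {ρ : 𝓗 →L[ℂ] 𝓗} (hρ : IsState ρ) : IsCompactOperator ρ := by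
  refine isCompactOperator_of_posTrace_lt_top hρ.1 (h := id) (by fun_prop)
    (spectrum_nonneg hρ.1) (fun c hc => ⟨c, hc, fun x _ hx => hx⟩) ?_
  rw [cfc_id ℝ ρ hρ.1.isSelfAdjoint, hρ.2]
  exact ENNReal.one_lt_top

/-- A compact self-adjoint operator is diagonal in some Hilbert basis. -/
theorem exists_hilbertBasis_eigenvectors {A : 𝓗 →L[ℂ] 𝓗} (hA : IsSelfAdjoint A)
    (hc : IsCompactOperator A) :
    ∃ (w : Set 𝓗) (b : HilbertBasis w ℂ 𝓗) (a : w → ℝ), ∀ i, A (b i) = (a i : ℂ) • b i := by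
  have hsym : (A : 𝓗 →ₗ[ℂ] 𝓗).IsSymmetric := hA.isSymmetric
  have hclosed : ∀ μ : ℂ, CompleteSpace (Module.End.eigenspace (A : 𝓗 →ₗ[ℂ] 𝓗) μ) := by
    intro μ
    have : IsClosed ((Module.End.eigenspace (A : 𝓗 →ₗ[ℂ] 𝓗) μ : Submodule ℂ 𝓗) : Set 𝓗) := by
      have h1 : ((Module.End.eigenspace (A : 𝓗 →ₗ[ℂ] 𝓗) μ : Submodule ℂ 𝓗) : Set 𝓗)
          = {x | A x = μ • x} := by
        ext x; simp
      rw [h1]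
      exact isClosed_eq A.continuous (continuous_const_smul μ)
    exact this.completeSpace_coe
  choose w b hb using fun μ : ℂ =>
    exists_hilbertBasis ℂ (Module.End.eigenspace (A : 𝓗 →ₗ[ℂ] 𝓗) μ)
  have hon := hsym.orthogonalFamily_eigenspaces.orthonormal_sigma_orthonormal
    (v_family := fun μ => (b μ : w μ → _)) fun μ => (b μ).orthonormal
  set v : (Σ μ, w μ) → 𝓗 := fun a => (b a.1 a.2 : 𝓗) with hv
  have hvon : Orthonormal ℂ v := hon
  have hve : ∀ a, A (v a) = a.1 • v a := fun a =>
    Module.End.mem_eigenspace_iff.1 (b a.1 a.2).2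
  have hreal : ∀ a : Σ μ, w μ, ((a.1.re : ℝ) : ℂ) = a.1 := by
    intro a
    have h1 := hsym.conj_eigenvalue_eq_self (μ := a.1)
      (Module.End.hasEigenvalue_of_hasEigenvector ⟨(b a.1 a.2).2, hvon.ne_zero a⟩)
    exact Complex.conj_eq_iff_re.1 h1
  -- A vector orthogonal to the bases of all eigenspaces is orthogonal to the eigenspaces, and by
  -- the spectral theorem for compact operators these have no common orthogonal vector but `0`.
  have hbot : (Submodule.span ℂ (Set.range v))ᗮ = ⊥ := by
    rw [eq_bot_iff, ← ContinuousLinearMap.orthogonalComplement_iSup_eigenspaces_eq_bot hc hsym,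
      ← Submodule.iInf_orthogonal]
    refine le_iInf fun μ => ?_
    intro x hx y hy
    have h1 := (b μ).hasSum_repr ⟨y, hy⟩
    have h2 := h1.mapL ((innerSL ℂ x).comp
      (Module.End.eigenspace (A : 𝓗 →ₗ[ℂ] 𝓗) μ).subtypeL)
    have h3 : ∀ i : w μ, ⟪x, (b μ i : 𝓗)⟫_ℂ = 0 := fun i =>
      (Submodule.mem_orthogonal' _ _).1 hx _ (Submodule.subset_span ⟨⟨μ, i⟩, rfl⟩)
    have h4 : ⟪x, y⟫_ℂ = 0 := by
      refine HasSum.unique (h2 : HasSum _ ⟪x, y⟫_ℂ) ?_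
      convert hasSum_zero with i
      simp [h3]
    rw [← inner_conj_symm, h4, map_zero]
  obtain ⟨W, c, j, hj, hc'⟩ : ∃ (W : Set 𝓗) (c : HilbertBasis W ℂ 𝓗) (j : W → Σ μ, w μ),
      Function.Injective j ∧ ∀ i, c i = v (j i) := by
    let e : (Σ μ, w μ) ≃ Set.range v := Equiv.ofInjective v hvon.linearIndependent.injective
    have hon' : Orthonormal ℂ (Subtype.val : Set.range v → 𝓗) := hvon.toSubtypeRange
    refine ⟨Set.range v, HilbertBasis.mkOfOrthogonalEqBot hon' (by rwa [Subtype.range_coe]), e.symm,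
      e.symm.injective, fun i => ?_⟩
    rw [HilbertBasis.coe_mkOfOrthogonalEqBot]
    exact (congrArg Subtype.val (e.apply_symm_apply i)).symm
  refine ⟨W, c, fun i => (j i).1.re, fun i => ?_⟩
  rw [hc', hve, hreal]

theorem eigenvalue_nonneg {ι : Type*} {b : HilbertBasis ι ℂ 𝓗} {A : 𝓗 →L[ℂ] 𝓗}
    (hA : A.IsPositive) {a : ι → ℝ} (h : ∀ i, A (b i) = (a i : ℂ) • b i) (i : ι) : 0 ≤ a i := by
  have h1 : 0 ≤ (⟪b i, A (b i)⟫_ℂ).re := hA.re_inner_nonneg_right (b i)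
  rwa [re_inner_eigenvector b (h i)] at h1

/-- Expanding in both bases gives a double series dominated, through `xy ≤ x² + y²`, by one with sum
at most `(1 + ‖A‖²) ∑ rⱼ`. Fubini therefore allows the trace to be computed in the eigenbasis of
`ρ`. -/
theorem hasSum_tsum_inner_comp {ι κ : Type*} (b : HilbertBasis ι ℂ 𝓗) (f : HilbertBasis κ ℂ 𝓗)
    (A : 𝓗 →L[ℂ] 𝓗) {ρ : 𝓗 →L[ℂ] 𝓗} {r : ι → ℝ} (hρ : ∀ i, ρ (b i) = (r i : ℂ) • b i)
    (hr : Summable r) (hr0 : ∀ i, 0 ≤ r i) :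
    HasSum (fun j => (r j : ℂ) * ⟪b j, A (b j)⟫_ℂ) (∑' i, ⟪f i, A (ρ (f i))⟫_ℂ) := by
  set F : κ → ι → ℂ := fun i j => r j * (⟪b j, f i⟫_ℂ * ⟪f i, A (b j)⟫_ℂ) with hF
  have hrow : ∀ i, HasSum (F i) ⟪f i, A (ρ (f i))⟫_ℂ := by
    intro i
    refine (hasSum_inner_apply b (A ∘L ρ) (f i) (f i)).congr_fun fun j => ?_
    simp only [hF, ContinuousLinearMap.comp_apply, hρ, map_smul, inner_smul_right]
    ring
  have hcol : ∀ j, HasSum (fun i => F i j) (r j * ⟪b j, A (b j)⟫_ℂ) := fun j =>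
    (f.hasSum_inner_mul_inner (b j) (A (b j))).mul_left _
  have hbd : ∀ j, HasSum (fun i => r j * (‖⟪f i, b j⟫_ℂ‖ ^ 2 + ‖⟪f i, A (b j)⟫_ℂ‖ ^ 2))
      (r j * (‖b j‖ ^ 2 + ‖A (b j)‖ ^ 2)) := fun j =>
    ((hasSum_norm_inner_sq f (b j)).add (hasSum_norm_inner_sq f (A (b j)))).mul_left _
  have hbig : Summable fun p : ι × κ =>
      r p.1 * (‖⟪f p.2, b p.1⟫_ℂ‖ ^ 2 + ‖⟪f p.2, A (b p.1)⟫_ℂ‖ ^ 2) := by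
    rw [summable_prod_of_nonneg fun p => mul_nonneg (hr0 _) (by positivity)]
    refine ⟨fun j => (hbd j).summable, ?_⟩
    simp only [fun j => (hbd j).tsum_eq]
    refine Summable.of_nonneg_of_le (fun j => mul_nonneg (hr0 j) (by positivity)) (fun j => ?_)
      (hr.mul_right (1 + ‖A‖ ^ 2))
    have h1 : ‖A (b j)‖ ≤ ‖A‖ := by
      simpa [b.orthonormal.1 j] using A.le_opNorm (b j)
    rw [b.orthonormal.1 j, one_pow]
    exact mul_le_mul_of_nonneg_left (by gcongr) (hr0 j)
  have hsum : Summable fun p : ι × κ => F p.2 p.1 := by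
    refine Summable.of_norm (hbig.of_nonneg_of_le (fun _ => norm_nonneg _) fun p => ?_)
    simp only [hF, norm_mul, Complex.norm_real, Real.norm_eq_abs, abs_of_nonneg (hr0 p.1)]
    refine mul_le_mul_of_nonneg_left ?_ (hr0 _)
    rw [norm_inner_symm]
    nlinarith [sq_nonneg (‖⟪f p.2, b p.1⟫_ℂ‖ - ‖⟪f p.2, A (b p.1)⟫_ℂ‖),
      sq_nonneg ‖⟪f p.2, b p.1⟫_ℂ‖, sq_nonneg ‖⟪f p.2, A (b p.1)⟫_ℂ‖]
  have h1 := hsum.hasSum.prod_fiberwise hcol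
  have h3 : HasSum (fun p : κ × ι => F p.1 p.2) (∑' p : ι × κ, F p.2 p.1) :=
    (Equiv.prodComm κ ι).hasSum_iff.2 hsum.hasSum
  rwa [← (h3.prod_fiberwise hrow).tsum_eq] at h1

/-- The trace of `A ρ` for `ρ = ∑ rⱼ |j⟩⟨j|` of trace class. -/
theorem hasSum_trace_comp {ι : Type*} (b : HilbertBasis ι ℂ 𝓗) (A : 𝓗 →L[ℂ] 𝓗) {ρ : 𝓗 →L[ℂ] 𝓗}
    {r : ι → ℝ} (hρ : ∀ i, ρ (b i) = (r i : ℂ) • b i) (hr : Summable r) (hr0 : ∀ i, 0 ≤ r i) :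
    HasSum (fun j => r j * (⟪b j, A (b j)⟫_ℂ).re) (trace (A ∘L ρ)).re := by
  refine (Complex.hasSum_re (hasSum_tsum_inner_comp b (traceBasis 𝓗) A hρ hr hr0)).congr_fun
    fun j => ?_
  rw [Complex.re_ofReal_mul]

/-! ### Enumeration in increasing order -/

/-- A type with a real function whose sublevel sets are finite can be enumerated so that the
function increases. -/
theorem exists_monotone_enumeration {ι : Type*} (f : ι → ℝ) (hf : ∀ x, {i | f i ≤ x}.Finite) :
    ∃ e : {k : ℕ // (k : ℕ∞) < ENat.card ι} ≃ ι, Monotone fun k => f (e k) := by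
  classical
  -- The auxiliary order on `ι` only breaks ties between equal values of `f`; the position of `i` is
  -- the number of its predecessors.
  let : LinearOrder ι := linearOrderOfSTO WellOrderingRel
  let key : ι → ℝ ×ₗ ι := fun i => toLex (f i, i)
  have hkey : Function.Injective key := fun i j h => by
    have := congrArg (fun p => (ofLex p).2) h
    exact this
  have hkf : ∀ {i j}, key i ≤ key j → f i ≤ f j := fun {i j} h => by
    rcases Prod.Lex.le_iff.1 h with h | h
    · exact h.le
    · exact h.1.le
  have hfin : ∀ i, {j | key j < key i}.Finite := fun i =>
    (hf (f i)).subset fun j hj => hkf (le_of_lt hj)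
  let T : ι → Finset ι := fun i => (hfin i).toFinset
  have hT : ∀ i j, j ∈ T i ↔ key j < key i := fun i j => by simp [T]
  let rank : ι → ℕ := fun i => (T i).card
  have hlt : ∀ {i j}, key i < key j → rank i < rank j := fun {i j} h => by
    refine Finset.card_lt_card ((Finset.ssubset_iff_of_subset fun l hl => ?_).2 ⟨i, ?_, ?_⟩)
    · exact (hT _ _).2 (((hT _ _).1 hl).trans h)
    · exact (hT _ _).2 h
    · exact fun hi => lt_irrefl _ ((hT _ _).1 hi)
  have hinj : Function.Injective rank := fun i j h => by
    by_contra hne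
    rcases lt_or_gt_of_ne (fun h' => hne (hkey h')) with h' | h'
    · exact (hlt h').ne h
    · exact (hlt h').ne h.symm
  -- Positions have no gaps: the `rank i` predecessors of `i` are mapped injectively into the
  -- numbers below `rank i`, hence onto them.
  have hlower : ∀ i, ∀ m < rank i, ∃ j, rank j = m := fun i m hm => by
    have himg : (T i).image rank = Finset.range (rank i) := by
      refine Finset.eq_of_subset_of_card_le (fun x hx => ?_) ?_
      · obtain ⟨j, hj, rfl⟩ := Finset.mem_image.1 hx
        exact Finset.mem_range.2 (hlt ((hT _ _).1 hj))
      · rw [Finset.card_image_of_injective _ hinj, Finset.card_range]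
    obtain ⟨j, _, hj⟩ := Finset.mem_image.1 (himg ▸ Finset.mem_range.2 hm)
    exact ⟨j, hj⟩
  have hmem : ∀ i, (rank i : ℕ∞) < ENat.card ι := fun i => by
    have hi : i ∉ T i := fun hi => lt_irrefl _ ((hT _ _).1 hi)
    have h1 : ((insert i (T i) : Finset ι) : Set ι).encard ≤ ENat.card ι := by
      rw [← Set.encard_univ]; exact Set.encard_le_encard (Set.subset_univ _)
    rw [Set.encard_coe_eq_coe_finsetCard, Finset.card_insert_of_notMem hi] at h1
    exact lt_of_lt_of_le (by exact_mod_cast Nat.lt_succ_self _) h1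
  have hsurj : ∀ k : ℕ, (k : ℕ∞) < ENat.card ι → ∃ i, rank i = k := fun k hk => by
    by_contra hno
    have hlt' : ∀ i, rank i < k := fun i => by
      by_contra hge
      rcases (not_lt.1 hge).eq_or_lt with h | h
      · exact hno ⟨i, h.symm⟩
      · exact hno (hlower i k h)
    have h1 := ENat.card_le_card_of_injective (f := fun i => (⟨rank i, hlt' i⟩ : Fin k))
      fun i j h => hinj (congrArg Fin.val h)
    rw [ENat.card_eq_coe_fintype_card (α := Fin k), Fintype.card_fin] at h1
    exact absurd hk (not_lt.2 h1)
  let E : ι ≃ {k : ℕ // (k : ℕ∞) < ENat.card ι} :=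
    Equiv.ofBijective (fun i => ⟨rank i, hmem i⟩)
      ⟨fun i j h => hinj (congrArg Subtype.val h), fun k => by
        obtain ⟨i, hi⟩ := hsurj k.1 k.2
        exact ⟨i, Subtype.ext hi⟩⟩
  refine ⟨E.symm, fun k l hkl => hkf (not_lt.1 fun h => ?_)⟩
  have h1 := hlt h
  have h2 : ∀ k, rank (E.symm k) = k.1 := fun k => congrArg Subtype.val (E.apply_symm_apply k)
  rw [h2, h2] at h1
  exact absurd h1 (not_lt.2 hkl)

/-! ### The decreasing eigenvalues of a state -/

/-- The state `ρ` is `∑ rᵢ |i⟩⟨i|` in the Hilbert basis `b`. -/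
structure IsDiagonal {ι : Type*} (b : HilbertBasis ι ℂ 𝓗) (r : ι → ℝ) (ρ : 𝓗 →L[ℂ] 𝓗) : Prop where
  isState : IsState ρ
  apply : ∀ i, ρ (b i) = (r i : ℂ) • b i

theorem IsState.exists_isDiagonal {ρ : 𝓗 →L[ℂ] 𝓗} (hρ : IsState ρ) :
    ∃ (w : Set 𝓗) (b : HilbertBasis w ℂ 𝓗) (r : w → ℝ), IsDiagonal b r ρ := by
  obtain ⟨w, b, r, h⟩ := exists_hilbertBasis_eigenvectors hρ.1.isSelfAdjoint hρ.isCompactOperator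
  exact ⟨w, b, r, hρ, h⟩

namespace IsDiagonal

variable {ι : Type*} {b : HilbertBasis ι ℂ 𝓗} {r : ι → ℝ} {ρ : 𝓗 →L[ℂ] 𝓗}

theorem nonneg (h : IsDiagonal b r ρ) (i : ι) : 0 ≤ r i :=
  eigenvalue_nonneg h.isState.1 h.apply i

theorem tsum_eq_one (h : IsDiagonal b r ρ) : ∑' i, ENNReal.ofReal (r i) = 1 := by
  rw [← posTrace_eq_tsum_eigenvalue b h.isState.1 h.apply, h.isState.2]

theorem summable (h : IsDiagonal b r ρ) : Summable r := by
  have h1 := ENNReal.summable_toReal (f := fun i => ENNReal.ofReal (r i))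
    (by rw [h.tsum_eq_one]; exact ENNReal.one_ne_top)
  simpa [ENNReal.toReal_ofReal (h.nonneg _)] using h1

theorem finite_le (h : IsDiagonal b r ρ) {μ : ℝ} (hμ : 0 < μ) : {i | μ ≤ r i}.Finite := by
  have h1 := h.summable.tendsto_cofinite_zero.eventually (gt_mem_nhds hμ)
  rw [Filter.eventually_cofinite] at h1
  simpa using h1

/-- An eigenvector for `ν ≥ μ` is orthogonal to each `bᵢ` with `rᵢ < μ`, by symmetry of `ρ`, and
only finitely many `rᵢ` reach `μ`. So the rank in the definition of `decreasingEigenvalue` just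
counts diagonal entries. -/
theorem iSup_eigenspace (h : IsDiagonal b r ρ) {μ : ℝ} (hμ : 0 < μ) :
    (⨆ ν ∈ Set.Ici μ, Module.End.eigenspace (ρ : 𝓗 →ₗ[ℂ] 𝓗) (ν : ℂ))
      = Submodule.span ℂ (Set.range fun i : {i | μ ≤ r i} => b i) := by
  refine le_antisymm (iSup₂_le fun ν hν v hv => ?_) (Submodule.span_le.2 ?_)
  · have hv' : ρ v = (ν : ℂ) • v := Module.End.mem_eigenspace_iff.1 hv
    have hzero : ∀ i, ¬ μ ≤ r i → ⟪b i, v⟫_ℂ = 0 := by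
      intro i hi
      have h1 : ⟪ρ (b i), v⟫_ℂ = ⟪b i, ρ v⟫_ℂ := h.isState.1.inner_left_eq_inner_right _ _
      rw [h.apply, hv', inner_smul_left, inner_smul_right, Complex.conj_ofReal] at h1
      have h2 : ((r i : ℂ) - ν) * ⟪b i, v⟫_ℂ = 0 := by rw [sub_mul, h1, sub_self]
      refine (mul_eq_zero.1 h2).resolve_left fun h3 => hi ?_
      have : r i = ν := by exact_mod_cast sub_eq_zero.1 h3
      rw [this]; exact hν
    have hfin := h.finite_le hμ
    have h1 := b.hasSum_repr v
    have h2 : HasSum (fun i => b.repr v i • b i) (∑ i ∈ hfin.toFinset, b.repr v i • b i) := by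
      refine hasSum_sum_of_ne_finset_zero fun i hi => ?_
      rw [HilbertBasis.repr_apply_apply, hzero i (by simpa using hi), zero_smul]
    rw [h1.unique h2]
    refine Submodule.sum_mem _ fun i hi => Submodule.smul_mem _ _ (Submodule.subset_span ?_)
    exact ⟨⟨i, by simpa using hi⟩, rfl⟩
  · rintro _ ⟨i, rfl⟩
    refine Submodule.mem_iSup_of_mem (r i) (Submodule.mem_iSup_of_mem i.2 ?_)
    exact Module.End.mem_eigenspace_iff.2 (h.apply i)

theorem finrank_iSup_eigenspace (h : IsDiagonal b r ρ) {μ : ℝ} (hμ : 0 < μ) :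
    Module.finrank ℂ ↥(⨆ ν ∈ Set.Ici μ, Module.End.eigenspace (ρ : 𝓗 →ₗ[ℂ] 𝓗) (ν : ℂ))
      = (h.finite_le hμ).toFinset.card := by
  rw [h.iSup_eigenspace hμ]
  let := (h.finite_le hμ).fintype
  rw [finrank_span_eq_card, Set.Finite.card_toFinset]
  exact b.orthonormal.linearIndependent.comp _ Subtype.val_injective

/-- Bridge from the supremum definition to a sorted list: `M` is the number of positive entries, and
for `k < M` the set of admissible `μ` is the interval `(0, rₑ₍ₖ₎]`. -/
theorem decreasingEigenvalue_eq (h : IsDiagonal b r ρ) :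
    ∃ (M : ℕ∞) (e : {k : ℕ // (k : ℕ∞) < M} ≃ {i // 0 < r i}), (Antitone fun k => r (e k)) ∧
      (∀ k, decreasingEigenvalue ρ k.1 = r (e k)) ∧
      ∀ k : ℕ, M ≤ k → decreasingEigenvalue ρ k = 0 := by
  -- Reciprocals turn the decreasing order into an increasing one with finite sublevel sets, because
  -- only finitely many `rᵢ` exceed a given positive bound.
  obtain ⟨e, he⟩ := exists_monotone_enumeration (fun i : {i // 0 < r i} => (r i)⁻¹) (by
    intro x
    by_cases hx : 0 < x
    · refine Set.Finite.of_finite_image (f := Subtype.val)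
        ((h.finite_le (inv_pos.2 hx)).subset ?_) Subtype.val_injective.injOn
      rintro _ ⟨i, hi, rfl⟩
      exact inv_le_of_inv_le₀ i.2 hi
    · convert Set.finite_empty
      ext i
      simp only [Set.mem_ofPred_eq, Set.mem_empty_iff_false, iff_false, not_le]
      exact (not_lt.1 hx).trans_lt (inv_pos.2 i.2))
  generalize ENat.card {i // 0 < r i} = M at e he
  have hanti : Antitone fun k => r (e k) := fun k l hkl =>
    (inv_le_inv₀ (e k).2 (e l).2).1 (he hkl)
  have hcount : ∀ {μ : ℝ} (hμ : 0 < μ) (k : ℕ),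
      k + 1 ≤ (h.finite_le hμ).toFinset.card ↔ ∃ hk : (k : ℕ∞) < M, μ ≤ r (e ⟨k, hk⟩) := by
    intro μ hμ k
    constructor
    · intro hk
      by_contra hno
      have hlt : ∀ l, μ ≤ r (e l) → l.1 < k := by
        intro l hl
        by_contra hkl
        have hk' : (k : ℕ∞) < M := lt_of_le_of_lt (by exact_mod_cast not_lt.1 hkl) l.2
        exact hno ⟨hk', hl.trans (hanti (a := ⟨k, hk'⟩) (not_lt.1 hkl))⟩
      have hle : (h.finite_le hμ).toFinset.card ≤ (Finset.range k).card := by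
        refine Finset.card_le_card_of_injOn
          (fun i => if hi : 0 < r i then (e.symm ⟨i, hi⟩).1 else 0) ?_ ?_
        · intro i hi
          have hi' : μ ≤ r i := by simpa using hi
          simp only [dif_pos (hμ.trans_le hi'), Finset.coe_range, Set.mem_Iio]
          exact hlt _ (by simpa using hi')
        · intro i hi j hj hij
          have hi' : μ ≤ r i := by simpa using hi
          have hj' : μ ≤ r j := by simpa using hj
          simp only [dif_pos (hμ.trans_le hi'), dif_pos (hμ.trans_le hj')] at hij
          exact congrArg Subtype.val (e.symm.injective (Subtype.ext hij))
      rw [Finset.card_range] at hle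
      omega
    · rintro ⟨hk, hμk⟩
      have hlt : ∀ l : Fin (k + 1), ((l : ℕ) : ℕ∞) < M := fun l =>
        lt_of_le_of_lt (by exact_mod_cast Nat.lt_succ_iff.1 l.2) hk
      have h1 : (Finset.univ : Finset (Fin (k + 1))).card ≤ (h.finite_le hμ).toFinset.card := by
        refine Finset.card_le_card_of_injOn (fun l => (e ⟨l, hlt l⟩).1) ?_ ?_
        · intro l _
          simp only [Set.Finite.coe_toFinset, Set.mem_ofPred_eq]
          exact hμk.trans (hanti (b := ⟨k, hk⟩) (Nat.lt_succ_iff.1 l.2))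
        · intro l _ l' _ hll
          have := e.injective (Subtype.ext hll)
          exact Fin.ext (congrArg Subtype.val this)
      simpa using h1
  have hset : ∀ k : ℕ, {μ : ℝ | 0 < μ ∧ k + 1 ≤ Module.finrank ℂ
      ↥(⨆ ν ∈ Set.Ici μ, Module.End.eigenspace (ρ : 𝓗 →ₗ[ℂ] 𝓗) (ν : ℂ))}
      = {μ : ℝ | 0 < μ ∧ ∃ hk : (k : ℕ∞) < M, μ ≤ r (e ⟨k, hk⟩)} := by
    intro k
    ext μ
    simp only [Set.mem_ofPred_eq]
    refine and_congr_right fun hμ => ?_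
    rw [h.finrank_iSup_eigenspace hμ, hcount hμ]
  refine ⟨M, e, hanti, fun k => ?_, fun k hk => ?_⟩
  · rw [decreasingEigenvalue, hset]
    have : {μ : ℝ | 0 < μ ∧ ∃ hk : ((k : ℕ) : ℕ∞) < M, μ ≤ r (e ⟨k, hk⟩)} = Set.Ioc 0 (r (e k)) := by
      ext μ
      exact and_congr_right fun _ => ⟨fun ⟨_, h⟩ => h, fun h => ⟨k.2, h⟩⟩
    rw [this, csSup_Ioc (e k).2]
  · rw [decreasingEigenvalue, hset]
    have : {μ : ℝ | 0 < μ ∧ ∃ hk : (k : ℕ∞) < M, μ ≤ r (e ⟨k, hk⟩)} = ∅ := by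
      ext μ
      simp only [Set.mem_ofPred_eq, Set.mem_empty_iff_false, iff_false, not_and, not_exists]
      exact fun _ hk' => absurd hk' (not_lt.2 hk)
    -- The default `sSup ∅ = 0` provides the continuation by zeros.
    rw [this, Real.sSup_empty]

theorem exists_equiv (h : IsDiagonal b r ρ) :
    ∃ e : {k : ℕ // 0 < decreasingEigenvalue ρ k} ≃ {i // 0 < r i},
      ∀ k, r (e k) = decreasingEigenvalue ρ k := by
  obtain ⟨M, e, -, h1, h2⟩ := h.decreasingEigenvalue_eq
  have hiff : ∀ k : ℕ, 0 < decreasingEigenvalue ρ k ↔ (k : ℕ∞) < M := fun k => by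
    constructor
    · intro hk
      by_contra hM
      rw [h2 k (not_lt.1 hM)] at hk
      exact lt_irrefl _ hk
    · intro hk
      rw [h1 ⟨k, hk⟩]
      exact (e ⟨k, hk⟩).2
  refine ⟨(Equiv.subtypeEquivRight hiff).trans e, fun k => ?_⟩
  rw [← h1 ⟨k, (hiff k).1 k.2⟩ |>.symm]
  rfl

/-- A sum over the eigenvalues can be taken over the decreasing sequence of eigenvalues. -/
theorem tsum_comp (h : IsDiagonal b r ρ) {f : ℝ → ℝ≥0∞} (hf : f 0 = 0) :
    ∑' i, f (r i) = ∑' k, f (decreasingEigenvalue ρ k) := by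
  obtain ⟨e, he⟩ := h.exists_equiv
  have hpos : ∀ k, 0 ≤ decreasingEigenvalue ρ k := fun k => by
    obtain ⟨M, e, -, h1, h2⟩ := h.decreasingEigenvalue_eq
    rcases lt_or_ge (k : ℕ∞) M with hk | hk
    · rw [h1 ⟨k, hk⟩]; exact (e ⟨k, hk⟩).2.le
    · rw [h2 k hk]
  have h1 : ∑' i : {i // 0 < r i}, f (r i) = ∑' i, f (r i) :=
    tsum_subtype_eq_of_support_subset (s := {i | 0 < r i}) (f := fun i => f (r i)) fun i hi =>
      (h.nonneg i).lt_of_ne fun h0 => hi (by simp [← h0, hf])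
  have h2 : ∑' k : {k // 0 < decreasingEigenvalue ρ k}, f (decreasingEigenvalue ρ k)
      = ∑' k, f (decreasingEigenvalue ρ k) :=
    tsum_subtype_eq_of_support_subset (s := {k | 0 < decreasingEigenvalue ρ k})
      (f := fun k => f (decreasingEigenvalue ρ k)) fun k hk =>
      (hpos k).lt_of_ne fun h0 => hk (by simp [← h0, hf])
  rw [← h1, ← h2, ← e.tsum_eq]
  simp only [he]

end IsDiagonal

section DecreasingEigenvalue

variable {ρ σ : 𝓗 →L[ℂ] 𝓗}

theorem IsState.decreasingEigenvalue_nonneg (hρ : IsState ρ) (k : ℕ) :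
    0 ≤ decreasingEigenvalue ρ k := by
  obtain ⟨w, b, r, h⟩ := hρ.exists_isDiagonal
  obtain ⟨M, e, -, h1, h2⟩ := h.decreasingEigenvalue_eq
  rcases lt_or_ge (k : ℕ∞) M with hk | hk
  · rw [h1 ⟨k, hk⟩]; exact (e ⟨k, hk⟩).2.le
  · rw [h2 k hk]

theorem IsState.decreasingEigenvalue_antitone (hρ : IsState ρ) :
    Antitone (decreasingEigenvalue ρ) := by
  obtain ⟨w, b, r, h⟩ := hρ.exists_isDiagonal
  obtain ⟨M, e, h0, h1, h2⟩ := h.decreasingEigenvalue_eq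
  intro k l hkl
  rcases lt_or_ge (l : ℕ∞) M with hl | hl
  · have hk : (k : ℕ∞) < M := lt_of_le_of_lt (by exact_mod_cast hkl) hl
    rw [h1 ⟨k, hk⟩, h1 ⟨l, hl⟩]
    exact h0 (a := ⟨k, hk⟩) (b := ⟨l, hl⟩) hkl
  · rw [h2 l hl]; exact hρ.decreasingEigenvalue_nonneg k

theorem IsState.tsum_decreasingEigenvalue (hρ : IsState ρ) :
    ∑' k, ENNReal.ofReal (decreasingEigenvalue ρ k) = 1 := by
  obtain ⟨w, b, r, h⟩ := hρ.exists_isDiagonal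
  rw [← h.tsum_comp ENNReal.ofReal_zero, h.tsum_eq_one]

theorem IsState.summable_decreasingEigenvalue (hρ : IsState ρ) :
    Summable (decreasingEigenvalue ρ) := by
  have h1 := ENNReal.summable_toReal (f := fun k => ENNReal.ofReal (decreasingEigenvalue ρ k))
    (by rw [hρ.tsum_decreasingEigenvalue]; exact ENNReal.one_ne_top)
  simpa [ENNReal.toReal_ofReal (hρ.decreasingEigenvalue_nonneg _)] using h1

theorem IsState.decreasingEigenvalue_le_one (hρ : IsState ρ) (k : ℕ) :
    decreasingEigenvalue ρ k ≤ 1 := by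
  have h1 := ENNReal.le_tsum (f := fun i => ENNReal.ofReal (decreasingEigenvalue ρ i)) k
  rw [hρ.tsum_decreasingEigenvalue] at h1
  exact ENNReal.ofReal_le_one.1 h1

theorem IsState.exists_orthonormal_eigenvectors (hρ : IsState ρ) :
    ∃ v : {k : ℕ // 0 < decreasingEigenvalue ρ k} → 𝓗, Orthonormal ℂ v ∧
      ∀ k, (⟪v k, ρ (v k)⟫_ℂ).re = decreasingEigenvalue ρ k := by
  obtain ⟨w, b, r, h⟩ := hρ.exists_isDiagonal
  obtain ⟨e, he⟩ := h.exists_equiv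
  refine ⟨fun k => b (e k), b.orthonormal.comp (fun k => (e k).1)
    (Subtype.val_injective.comp e.injective), fun k => ?_⟩
  rw [re_inner_eigenvector b (h.apply _), he]

/-- **Ky Fan's maximum principle**. -/
theorem IsState.sum_inner_le_sum_decreasingEigenvalue (hρ : IsState ρ) {ι : Type*} {v : ι → 𝓗}
    (hv : Orthonormal ℂ v) (s : Finset ι) {m : ℕ} (hs : s.card ≤ m) :
    ∑ j ∈ s, (⟪v j, ρ (v j)⟫_ℂ).re ≤ ∑ k ∈ Finset.range m, decreasingEigenvalue ρ k := by
  obtain ⟨w, b, r, h⟩ := hρ.exists_isDiagonal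
  -- Threshold argument: bound `rᵢ` by `L + (rᵢ - L)₊`. The constant part contributes at most `m L`
  -- since the `vⱼ` are unit vectors, and by Bessel in `j` the other part contributes at most `∑ (rᵢ
  -- - L)₊`, to which only the first `m` eigenvalues contribute. The total is the sum of the first
  -- `m` eigenvalues.
  set L := decreasingEigenvalue ρ m with hL
  have hL0 : 0 ≤ L := hρ.decreasingEigenvalue_nonneg m
  have hbessel : ∀ i, ∑ j ∈ s, ENNReal.ofReal (‖⟪b i, v j⟫_ℂ‖ ^ 2) ≤ 1 := by
    intro i
    rw [← ENNReal.ofReal_sum_of_nonneg fun _ _ => by positivity, ENNReal.ofReal_le_one]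
    have h1 := hv.sum_inner_products_le (x := b i) (s := s)
    rw [b.orthonormal.1 i] at h1
    simpa [norm_inner_symm] using h1
  have hmain : ENNReal.ofReal (∑ j ∈ s, (⟪v j, ρ (v j)⟫_ℂ).re)
      ≤ ENNReal.ofReal (∑ k ∈ Finset.range m, decreasingEigenvalue ρ k) := by
    calc ENNReal.ofReal (∑ j ∈ s, (⟪v j, ρ (v j)⟫_ℂ).re)
        = ∑ j ∈ s, ENNReal.ofReal (⟪v j, ρ (v j)⟫_ℂ).re :=
          ENNReal.ofReal_sum_of_nonneg fun j _ => hρ.1.re_inner_nonneg_right (v j)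
      _ = ∑ j ∈ s, ∑' i, ENNReal.ofReal (r i) * ENNReal.ofReal (‖⟪b i, v j⟫_ℂ‖ ^ 2) :=
          Finset.sum_congr rfl fun j _ => ofReal_inner_self_apply b h.nonneg h.apply (v j)
      _ ≤ ∑ j ∈ s, ∑' i, (ENNReal.ofReal L * ENNReal.ofReal (‖⟪b i, v j⟫_ℂ‖ ^ 2)
            + ENNReal.ofReal (r i - L) * ENNReal.ofReal (‖⟪b i, v j⟫_ℂ‖ ^ 2)) := by
          refine Finset.sum_le_sum fun j _ => ENNReal.tsum_le_tsum fun i => ?_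
          rw [← add_mul]
          gcongr
          refine le_trans (ENNReal.ofReal_le_ofReal ?_) ENNReal.ofReal_add_le
          linarith
      _ = ∑ j ∈ s, ENNReal.ofReal L
            + ∑ j ∈ s, ∑' i, ENNReal.ofReal (r i - L) * ENNReal.ofReal (‖⟪b i, v j⟫_ℂ‖ ^ 2) := by
          rw [← Finset.sum_add_distrib]
          refine Finset.sum_congr rfl fun j _ => ?_
          rw [ENNReal.tsum_add, ENNReal.tsum_mul_left, tsum_ofReal_norm_inner_sq, hv.1 j]
          simp
      _ ≤ ∑ _k ∈ Finset.range m, ENNReal.ofReal L + ∑' i, ENNReal.ofReal (r i - L) := by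
          gcongr ?_ + ?_
          · simp only [Finset.sum_const, Finset.card_range]
            gcongr
          · rw [← Summable.tsum_finsetSum fun _ _ => ENNReal.summable]
            refine ENNReal.tsum_le_tsum fun i => ?_
            rw [← Finset.mul_sum]
            exact mul_le_of_le_one_right' (hbessel i)
      _ = ∑ _k ∈ Finset.range m, ENNReal.ofReal L
            + ∑ k ∈ Finset.range m, ENNReal.ofReal (decreasingEigenvalue ρ k - L) := by
          rw [h.tsum_comp (f := fun x => ENNReal.ofReal (x - L))
            (ENNReal.ofReal_of_nonpos (by linarith)), tsum_eq_sum fun k hk => ?_]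
          refine ENNReal.ofReal_of_nonpos (sub_nonpos.2 ?_)
          exact hρ.decreasingEigenvalue_antitone (by simpa using hk)
      _ = _ := by
          rw [← Finset.sum_add_distrib,
            ENNReal.ofReal_sum_of_nonneg fun k _ => hρ.decreasingEigenvalue_nonneg k]
          refine Finset.sum_congr rfl fun k hk => ?_
          have : L ≤ decreasingEigenvalue ρ k :=
            hρ.decreasingEigenvalue_antitone (Finset.mem_range.1 hk).le
          rw [← ENNReal.ofReal_add hL0 (by linarith)]
          congr 1
          ring
  exact (ENNReal.ofReal_le_ofReal_iff
    (Finset.sum_nonneg fun k _ => hρ.decreasingEigenvalue_nonneg k)).1 hmain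

/-- Test `σ` on the leading eigenvectors of `ρ`: each expectation changes by at most `‖ρ - σ‖`, and
Ky Fan bounds the result by the eigenvalues of `σ`. This makes partial sums, hence single ordered
eigenvalues, continuous on states. -/
theorem sum_decreasingEigenvalue_le (hρ : IsState ρ) (hσ : IsState σ) (m : ℕ) :
    ∑ k ∈ Finset.range m, decreasingEigenvalue ρ k
      ≤ ∑ k ∈ Finset.range m, decreasingEigenvalue σ k + m * ‖ρ - σ‖ := by
  obtain ⟨v, hv, hvρ⟩ := hρ.exists_orthonormal_eigenvectors
  set s := (Finset.range m).subtype fun k => 0 < decreasingEigenvalue ρ k with hs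
  have hcard : s.card ≤ m := by
    rw [hs, Finset.card_subtype]
    exact (Finset.card_filter_le _ _).trans (Finset.card_range m).le
  have h1 : ∑ k ∈ Finset.range m, decreasingEigenvalue ρ k
      = ∑ k ∈ s, (⟪v k, ρ (v k)⟫_ℂ).re := by
    simp only [hvρ]
    rw [hs, Finset.sum_subtype_eq_sum_filter, Finset.sum_filter_of_ne]
    exact fun k _ hk => (hρ.decreasingEigenvalue_nonneg k).lt_of_ne hk.symm
  rw [h1]
  calc ∑ k ∈ s, (⟪v k, ρ (v k)⟫_ℂ).re
      ≤ ∑ k ∈ s, ((⟪v k, σ (v k)⟫_ℂ).re + ‖ρ - σ‖) := by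
        refine Finset.sum_le_sum fun k _ => ?_
        have h2 : (⟪v k, (ρ - σ) (v k)⟫_ℂ).re ≤ ‖v k‖ * ‖(ρ - σ) (v k)‖ :=
          re_inner_le_norm (𝕜 := ℂ) _ _
        have h3 := (ρ - σ).le_opNorm (v k)
        rw [hv.1 k] at h2 h3
        rw [sub_apply, inner_sub_right, Complex.sub_re] at h2
        rw [sub_apply] at h3
        linarith
    _ = ∑ k ∈ s, (⟪v k, σ (v k)⟫_ℂ).re + s.card * ‖ρ - σ‖ := by
        rw [Finset.sum_add_distrib, Finset.sum_const, nsmul_eq_mul]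
    _ ≤ _ := by
        gcongr
        exact hσ.sum_inner_le_sum_decreasingEigenvalue hv s hcard

theorem tendsto_sum_decreasingEigenvalue {ρ : ℕ → 𝓗 →L[ℂ] 𝓗} {ρ₀ : 𝓗 →L[ℂ] 𝓗}
    (hρ : ∀ n, IsState (ρ n)) (hρ₀ : IsState ρ₀) (h : Tendsto ρ atTop (𝓝 ρ₀)) (m : ℕ) :
    Tendsto (fun n => ∑ k ∈ Finset.range m, decreasingEigenvalue (ρ n) k) atTop
      (𝓝 (∑ k ∈ Finset.range m, decreasingEigenvalue ρ₀ k)) := by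
  rw [tendsto_iff_norm_sub_tendsto_zero] at h ⊢
  refine squeeze_zero (fun _ => norm_nonneg _) (fun n => ?_) (by simpa using h.const_mul (m : ℝ))
  have h1 := sum_decreasingEigenvalue_le (hρ n) hρ₀ m
  have h2 := sum_decreasingEigenvalue_le hρ₀ (hρ n) m
  rw [norm_sub_rev] at h2
  rw [Real.norm_eq_abs, abs_le]
  constructor <;> linarith

theorem tendsto_decreasingEigenvalue {ρ : ℕ → 𝓗 →L[ℂ] 𝓗} {ρ₀ : 𝓗 →L[ℂ] 𝓗}
    (hρ : ∀ n, IsState (ρ n)) (hρ₀ : IsState ρ₀) (h : Tendsto ρ atTop (𝓝 ρ₀)) (k : ℕ) :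
    Tendsto (fun n => decreasingEigenvalue (ρ n) k) atTop (𝓝 (decreasingEigenvalue ρ₀ k)) := by
  have h1 := (tendsto_sum_decreasingEigenvalue hρ hρ₀ h (k + 1)).sub
    (tendsto_sum_decreasingEigenvalue hρ hρ₀ h k)
  simpa [Finset.sum_range_succ] using h1

end DecreasingEigenvalue

/-! ### The entropy -/

theorem entropy_eq_tsum {ι : Type*} {b : HilbertBasis ι ℂ 𝓗} {r : ι → ℝ} {ρ : 𝓗 →L[ℂ] 𝓗}
    (h : IsDiagonal b r ρ) :
    entropy ρ = ∑' i, ENNReal.ofReal (Real.negMulLog (r i)) := by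
  have hle : ∀ x ∈ spectrum ℝ ρ, x ≤ 1 := by
    intro x hx
    have h1 : ‖ρ‖ ≤ 1 := by
      have := norm_le_posTrace h.isState.1
      rw [h.isState.2] at this
      exact ENNReal.ofReal_le_one.1 this
    by_cases hn : Nontrivial 𝓗
    · exact (le_abs_self x).trans ((spectrum.norm_le_norm_of_mem hx).trans h1)
    · have := not_nontrivial_iff_subsingleton.1 hn
      have h2 : Subsingleton (𝓗 →L[ℂ] 𝓗) := inferInstance
      exact absurd (isUnit_of_subsingleton _) hx
  refine posTrace_eq_tsum_eigenvalue b ((ContinuousLinearMap.nonneg_iff_isPositive _).1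
    (cfc_nonneg fun x hx => Real.negMulLog_nonneg (spectrum_nonneg h.isState.1 x hx) (hle x hx)))
    fun i => ?_
  exact cfc_apply_eigenvector h.isState.1.isSelfAdjoint
    Real.continuous_negMulLog.continuousOn (h.apply i)

theorem IsState.entropy_eq (ρ : 𝓗 →L[ℂ] 𝓗) (hρ : IsState ρ) :
    entropy ρ = ∑' k, ENNReal.ofReal (Real.negMulLog (decreasingEigenvalue ρ k)) := by
  obtain ⟨w, b, r, h⟩ := hρ.exists_isDiagonal
  rw [entropy_eq_tsum h]
  exact h.tsum_comp (f := fun x => ENNReal.ofReal (Real.negMulLog x)) (by simp)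

/-! ### Hamiltonians -/

namespace Hamiltonian

variable (H : Hamiltonian 𝓗)

theorem resolvent_isPositive : H.resolvent.IsPositive := by
  rw [ContinuousLinearMap.isPositive_def']
  refine ⟨H.resolvent_selfAdjoint, fun x => ?_⟩
  rw [ContinuousLinearMap.reApplyInnerSelf_apply]
  nth_rewrite 2 [← H.resolvent_spec x]
  rw [inner_add_right, map_add]
  exact add_nonneg inner_self_nonneg (H.nonneg ⟨_, H.resolvent_mem x⟩)

theorem norm_resolvent_le : ‖H.resolvent‖ ≤ 1 :=
  LinearMap.mkContinuous_norm_le _ zero_le_one _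

theorem spectrum_resolvent {x : ℝ} (hx : x ∈ spectrum ℝ H.resolvent) : 0 ≤ x ∧ x ≤ 1 := by
  refine ⟨spectrum_nonneg H.resolvent_isPositive x hx, ?_⟩
  rcases subsingleton_or_nontrivial 𝓗 with hs | hs
  · have h2 : Subsingleton (𝓗 →L[ℂ] 𝓗) := inferInstance
    exact absurd (isUnit_of_subsingleton _) hx
  · exact (le_abs_self x).trans ((spectrum.norm_le_norm_of_mem hx).trans H.norm_resolvent_le)

theorem resolvent_oneAdd (x : H.op.domain) : H.resolvent ((x : 𝓗) + H.op x) = x :=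
  congrArg Subtype.val (H.oneAddEquiv.symm_apply_apply x)

/-- The spectral subspace of `H` for the interval `[0, n]`. -/
def spectralSubspace (n : ℕ) : Submodule ℂ 𝓗 :=
  (cfc (fun x : ℝ => max 0 (((n : ℝ) + 1)⁻¹ - x)) H.resolvent : 𝓗 →L[ℂ] 𝓗).ker

theorem spectralProj_mem (n : ℕ) (x : 𝓗) : H.spectralProj n x ∈ H.spectralSubspace n :=
  Submodule.starProjection_apply_mem
    (cfc (fun x : ℝ => max 0 (((n : ℝ) + 1)⁻¹ - x)) H.resolvent : 𝓗 →L[ℂ] 𝓗).ker x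

theorem spectralProj_eq_self {n : ℕ} {x : 𝓗} (hx : x ∈ H.spectralSubspace n) :
    H.spectralProj n x = x :=
  Submodule.starProjection_eq_self_iff.2 hx

theorem inner_sub_spectralProj {n : ℕ} (x : 𝓗) {w : 𝓗} (hw : w ∈ H.spectralSubspace n) :
    ⟪x - H.spectralProj n x, w⟫_ℂ = 0 :=
  Submodule.starProjection_inner_eq_zero x w hw

theorem continuous_cutoffFun (n : ℕ) : Continuous fun x : ℝ => (max x ((n : ℝ) + 1)⁻¹)⁻¹ - 1 :=
  ((continuous_id.max continuous_const).inv₀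
    fun x => (lt_max_of_lt_right (by positivity)).ne').sub continuous_const

theorem cutoff_mem (n : ℕ) (x : 𝓗) : H.cutoff n x ∈ H.spectralSubspace n := by
  have hcomm := cfc_commute_cfc (fun x : ℝ => max 0 (((n : ℝ) + 1)⁻¹ - x))
    (fun x : ℝ => (max x ((n : ℝ) + 1)⁻¹)⁻¹ - 1) H.resolvent
  have h1 := congrArg (fun T : 𝓗 →L[ℂ] 𝓗 => T (H.spectralProj n x)) hcomm
  simp only [mul_apply_eq_comp] at h1
  have h2 : cfc (fun x : ℝ => max 0 (((n : ℝ) + 1)⁻¹ - x)) H.resolvent (H.spectralProj n x) = 0 :=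
    H.spectralProj_mem n x
  rw [h2, map_zero] at h1
  exact h1

/-- `⟨φ|Pₙ H|φ⟩ = ⟨Pₙ φ|H|Pₙ φ⟩`. -/
theorem inner_cutoff (n : ℕ) (x : 𝓗) :
    ⟪x, H.cutoff n x⟫_ℂ = ⟪H.spectralProj n x, H.cutoff n x⟫_ℂ := by
  have h := H.inner_sub_spectralProj x (H.cutoff_mem n x)
  rwa [inner_sub_left, sub_eq_zero] at h

theorem inner_cutoff_nonneg (n : ℕ) (x : 𝓗) : 0 ≤ (⟪x, H.cutoff n x⟫_ℂ).re := by
  obtain ⟨h, h'⟩ := H.cutoff_spec n x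
  rw [inner_cutoff, ← h']
  exact H.nonneg ⟨_, h⟩

/-- The spectral projector reduces `H`: in `x = Pₙx + (x - Pₙx)` the cross terms of the quadratic
form vanish, and the remaining term is nonnegative. -/
theorem inner_cutoff_le (n : ℕ) (x : H.op.domain) :
    (⟪(x : 𝓗), H.cutoff n x⟫_ℂ).re ≤ (⟪(x : 𝓗), H.op x⟫_ℂ).re := by
  obtain ⟨h, h'⟩ := H.cutoff_spec n x
  set y : H.op.domain := ⟨H.spectralProj n x, h⟩ with hy
  have h1 : ⟪((x - y : H.op.domain) : 𝓗), H.op y⟫_ℂ = 0 := by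
    rw [h']; exact H.inner_sub_spectralProj _ (H.cutoff_mem n _)
  have h2 : ⟪(y : 𝓗), H.op (x - y)⟫_ℂ = 0 := by
    rw [← H.symm, ← inner_conj_symm, h1, map_zero]
  have h3 := H.nonneg (x - y)
  have h4 : H.op x = H.op y + H.op (x - y) := by rw [← LinearPMap.map_add]; congr 1; abel
  have h5 : (x : 𝓗) = (y : 𝓗) + ((x - y : H.op.domain) : 𝓗) := by simp
  have h6 : ⟪(x : 𝓗), H.op x⟫_ℂ
      = ⟪(y : 𝓗), H.op y⟫_ℂ + ⟪((x - y : H.op.domain) : 𝓗), H.op (x - y)⟫_ℂ := by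
    rw [h4]
    nth_rewrite 1 [h5]
    rw [inner_add_left, inner_add_right, inner_add_right, h1, h2]
    ring
  rw [h6, Complex.add_re, inner_cutoff, ← h']
  linarith

/-- On this subspace `H` agrees with a bounded function of the resolvent whose values on the
spectrum lie in `[0, n]`. -/
theorem mem_domain_of_mem_spectralSubspace {n : ℕ} {x : 𝓗} (hx : x ∈ H.spectralSubspace n) :
    ∃ h : x ∈ H.op.domain, (⟪x, H.op ⟨x, h⟩⟫_ℂ).re ≤ n * ‖x‖ ^ 2 := by
  obtain ⟨h, h'⟩ := H.cutoff_spec n x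
  have e := H.spectralProj_eq_self hx
  have h1 : x ∈ H.op.domain := by rw [← e]; exact h
  refine ⟨h1, ?_⟩
  have h2 : (⟨H.spectralProj n x, h⟩ : H.op.domain) = ⟨x, h1⟩ := Subtype.ext e
  rw [h2] at h'
  rw [h']
  have h3 : ‖cfc (fun x : ℝ => (max x ((n : ℝ) + 1)⁻¹)⁻¹ - 1) H.resolvent‖ ≤ n := by
    refine norm_cfc_le (by positivity) fun t ht => ?_
    obtain ⟨ht0, ht1⟩ := H.spectrum_resolvent ht
    have hn : (0 : ℝ) < ((n : ℝ) + 1)⁻¹ := by positivity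
    have hm : 0 < max t ((n : ℝ) + 1)⁻¹ := lt_max_of_lt_right hn
    have hm1 : max t ((n : ℝ) + 1)⁻¹ ≤ 1 := max_le ht1 (inv_le_one_of_one_le₀ (by simp))
    have hle : (max t ((n : ℝ) + 1)⁻¹)⁻¹ ≤ (n : ℝ) + 1 := by
      rw [inv_le_comm₀ hm (by positivity)]; exact le_max_right _ _
    have hge : 1 ≤ (max t ((n : ℝ) + 1)⁻¹)⁻¹ := (one_le_inv₀ hm).2 hm1
    rw [Real.norm_eq_abs, abs_of_nonneg (by linarith)]
    linarith
  have h4 : ‖H.cutoff n x‖ ≤ n * ‖x‖ := by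
    change ‖cfc (fun x : ℝ => (max x ((n : ℝ) + 1)⁻¹)⁻¹ - 1) H.resolvent (H.spectralProj n x)‖ ≤ _
    rw [e]
    exact ContinuousLinearMap.le_of_opNorm_le _ h3 x
  calc (⟪x, H.cutoff n x⟫_ℂ).re ≤ ‖x‖ * ‖H.cutoff n x‖ := re_inner_le_norm (𝕜 := ℂ) _ _
    _ ≤ ‖x‖ * (n * ‖x‖) := by gcongr
    _ = _ := by ring

theorem energy_eq_iSup {ι : Type*} (b : HilbertBasis ι ℂ 𝓗) {ρ : 𝓗 →L[ℂ] 𝓗} {r : ι → ℝ}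
    (hρ : ∀ i, ρ (b i) = (r i : ℂ) • b i) (hr : Summable r) (hr0 : ∀ i, 0 ≤ r i) :
    H.energy ρ = ⨆ n : ℕ, ∑' j, ENNReal.ofReal (r j)
      * ENNReal.ofReal (⟪b j, H.cutoff n (b j)⟫_ℂ).re := by
  refine iSup_congr fun n => ?_
  have h := hasSum_trace_comp b (H.cutoff n) hρ hr hr0
  rw [← h.tsum_eq, ENNReal.ofReal_tsum_of_nonneg
    (fun j => mul_nonneg (hr0 j) (H.inner_cutoff_nonneg n _)) h.summable]
  exact tsum_congr fun j => ENNReal.ofReal_mul (hr0 j)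

theorem groundEnergy_le (φ : H.op.domain) (hφ : ‖φ‖ = 1) :
    H.groundEnergy ≤ (⟪(φ : 𝓗), H.op φ⟫_ℂ).re :=
  ciInf_le (f := fun φ : {φ : H.op.domain // ‖φ‖ = 1} => (⟪(φ.1 : 𝓗), H.op φ.1⟫_ℂ).re)
    ⟨0, by rintro _ ⟨φ, rfl⟩; exact H.nonneg _⟩ ⟨φ, hφ⟩

theorem nonempty_unit [Nontrivial 𝓗] : Nonempty {φ : H.op.domain // ‖φ‖ = 1} := by
  obtain ⟨y, hy⟩ := exists_ne (0 : 𝓗)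
  have hx : H.resolvent y ≠ 0 := by
    intro h
    have h1 := H.resolvent_spec y
    have h2 : (⟨H.resolvent y, H.resolvent_mem y⟩ : H.op.domain) = 0 := Subtype.ext h
    rw [h2, LinearPMap.map_zero, h, add_zero] at h1
    exact hy h1.symm
  set x : H.op.domain := ⟨H.resolvent y, H.resolvent_mem y⟩
  have hn : ‖x‖ ≠ 0 := norm_ne_zero_iff.2 fun h => hx (congrArg Subtype.val h)
  refine ⟨⟨((‖x‖⁻¹ : ℝ) : ℂ) • x, ?_⟩⟩
  rw [norm_smul, Complex.norm_real, norm_inv, norm_norm, inv_mul_cancel₀ hn]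

theorem groundEnergy_nonneg : 0 ≤ H.groundEnergy := Real.iInf_nonneg fun _ => H.nonneg _

theorem continuousOn_expNegFun {l : ℝ} (hl : 0 < l) :
    ContinuousOn (fun x : ℝ => if x ≤ 0 then 0 else Real.exp (-l * (x⁻¹ - 1)))
      (spectrum ℝ H.resolvent) := by
  refine Continuous.continuousOn (continuous_iff_continuousAt.2 fun x => ?_)
  have hev : ∀ y : ℝ, 0 < y → (fun x : ℝ => if x ≤ 0 then 0 else Real.exp (-l * (x⁻¹ - 1)))
      =ᶠ[𝓝 y] fun x => Real.exp (-l * (x⁻¹ - 1)) := fun y hy => by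
    filter_upwards [lt_mem_nhds hy] with z hz
    rw [if_neg (not_le.2 hz)]
  rcases lt_trichotomy x 0 with hx | hx | hx
  · have : (fun x : ℝ => if x ≤ 0 then 0 else Real.exp (-l * (x⁻¹ - 1))) =ᶠ[𝓝 x] fun _ => 0 := by
      filter_upwards [gt_mem_nhds hx] with z hz
      rw [if_pos hz.le]
    exact continuousAt_const.congr this.symm
  · subst hx
    have h1 : Tendsto (fun x : ℝ => Real.exp (-l * (x⁻¹ - 1))) (𝓝[>] 0) (𝓝 0) := by
      refine Real.tendsto_exp_atBot.comp (Tendsto.const_mul_atTop_of_neg (by linarith) ?_)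
      exact tendsto_atTop_add_const_right _ _ tendsto_inv_nhdsGT_zero
    have h2 : Tendsto (fun x : ℝ => if x ≤ 0 then 0 else Real.exp (-l * (x⁻¹ - 1)))
        (𝓝[≤] 0 ⊔ 𝓝[>] 0) (𝓝 0) := by
      refine tendsto_sup.2 ⟨tendsto_const_nhds.congr' ?_, h1.congr' ?_⟩
      · filter_upwards [self_mem_nhdsWithin] with z hz
        exact (if_pos hz).symm
      · filter_upwards [self_mem_nhdsWithin] with z hz
        exact (if_neg (not_le.2 hz)).symm
    rw [nhdsLE_sup_nhdsGT] at h2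
    rwa [ContinuousAt, if_pos le_rfl]
  · refine ContinuousAt.congr ?_ (hev x hx).symm
    exact Real.continuous_exp.continuousAt.comp
      (continuousAt_const.mul ((continuousAt_inv₀ hx.ne').sub continuousAt_const))

theorem expNeg_isPositive (l : ℝ) : (H.expNeg l).IsPositive :=
  (ContinuousLinearMap.nonneg_iff_isPositive _).1 <| cfc_nonneg fun x _ => by
    split_ifs
    · exact le_rfl
    · exact (Real.exp_pos _).le

theorem finiteDimensional_spectralSubspace {l : ℝ} (hl : 0 < l) (h : posTrace (H.expNeg l) < ⊤)
    (n : ℕ) : FiniteDimensional ℂ (H.spectralSubspace n) := by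
  refine finiteDimensional_ker_of_posTrace_lt_top H.resolvent_isPositive
    (H.continuousOn_expNegFun hl) (fun x _ => ?_) (fun c hc => ?_) h (by positivity)
  · split_ifs
    · exact le_rfl
    · exact (Real.exp_pos _).le
  · refine ⟨Real.exp (-l * (c⁻¹ - 1)), Real.exp_pos _, fun x _ hx => ?_⟩
    rw [if_neg (not_le.2 (hc.trans_le hx))]
    have : x⁻¹ ≤ c⁻¹ := inv_anti₀ hc hx
    refine Real.exp_le_exp.2 ?_
    nlinarith

theorem isCompactOperator_resolvent (h : ∀ n, FiniteDimensional ℂ (H.spectralSubspace n)) :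
    IsCompactOperator H.resolvent :=
  isCompactOperator_of_finiteDimensional_ker H.resolvent_selfAdjoint
    (fun _ hx => (H.spectrum_resolvent hx).1) h

end Hamiltonian

theorem tsum_iSup_of_monotone {ι : Type*} {f : ℕ → ι → ℝ≥0∞} (hf : ∀ i, Monotone fun n => f n i) :
    ⨆ n, ∑' i, f n i = ∑' i, ⨆ n, f n i := by
  refine le_antisymm (iSup_le fun n => ENNReal.tsum_le_tsum fun i => le_iSup (fun n => f n i) n) ?_
  rw [ENNReal.tsum_eq_iSup_sum]
  refine iSup_le fun s => ?_
  rw [ENNReal.finsetSum_iSup_of_monotone hf]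
  exact iSup_mono fun n => ENNReal.sum_le_tsum s

/-! ### Hamiltonians with an eigenbasis -/

namespace Hamiltonian

variable {H : Hamiltonian 𝓗}

namespace Eigenbasis

variable (B : H.Eigenbasis)

theorem inner_op (k : {k : ℕ // (k : ℕ∞) < B.N}) :
    (⟪B.basis k, H.op ⟨B.basis k, B.mem_domain k⟩⟫_ℂ).re = B.level k := by
  rw [B.eigen, inner_smul_right, inner_self_eq_norm_sq_to_K, B.basis.orthonormal.1 k]
  simp

theorem level_nonneg (k : {k : ℕ // (k : ℕ∞) < B.N}) : 0 ≤ B.level k := by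
  rw [← inner_op]; exact H.nonneg ⟨B.basis k, B.mem_domain k⟩

theorem resolvent_basis (k : {k : ℕ // (k : ℕ∞) < B.N}) :
    H.resolvent (B.basis k) = (((1 + B.level k)⁻¹ : ℝ) : ℂ) • B.basis k := by
  have h := H.resolvent_oneAdd ⟨B.basis k, B.mem_domain k⟩
  rw [B.eigen] at h
  have h0 := B.level_nonneg k
  have h1 : B.basis k + (B.level k : ℂ) • B.basis k = ((1 + B.level k : ℝ) : ℂ) • B.basis k := by
    push_cast
    rw [add_smul, one_smul]
  rw [h1, map_smul] at h
  rw [Complex.ofReal_inv]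
  exact eq_inv_smul_iff₀ (by exact_mod_cast (by linarith : (1 + B.level k) ≠ 0)) |>.2 h

theorem expNeg_basis {l : ℝ} (hl : 0 < l) (k : {k : ℕ // (k : ℕ∞) < B.N}) :
    H.expNeg l (B.basis k) = (Real.exp (-l * B.level k) : ℂ) • B.basis k := by
  have h0 := B.level_nonneg k
  have h := cfc_apply_eigenvector H.resolvent_selfAdjoint (H.continuousOn_expNegFun hl)
    (B.resolvent_basis k)
  rw [if_neg (by rw [not_le]; positivity), inv_inv, add_sub_cancel_left] at h
  exact h

theorem posTrace_expNeg {l : ℝ} (hl : 0 < l) :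
    posTrace (H.expNeg l) = ∑' k, ENNReal.ofReal (Real.exp (-l * B.level k)) :=
  posTrace_eq_tsum_eigenvalue B.basis (H.expNeg_isPositive l) fun k => by
    rw [B.expNeg_basis hl]

theorem basis_mem_spectralSubspace {n : ℕ} {k : {k : ℕ // (k : ℕ∞) < B.N}}
    (hn : B.level k ≤ n) : B.basis k ∈ H.spectralSubspace n := by
  have h0 := B.level_nonneg k
  have hk := cfc_apply_eigenvector (f := fun x : ℝ => max 0 (((n : ℝ) + 1)⁻¹ - x))
    H.resolvent_selfAdjoint (by fun_prop) (B.resolvent_basis k)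
  have hle : ((n : ℝ) + 1)⁻¹ ≤ (1 + B.level k)⁻¹ := inv_anti₀ (by linarith) (by linarith)
  rw [max_eq_left (by linarith), Complex.ofReal_zero, zero_smul] at hk
  exact hk

theorem cutoff_basis (n : ℕ) (k : {k : ℕ // (k : ℕ∞) < B.N}) :
    H.cutoff n (B.basis k) = ((if B.level k ≤ n then B.level k else 0 : ℝ) : ℂ) • B.basis k := by
  have h0 := B.level_nonneg k
  have hk := cfc_apply_eigenvector (f := fun x : ℝ => max 0 (((n : ℝ) + 1)⁻¹ - x))
    H.resolvent_selfAdjoint (by fun_prop) (B.resolvent_basis k)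
  by_cases hn : B.level k ≤ n
  · have hle : ((n : ℝ) + 1)⁻¹ ≤ (1 + B.level k)⁻¹ :=
      inv_anti₀ (by linarith) (by linarith)
    have h := cfc_apply_eigenvector H.resolvent_selfAdjoint
      (continuous_cutoffFun n).continuousOn (B.resolvent_basis k)
    rw [max_eq_left hle, inv_inv, add_sub_cancel_left] at h
    rw [if_pos hn]
    change cfc (fun x : ℝ => (max x ((n : ℝ) + 1)⁻¹)⁻¹ - 1) H.resolvent
      (H.spectralProj n (B.basis k)) = _
    rw [H.spectralProj_eq_self (B.basis_mem_spectralSubspace hn), h]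
  · have hlt : (1 + B.level k)⁻¹ < ((n : ℝ) + 1)⁻¹ :=
      inv_strictAnti₀ (by positivity) (by linarith [not_le.1 hn])
    rw [max_eq_right (by linarith)] at hk
    -- A basis vector with level above `n` is an eigenvector, with nonzero eigenvalue, of the
    -- self-adjoint operator whose kernel is the spectral subspace; it is therefore orthogonal to
    -- that kernel.
    have hP : H.spectralProj n (B.basis k) = 0 := by
      have hort : ∀ w ∈ H.spectralSubspace n, ⟪B.basis k - 0, w⟫_ℂ = 0 := by
        intro w hw
        have hsa : IsSelfAdjoint
            (cfc (fun x : ℝ => max 0 (((n : ℝ) + 1)⁻¹ - x)) H.resolvent) := cfc_predicate _ _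
        have h1 : ⟪cfc (fun x : ℝ => max 0 (((n : ℝ) + 1)⁻¹ - x)) H.resolvent (B.basis k), w⟫_ℂ
            = ⟪B.basis k, cfc (fun x : ℝ => max 0 (((n : ℝ) + 1)⁻¹ - x)) H.resolvent w⟫_ℂ :=
          hsa.isSymmetric _ _
        have hw' : cfc (fun x : ℝ => max 0 (((n : ℝ) + 1)⁻¹ - x)) H.resolvent w = 0 := hw
        rw [hk, hw', inner_zero_right, inner_smul_left] at h1
        rw [sub_zero]
        refine (mul_eq_zero.1 h1).resolve_left ?_
        rw [Complex.conj_ofReal]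
        exact_mod_cast (sub_pos.2 hlt).ne'
      exact Submodule.eq_starProjection_of_mem_of_inner_eq_zero (zero_mem _) hort
    change cfc (fun x : ℝ => (max x ((n : ℝ) + 1)⁻¹)⁻¹ - 1) H.resolvent
      (H.spectralProj n (B.basis k)) = _
    rw [hP, map_zero, if_neg hn, Complex.ofReal_zero, zero_smul]

/-- For fixed `n`, Tonelli exchanges the eigenbasis of `ρ` for that of `H`; monotone convergence
then removes the cutoff. -/
theorem energy_eq_tsum {ι : Type*} (b : HilbertBasis ι ℂ 𝓗) {ρ : 𝓗 →L[ℂ] 𝓗} {r : ι → ℝ}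
    (hρ : ∀ i, ρ (b i) = (r i : ℂ) • b i) (hr : Summable r) (hr0 : ∀ i, 0 ≤ r i) :
    H.energy ρ = ∑' k, ENNReal.ofReal (B.level k)
      * ENNReal.ofReal (⟪B.basis k, ρ (B.basis k)⟫_ℂ).re := by
  have hlev : ∀ k, (⨆ n : ℕ, ENNReal.ofReal (if B.level k ≤ n then B.level k else 0))
      = ENNReal.ofReal (B.level k) := by
    intro k
    refine le_antisymm (iSup_le fun n => ENNReal.ofReal_le_ofReal ?_) ?_
    · split_ifs
      · exact le_rfl
      · exact B.level_nonneg k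
    · obtain ⟨n, hn⟩ := exists_nat_ge (B.level k)
      exact le_iSup_of_le n (by rw [if_pos hn])
  have hmono : ∀ k, Monotone fun n : ℕ =>
      ENNReal.ofReal (if B.level k ≤ n then B.level k else 0) := by
    intro k m n hmn
    refine ENNReal.ofReal_le_ofReal ?_
    have : (m : ℝ) ≤ n := by exact_mod_cast hmn
    have := B.level_nonneg k
    split_ifs <;> linarith
  have hstep : ∀ n : ℕ, ∑' j, ENNReal.ofReal (r j)
      * ENNReal.ofReal (⟪b j, H.cutoff n (b j)⟫_ℂ).re
      = ∑' k, ENNReal.ofReal (if B.level k ≤ n then B.level k else 0)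
        * ENNReal.ofReal (⟪B.basis k, ρ (B.basis k)⟫_ℂ).re := by
    intro n
    have hn0 : ∀ k, 0 ≤ (if B.level k ≤ n then B.level k else 0) := fun k => by
      split_ifs
      · exact B.level_nonneg k
      · exact le_rfl
    simp only [fun j => ofReal_inner_self_apply B.basis hn0 (B.cutoff_basis n) (b j),
      fun k => ofReal_inner_self_apply b hr0 hρ (B.basis k), ← ENNReal.tsum_mul_left]
    rw [ENNReal.tsum_comm]
    refine tsum_congr fun k => tsum_congr fun j => ?_
    rw [norm_inner_symm, mul_left_comm]
  rw [H.energy_eq_iSup b hρ hr hr0]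
  simp only [hstep]
  rw [tsum_iSup_of_monotone fun k => (hmono k).mul_const' _]
  refine tsum_congr fun k => ?_
  rw [← ENNReal.iSup_mul, hlev]

theorem rearrange_basis {ρ : 𝓗 →L[ℂ] 𝓗} (hρ : IsState ρ) (k : {k : ℕ // (k : ℕ∞) < B.N}) :
    B.rearrange ρ (B.basis k) = (decreasingEigenvalue ρ k : ℂ) • B.basis k := by
  have hs : Summable fun k : {k : ℕ // (k : ℕ∞) < B.N} => (decreasingEigenvalue ρ k : ℂ) •
      InnerProductSpace.rankOne ℂ (B.basis k) (B.basis k) := by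
    refine Summable.of_norm ?_
    have h1 := hρ.summable_decreasingEigenvalue.comp_injective
      (Subtype.val_injective (p := fun k : ℕ => (k : ℕ∞) < B.N))
    refine h1.congr fun k => ?_
    rw [norm_smul, InnerProductSpace.norm_rankOne, B.basis.orthonormal.1 k, Complex.norm_real,
      Real.norm_eq_abs, abs_of_nonneg (hρ.decreasingEigenvalue_nonneg _)]
    simp
  have h1 := hs.hasSum.mapL (ContinuousLinearMap.apply ℂ 𝓗 (B.basis k))
  refine h1.unique ?_
  convert hasSum_ite_eq k ((decreasingEigenvalue ρ k : ℂ) • B.basis k) using 2 with j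
  split_ifs with hj
  · subst hj
    simp [B.basis.orthonormal.1 j, inner_self_eq_norm_sq_to_K]
  · simp [B.basis.orthonormal.2 hj]

theorem energy_rearrange {ρ : 𝓗 →L[ℂ] 𝓗} (hρ : IsState ρ) :
    H.energy (B.rearrange ρ) = ∑' k : {k : ℕ // (k : ℕ∞) < B.N}, ENNReal.ofReal (B.level k)
      * ENNReal.ofReal (decreasingEigenvalue ρ k) := by
  rw [B.energy_eq_tsum B.basis (B.rearrange_basis hρ)
    (hρ.summable_decreasingEigenvalue.comp_injective Subtype.val_injective)
    fun k => hρ.decreasingEigenvalue_nonneg k]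
  exact tsum_congr fun k => by rw [re_inner_eigenvector B.basis (B.rearrange_basis hρ k)]

/-! #### Extension of the levels and the populations to all natural numbers -/

/-- The levels, continued by the last of them if there are finitely many. -/
def extLevel : ℕ → ℝ := partialSups fun k : ℕ => if h : (k : ℕ∞) < B.N then B.level ⟨k, h⟩ else 0

/-- The populations `⟨k|ρ|k⟩`, continued by zeros. -/
def population (ρ : 𝓗 →L[ℂ] 𝓗) (k : ℕ) : ℝ :=
  if h : (k : ℕ∞) < B.N then (⟪B.basis ⟨k, h⟩, ρ (B.basis ⟨k, h⟩)⟫_ℂ).re else 0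

theorem extLevel_monotone : Monotone B.extLevel := (partialSups _).monotone

theorem extLevel_eq (k : {k : ℕ // (k : ℕ∞) < B.N}) : B.extLevel k = B.level k := by
  refine le_antisymm (partialSups_le _ _ _ fun j hj => ?_) ?_
  · have h : (j : ℕ∞) < B.N := lt_of_le_of_lt (by exact_mod_cast hj) k.2
    rw [dif_pos h]
    exact B.level_mono (a := ⟨j, h⟩) (b := k) hj
  · have := le_partialSups (fun k : ℕ => if h : (k : ℕ∞) < B.N then B.level ⟨k, h⟩ else 0) k.1
    beta_reduce at this
    rw [dif_pos k.2] at this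
    exact this

theorem extLevel_nonneg (k : ℕ) : 0 ≤ B.extLevel k := by
  refine le_trans ?_ (B.extLevel_monotone (Nat.zero_le k))
  rw [extLevel, partialSups_zero]
  split_ifs
  · exact B.level_nonneg _
  · exact le_rfl

theorem population_eq (ρ : 𝓗 →L[ℂ] 𝓗) (k : {k : ℕ // (k : ℕ∞) < B.N}) :
    B.population ρ k = (⟪B.basis k, ρ (B.basis k)⟫_ℂ).re := by
  rw [population, dif_pos k.2]

theorem population_of_le (ρ : 𝓗 →L[ℂ] 𝓗) {k : ℕ} (hk : B.N ≤ k) : B.population ρ k = 0 := by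
  rw [population, dif_neg (not_lt.2 hk)]

theorem tsum_subtype_eq {f : ℕ → ℝ≥0∞} (hf : ∀ k : ℕ, B.N ≤ k → f k = 0) :
    ∑' k : {k : ℕ // (k : ℕ∞) < B.N}, f k = ∑' k, f k :=
  tsum_subtype_eq_of_support_subset (s := {k : ℕ | (k : ℕ∞) < B.N}) (f := f) fun k hk => by
    by_contra h
    exact hk (hf k (not_lt.1 h))

variable {ρ : 𝓗 →L[ℂ] 𝓗}

theorem population_nonneg (hρ : IsState ρ) (k : ℕ) : 0 ≤ B.population ρ k := by
  rw [population]
  split_ifs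
  · exact hρ.1.re_inner_nonneg_right _
  · exact le_rfl

theorem tsum_population (hρ : IsState ρ) : ∑' k, ENNReal.ofReal (B.population ρ k) = 1 := by
  rw [← hρ.2, posTrace_eq_tsum B.basis hρ.1,
    ← B.tsum_subtype_eq fun k hk => by rw [B.population_of_le ρ hk, ENNReal.ofReal_zero]]
  simp only [population_eq]

theorem sum_population_le (hρ : IsState ρ) (m : ℕ) :
    ∑ k ∈ Finset.range m, B.population ρ k
      ≤ ∑ k ∈ Finset.range m, decreasingEigenvalue ρ k := by
  set s := (Finset.range m).subtype fun k : ℕ => (k : ℕ∞) < B.N with hs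
  have hcard : s.card ≤ m := by
    rw [hs, Finset.card_subtype]
    exact (Finset.card_filter_le _ _).trans (Finset.card_range m).le
  have h1 : ∑ k ∈ Finset.range m, B.population ρ k
      = ∑ k ∈ s, (⟪B.basis k, ρ (B.basis k)⟫_ℂ).re := by
    simp only [← population_eq]
    rw [hs, Finset.sum_subtype_eq_sum_filter, Finset.sum_filter_of_ne]
    intro k _ hk
    by_contra h
    exact hk (B.population_of_le ρ (not_lt.1 h))
  rw [h1]
  exact hρ.sum_inner_le_sum_decreasingEigenvalue B.basis.orthonormal s hcard

/-- Here `k` is at least the dimension, so the first `k` populations already sum to `1`. By Ky Fan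
so do the first `k` eigenvalues, and nothing remains for the next one. -/
theorem decreasingEigenvalue_of_le (hρ : IsState ρ) {k : ℕ} (hk : B.N ≤ k) :
    decreasingEigenvalue ρ k = 0 := by
  have h1 : ∑' j, ENNReal.ofReal (B.population ρ j)
      = ENNReal.ofReal (∑ j ∈ Finset.range k, B.population ρ j) := by
    rw [ENNReal.ofReal_sum_of_nonneg fun j _ => B.population_nonneg hρ j]
    refine tsum_eq_sum fun j hj => ?_
    rw [B.population_of_le ρ (hk.trans (by simpa using hj)), ENNReal.ofReal_zero]
  rw [B.tsum_population hρ] at h1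
  have h2 := ENNReal.sum_le_tsum (f := fun j => ENNReal.ofReal (decreasingEigenvalue ρ j))
    (Finset.range (k + 1))
  rw [hρ.tsum_decreasingEigenvalue, h1,
    ← ENNReal.ofReal_sum_of_nonneg fun j _ => hρ.decreasingEigenvalue_nonneg j,
    ENNReal.ofReal_le_ofReal_iff (Finset.sum_nonneg fun j _ => B.population_nonneg hρ j),
    Finset.sum_range_succ] at h2
  have h3 := B.sum_population_le hρ k
  have h4 := hρ.decreasingEigenvalue_nonneg k
  linarith

theorem energy_eq_tsum_population (hρ : IsState ρ) :
    H.energy ρ = ∑' k, ENNReal.ofReal (B.extLevel k) * ENNReal.ofReal (B.population ρ k) := by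
  obtain ⟨w, b, r, h⟩ := hρ.exists_isDiagonal
  rw [B.energy_eq_tsum b h.apply h.summable h.nonneg, ← B.tsum_subtype_eq fun k hk => by
    rw [B.population_of_le ρ hk, ENNReal.ofReal_zero, mul_zero]]
  simp only [extLevel_eq, population_eq]

theorem energy_rearrange_eq_tsum (hρ : IsState ρ) :
    H.energy (B.rearrange ρ)
      = ∑' k, ENNReal.ofReal (B.extLevel k) * ENNReal.ofReal (decreasingEigenvalue ρ k) := by
  rw [B.energy_rearrange hρ, ← B.tsum_subtype_eq fun k hk => by
    rw [B.decreasingEigenvalue_of_le hρ hk, ENNReal.ofReal_zero, mul_zero]]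
  simp only [extLevel_eq]

theorem tendsto_population {ρ : ℕ → 𝓗 →L[ℂ] 𝓗} {ρ₀ : 𝓗 →L[ℂ] 𝓗} (h : Tendsto ρ atTop (𝓝 ρ₀))
    (k : ℕ) : Tendsto (fun n => B.population (ρ n) k) atTop (𝓝 (B.population ρ₀ k)) := by
  simp only [population]
  split_ifs with hk
  · refine (Complex.continuous_re.tendsto _).comp (Tendsto.inner tendsto_const_nhds ?_)
    exact ((ContinuousLinearMap.apply ℂ 𝓗 (B.basis ⟨k, hk⟩)).continuous.tendsto _).comp h
  · exact tendsto_const_nhds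

theorem N_pos [Nontrivial 𝓗] : ((0 : ℕ) : ℕ∞) < B.N := by
  by_contra h
  have hemp : IsEmpty {k : ℕ // (k : ℕ∞) < B.N} := ⟨fun k => by
    have h1 := k.2.trans_le (not_lt.1 h)
    simp at h1⟩
  obtain ⟨y, hy⟩ := exists_ne (0 : 𝓗)
  exact hy ((B.basis.hasSum_repr y).unique hasSum_empty)

theorem groundEnergy_eq [Nontrivial 𝓗] : H.groundEnergy = B.extLevel 0 := by
  rw [B.extLevel_eq ⟨0, B.N_pos⟩]
  refine le_antisymm ?_ ?_
  · rw [← B.inner_op]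
    exact H.groundEnergy_le ⟨B.basis ⟨0, B.N_pos⟩, B.mem_domain _⟩ (B.basis.orthonormal.1 _)
  · have := H.nonempty_unit
    refine le_ciInf fun φ => ?_
    obtain ⟨φ, hφ⟩ := φ
    have hk : ∀ k, ⟪B.basis k, H.op φ⟫_ℂ = B.level k * ⟪B.basis k, (φ : 𝓗)⟫_ℂ := by
      intro k
      have h := H.symm ⟨B.basis k, B.mem_domain k⟩ φ
      rw [B.eigen, inner_smul_left, Complex.conj_ofReal] at h
      exact h.symm
    have h1 : HasSum (fun k => B.level k * ‖⟪B.basis k, (φ : 𝓗)⟫_ℂ‖ ^ 2)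
        (⟪(φ : 𝓗), H.op φ⟫_ℂ).re := by
      refine (Complex.hasSum_re (B.basis.hasSum_inner_mul_inner (φ : 𝓗) (H.op φ))).congr_fun
        fun k => ?_
      rw [hk, ← inner_conj_symm (φ : 𝓗), mul_left_comm, Complex.re_ofReal_mul,
        mul_comm ((starRingEnd ℂ) _), Complex.mul_conj, Complex.ofReal_re,
        Complex.normSq_eq_norm_sq]
    have h2 := (hasSum_norm_inner_sq B.basis (φ : 𝓗)).mul_left (B.level ⟨0, B.N_pos⟩)
    have hφ' : ‖(φ : 𝓗)‖ = 1 := hφ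
    rw [hφ', one_pow, mul_one] at h2
    refine hasSum_le (fun k => ?_) h2 h1
    gcongr
    exact B.level_mono (Nat.zero_le k.1)

end Eigenbasis

end Hamiltonian

/-! ### Upper limits of sums -/

theorem coe_limsup (u : ℕ → ℝ≥0∞) :
    ((limsup u atTop : ℝ≥0∞) : EReal) = limsup (fun n => (u n : EReal)) atTop :=
  Monotone.map_limsup_of_continuousAt
    (fun _ _ h => EReal.coe_ennreal_le_coe_ennreal_iff.2 h) u
    continuous_coe_ennreal_ereal.continuousAt

theorem coe_liminf (u : ℕ → ℝ≥0∞) :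
    ((liminf u atTop : ℝ≥0∞) : EReal) = liminf (fun n => (u n : EReal)) atTop :=
  Monotone.map_liminf_of_continuousAt
    (fun _ _ h => EReal.coe_ennreal_le_coe_ennreal_iff.2 h) u
    continuous_coe_ennreal_ereal.continuousAt

theorem limsup_add_liminf_le (u v : ℕ → ℝ≥0∞) :
    limsup u atTop + liminf v atTop ≤ limsup (fun n => u n + v n) atTop := by
  rw [← EReal.coe_ennreal_le_coe_ennreal_iff, EReal.coe_ennreal_add, coe_limsup, coe_limsup,
    coe_liminf]
  simp only [EReal.coe_ennreal_add]
  exact EReal.le_limsup_add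

/-- Fatou's lemma for the counting measure; the source of all lower semicontinuity below. -/
theorem tsum_le_liminf {f : ℕ → ℕ → ℝ≥0∞} {f₀ : ℕ → ℝ≥0∞}
    (h : ∀ k, Tendsto (fun n => f n k) atTop (𝓝 (f₀ k))) :
    ∑' k, f₀ k ≤ liminf (fun n => ∑' k, f n k) atTop := by
  have h1 := MeasureTheory.lintegral_liminf_le (μ := MeasureTheory.Measure.count) (f := f)
    (u := atTop) fun n => measurable_of_countable (f n)
  simp only [MeasureTheory.lintegral_count] at h1
  simpa only [fun k => (h k).liminf_eq] using h1

/-- If `F + D = a G + C` with a lower semicontinuous `D`, then the jump of `F` is at most `a` times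
the jump of `G`. -/
theorem limsup_sub_le {F G D : ℕ → ℝ≥0∞} {F₀ G₀ D₀ a C K : ℝ≥0∞} (ha : a ≠ ⊤) (hC : C ≠ ⊤)
    (hK : K ≠ ⊤) (h : ∀ n, F n + D n = a * G n + C) (h₀ : F₀ + D₀ = a * G₀ + C)
    (hD : D₀ ≤ liminf D atTop) (hG : ∀ n, G n ≤ K) (hG₀ : G₀ ≠ ⊤) :
    limsup (fun n => (F n : EReal)) atTop - F₀
      ≤ a * (limsup (fun n => (G n : EReal)) atTop - G₀) := by
  have hLG : limsup G atTop ≠ ⊤ :=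
    ne_top_of_le_ne_top hK (limsup_le_of_le (by isBoundedDefault) (Eventually.of_forall hG))
  -- The only analytic input is `limsup F + liminf D ≤ limsup (F + D)`. Everything in sight is then
  -- finite, so `D₀` and `C` can be cancelled in `ℝ`.
  have h1 : limsup F atTop + D₀ ≤ a * limsup G atTop + C := by
    calc limsup F atTop + D₀ ≤ limsup F atTop + liminf D atTop := by gcongr
      _ ≤ limsup (fun n => F n + D n) atTop := limsup_add_liminf_le F D
      _ = limsup (fun n => a * G n + C) atTop := by simp only [h]
      _ = limsup (fun n => a * G n) atTop + C :=
          limsup_add_const _ _ _ (by isBoundedDefault) (by isBoundedDefault)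
      _ = a * limsup G atTop + C := by rw [ENNReal.limsup_const_mul_of_ne_top ha]
  rw [← coe_limsup, ← coe_limsup]
  generalize limsup F atTop = LF at h1
  generalize limsup G atTop = LG at h1 hLG
  have hr1 : a * LG + C ≠ ⊤ := ENNReal.add_ne_top.2 ⟨ENNReal.mul_ne_top ha hLG, hC⟩
  have hr2 : a * G₀ + C ≠ ⊤ := ENNReal.add_ne_top.2 ⟨ENNReal.mul_ne_top ha hG₀, hC⟩
  have hl1 := ne_top_of_le_ne_top hr1 h1
  rw [← h₀] at hr2
  lift LF to NNReal using (ENNReal.add_ne_top.1 hl1).1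
  lift D₀ to NNReal using (ENNReal.add_ne_top.1 hr2).2
  lift F₀ to NNReal using (ENNReal.add_ne_top.1 hr2).1
  lift LG to NNReal using hLG
  lift G₀ to NNReal using hG₀
  lift C to NNReal using hC
  lift a to NNReal using ha
  have h1' : (LF : ℝ) + D₀ ≤ a * LG + C := by exact_mod_cast h1
  have h0' : (F₀ : ℝ) + D₀ = a * G₀ + C := by exact_mod_cast h₀
  have h2 : (LF : ℝ) - F₀ ≤ a * (LG - G₀) := by linarith
  have hc : ∀ x : NNReal, ((x : ℝ≥0∞) : EReal) = ((x : ℝ) : EReal) := fun _ => rfl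
  rw [hc, hc, hc, hc, hc]
  exact_mod_cast h2

/-! ### Summation by parts -/

theorem tsum_ofReal_add_nat {p : ℕ → ℝ} (hp : ∀ k, 0 ≤ p k)
    (h1 : ∑' k, ENNReal.ofReal (p k) = 1) (j : ℕ) :
    ∑' k, ENNReal.ofReal (p (k + j)) = ENNReal.ofReal (1 - ∑ k ∈ Finset.range j, p k) := by
  have h2 := Summable.sum_add_tsum_nat_add' (f := fun k => ENNReal.ofReal (p k)) (k := j)
    ENNReal.summable
  rw [h1, ← ENNReal.ofReal_sum_of_nonneg fun k _ => hp k] at h2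
  rw [ENNReal.ofReal_sub _ (Finset.sum_nonneg fun k _ => hp k), ENNReal.ofReal_one, ← h2,
    ENNReal.add_sub_cancel_left ENNReal.ofReal_ne_top]

/-- Write `eₖ` as `e₀` plus its increments and interchange the sums: the `j`-th increment is
weighted by the mass of `p` beyond `j`. In `[0, ∞]` no convergence assumption is needed. -/
theorem tsum_mul_eq_tsum_increments {e p : ℕ → ℝ} (he : Monotone e) (he0 : 0 ≤ e 0)
    (hp : ∀ k, 0 ≤ p k) (h1 : ∑' k, ENNReal.ofReal (p k) = 1) :
    ∑' k, ENNReal.ofReal (e k) * ENNReal.ofReal (p k)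
      = ENNReal.ofReal (e 0) + ∑' j, ENNReal.ofReal (e (j + 1) - e j)
        * ENNReal.ofReal (1 - ∑ k ∈ Finset.range (j + 1), p k) := by
  have hΔ : ∀ j, 0 ≤ e (j + 1) - e j := fun j => sub_nonneg.2 (he j.le_succ)
  have hek : ∀ k, ENNReal.ofReal (e k) = ENNReal.ofReal (e 0)
      + ∑' j, if j < k then ENNReal.ofReal (e (j + 1) - e j) else 0 := by
    intro k
    rw [tsum_eq_sum (s := Finset.range k) fun j hj => if_neg (by simpa using hj),
      Finset.sum_congr rfl fun j hj => if_pos (Finset.mem_range.1 hj),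
      ← ENNReal.ofReal_sum_of_nonneg fun j _ => hΔ j,
      ← ENNReal.ofReal_add he0 (Finset.sum_nonneg fun j _ => hΔ j), Finset.sum_range_sub]
    congr 1
    ring
  have hterm : ∀ k, ENNReal.ofReal (e k) * ENNReal.ofReal (p k)
      = ENNReal.ofReal (e 0) * ENNReal.ofReal (p k)
        + ∑' j, (if j < k then ENNReal.ofReal (e (j + 1) - e j) else 0) * ENNReal.ofReal (p k) := by
    intro k
    rw [hek k, add_mul, ENNReal.tsum_mul_right]
  rw [tsum_congr hterm, ENNReal.tsum_add, ENNReal.tsum_mul_left, h1, mul_one, ENNReal.tsum_comm]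
  congr 1
  refine tsum_congr fun j => ?_
  rw [← tsum_ofReal_add_nat hp h1, ← ENNReal.tsum_mul_left,
    ← Summable.sum_add_tsum_nat_add' (k := j + 1) ENNReal.summable, Finset.sum_eq_zero, zero_add]
  · refine tsum_congr fun k => ?_
    rw [if_pos (by omega)]
  · intro k hk
    rw [if_neg (by have := Finset.mem_range.1 hk; omega), zero_mul]

/-- Moving mass to the lower levels decreases the mean energy. -/
theorem tsum_mul_eq_add_tsum {e p q : ℕ → ℝ} (he : Monotone e) (he0 : 0 ≤ e 0)
    (hp : ∀ k, 0 ≤ p k) (hp1 : ∑' k, ENNReal.ofReal (p k) = 1)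
    (hq : ∀ k, 0 ≤ q k) (hq1 : ∑' k, ENNReal.ofReal (q k) = 1)
    (hpq : ∀ m, ∑ k ∈ Finset.range m, p k ≤ ∑ k ∈ Finset.range m, q k) :
    ∑' k, ENNReal.ofReal (e k) * ENNReal.ofReal (q k)
      + ∑' j, ENNReal.ofReal ((e (j + 1) - e j)
        * (∑ k ∈ Finset.range (j + 1), q k - ∑ k ∈ Finset.range (j + 1), p k))
      = ∑' k, ENNReal.ofReal (e k) * ENNReal.ofReal (p k) := by
  rw [tsum_mul_eq_tsum_increments he he0 hp hp1, tsum_mul_eq_tsum_increments he he0 hq hq1,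
    add_assoc, ← ENNReal.tsum_add]
  congr 1
  refine tsum_congr fun j => ?_
  have hΔ : 0 ≤ e (j + 1) - e j := sub_nonneg.2 (he j.le_succ)
  have hq' : ∑ k ∈ Finset.range (j + 1), q k ≤ 1 := by
    have h2 := ENNReal.sum_le_tsum (f := fun k => ENNReal.ofReal (q k)) (Finset.range (j + 1))
    rw [hq1, ← ENNReal.ofReal_sum_of_nonneg fun k _ => hq k] at h2
    exact ENNReal.ofReal_le_one.1 h2
  have := hpq (j + 1)
  rw [ENNReal.ofReal_mul hΔ, ← mul_add, ← ENNReal.ofReal_add (by linarith) (by linarith)]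
  congr 2
  ring

/-! ### Jumps of the energy and of the entropy -/

theorem jump_eq {F : (𝓗 →L[ℂ] 𝓗) → ℝ≥0∞} {ρ₀ : 𝓗 →L[ℂ] 𝓗} (h : F ρ₀ ≠ ⊤)
    (ρ : ℕ → 𝓗 →L[ℂ] 𝓗) :
    jump F ρ ρ₀ = limsup (fun n => (F (ρ n) : EReal)) atTop - (F ρ₀ : EReal) := by
  rw [jump, if_neg h]

/-- Legendre bound: `η(x) - s x` is maximal at `x = e^{-1-s}`, with value `e^{-1-s}`. It follows
from `1 - 1/y ≤ log y` at `y = x e^{1+s}`. -/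
theorem negMulLog_le_mul_add_exp (s : ℝ) {x : ℝ} (hx : 0 ≤ x) :
    Real.negMulLog x ≤ s * x + Real.exp (-1 - s) := by
  rcases hx.eq_or_lt with rfl | hx
  · simpa using (Real.exp_pos _).le
  · have hy : 0 < x * Real.exp (1 + s) := by positivity
    have h1 := Real.one_sub_inv_le_log_of_pos hy
    rw [Real.log_mul hx.ne' (Real.exp_pos _).ne', Real.log_exp] at h1
    have h2 : x * (x * Real.exp (1 + s))⁻¹ = Real.exp (-1 - s) := by
      rw [mul_inv, ← mul_assoc, mul_inv_cancel₀ hx.ne', one_mul, ← Real.exp_neg]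
      congr 1
      ring
    have h3 := mul_le_mul_of_nonneg_left h1 hx.le
    rw [mul_sub, h2] at h3
    rw [Real.negMulLog]
    linarith

namespace Hamiltonian

variable {H : Hamiltonian 𝓗} {E : ℝ} {ρ : ℕ → 𝓗 →L[ℂ] 𝓗} {ρ₀ : 𝓗 →L[ℂ] 𝓗}

theorem ConvergesIn.isState (h : H.ConvergesIn E ρ ρ₀) (n : ℕ) : IsState (ρ n) := (h.1 n).1

/-! ### The three upper bounds -/

namespace Eigenbasis

variable (B : H.Eigenbasis)

/-- The point of the identity is that the gap consists of nonnegative terms, each involving finitely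
many eigenvalues and populations and hence continuous in `σ`. -/
theorem energy_rearrange_add {σ : 𝓗 →L[ℂ] 𝓗} (hσ : IsState σ) :
    H.energy (B.rearrange σ) + ∑' j, ENNReal.ofReal ((B.extLevel (j + 1) - B.extLevel j)
        * (∑ k ∈ Finset.range (j + 1), decreasingEigenvalue σ k
          - ∑ k ∈ Finset.range (j + 1), B.population σ k))
      = H.energy σ := by
  rw [B.energy_rearrange_eq_tsum hσ, B.energy_eq_tsum_population hσ]
  exact tsum_mul_eq_add_tsum B.extLevel_monotone (B.extLevel_nonneg 0) (B.population_nonneg hσ)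
    (B.tsum_population hσ) hσ.decreasingEigenvalue_nonneg hσ.tsum_decreasingEigenvalue
    (B.sum_population_le hσ)

theorem energy_rearrange_le {σ : 𝓗 →L[ℂ] 𝓗} (hσ : IsState σ) :
    H.energy (B.rearrange σ) ≤ H.energy σ := by
  rw [← B.energy_rearrange_add hσ]
  exact le_self_add

/-- The energy is lower semicontinuous by Fatou, as populations converge; so the limit state has
finite energy and its jumps are genuine differences. -/
theorem energy_limit_le (B : H.Eigenbasis) (h : H.ConvergesIn E ρ ρ₀) : H.energy ρ₀ ≤ ENNReal.ofReal E := by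
  rw [B.energy_eq_tsum_population h.2.1]
  refine (tsum_le_liminf (f := fun n k =>
    ENNReal.ofReal (B.extLevel k) * ENNReal.ofReal (B.population (ρ n) k)) fun k => ?_).trans ?_
  · refine ENNReal.Tendsto.const_mul ?_ (Or.inr ENNReal.ofReal_ne_top)
    exact (ENNReal.continuous_ofReal.tendsto _).comp (B.tendsto_population h.2.2.tendsto k)
  · refine liminf_le_of_le (by isBoundedDefault) fun b hb => ?_
    obtain ⟨n, hn⟩ := hb.exists
    rw [← B.energy_eq_tsum_population (h.isState n)] at hn
    exact hn.trans (h.1 n).2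

theorem le_energy (B : H.Eigenbasis) [Nontrivial 𝓗] {σ : 𝓗 →L[ℂ] 𝓗} (hσ : IsState σ) :
    ENNReal.ofReal H.groundEnergy ≤ H.energy σ := by
  rw [B.energy_eq_tsum_population hσ, B.groundEnergy_eq]
  calc ENNReal.ofReal (B.extLevel 0)
      = ∑' k, ENNReal.ofReal (B.extLevel 0) * ENNReal.ofReal (B.population σ k) := by
        rw [ENNReal.tsum_mul_left, B.tsum_population hσ, mul_one]
    _ ≤ _ := by
        refine ENNReal.tsum_le_tsum fun k => ?_
        gcongr
        exact B.extLevel_monotone k.zero_le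

theorem jump_energy_le (B : H.Eigenbasis) [Nontrivial 𝓗] (hE : 0 ≤ E) (h : H.ConvergesIn E ρ ρ₀) :
    jump H.energy ρ ρ₀ ≤ ((E - H.groundEnergy : ℝ) : EReal) := by
  have hfin := ne_top_of_le_ne_top ENNReal.ofReal_ne_top (B.energy_limit_le h)
  rw [jump_eq hfin, EReal.coe_sub]
  refine EReal.sub_le_sub (limsup_le_of_le (by isBoundedDefault) (Eventually.of_forall fun n => ?_))
    ?_
  · have := EReal.coe_ennreal_le_coe_ennreal_iff.2 (h.1 n).2
    rwa [EReal.coe_ennreal_ofReal, max_eq_left hE] at this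
  · have := EReal.coe_ennreal_le_coe_ennreal_iff.2 (B.le_energy h.2.1)
    rwa [EReal.coe_ennreal_ofReal, max_eq_left H.groundEnergy_nonneg] at this

theorem jump_energy_rearrange_le (h : H.ConvergesIn E ρ ρ₀) :
    jump (fun σ => H.energy (B.rearrange σ)) ρ ρ₀ ≤ jump H.energy ρ ρ₀ := by
  have hfin := ne_top_of_le_ne_top ENNReal.ofReal_ne_top (B.energy_limit_le h)
  rw [jump_eq hfin, jump_eq (F := fun σ => H.energy (B.rearrange σ)) 
    (ne_top_of_le_ne_top hfin (B.energy_rearrange_le h.2.1))]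
  have h1 := limsup_sub_le (a := 1) (C := 0) ENNReal.one_ne_top ENNReal.zero_ne_top
    (ENNReal.ofReal_ne_top (r := E))
    (fun n => by rw [one_mul, add_zero]; exact B.energy_rearrange_add (h.isState n))
    (by rw [one_mul, add_zero]; exact B.energy_rearrange_add h.2.1)
    (tsum_le_liminf fun j => ?_) (fun n => (h.1 n).2) hfin
  · simpa using h1
  · refine (ENNReal.continuous_ofReal.tendsto _).comp (Tendsto.const_mul _ ?_)
    exact (tendsto_sum_decreasingEigenvalue h.isState h.2.1 h.2.2.tendsto (j + 1)).sub
      (tendsto_finsetSum _ fun k _ => B.tendsto_population h.2.2.tendsto k)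

/-- The Gibbs weights of the levels, up to a factor, continued by zeros. -/
def weight (l : ℝ) (k : ℕ) : ℝ :=
  if (k : ℕ∞) < B.N then Real.exp (-1 - l * B.extLevel k) else 0

theorem weight_nonneg (l : ℝ) (k : ℕ) : 0 ≤ B.weight l k := by
  rw [weight]
  split_ifs
  · exact (Real.exp_pos _).le
  · exact le_rfl

theorem tsum_weight_ne_top {l : ℝ} (hl : 0 < l) (hZ : posTrace (H.expNeg l) < ⊤) :
    ∑' k, ENNReal.ofReal (B.weight l k) ≠ ⊤ := by
  refine ne_top_of_le_ne_top hZ.ne ?_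
  rw [B.posTrace_expNeg hl, ← B.tsum_subtype_eq fun k hk => by
    rw [weight, if_neg (not_lt.2 hk), ENNReal.ofReal_zero]]
  refine ENNReal.tsum_le_tsum fun k => ENNReal.ofReal_le_ofReal ?_
  rw [weight, if_pos k.2, B.extLevel_eq]
  exact Real.exp_le_exp.2 (by linarith)

theorem negMulLog_le (l : ℝ) {σ : 𝓗 →L[ℂ] 𝓗} (hσ : IsState σ) (k : ℕ) :
    Real.negMulLog (decreasingEigenvalue σ k)
      ≤ l * (B.extLevel k * decreasingEigenvalue σ k) + B.weight l k := by
  rcases lt_or_ge (k : ℕ∞) B.N with hk | hk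
  · rw [weight, if_pos hk, ← mul_assoc]
    exact negMulLog_le_mul_add_exp _ (hσ.decreasingEigenvalue_nonneg k)
  · rw [weight, if_neg (not_lt.2 hk), B.decreasingEigenvalue_of_le hσ hk]
    simp

/-- The second sum on the left is the relative entropy of `σ↓` with respect to the operator with
eigenvalues `weight l k`. Its terms are nonnegative by the Legendre bound with `s = l Eₖ`; past the
dimension both eigenvalue and weight vanish. -/
theorem entropy_add {l : ℝ} (hl : 0 < l) {σ : 𝓗 →L[ℂ] 𝓗} (hσ : IsState σ) :
    entropy σ + ∑' k, ENNReal.ofReal (l * (B.extLevel k * decreasingEigenvalue σ k)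
        + B.weight l k - Real.negMulLog (decreasingEigenvalue σ k))
      = ENNReal.ofReal l * H.energy (B.rearrange σ) + ∑' k, ENNReal.ofReal (B.weight l k) := by
  rw [IsState.entropy_eq _ hσ, B.energy_rearrange_eq_tsum hσ, ← ENNReal.tsum_mul_left,
    ← ENNReal.tsum_add, ← ENNReal.tsum_add]
  refine tsum_congr fun k => ?_
  have h0 := hσ.decreasingEigenvalue_nonneg k
  have h1 := B.extLevel_nonneg k
  have h2 := B.weight_nonneg l k
  rw [← ENNReal.ofReal_mul h1, ← ENNReal.ofReal_mul hl.le, ← ENNReal.ofReal_add (by positivity) h2,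
    ← ENNReal.ofReal_add (Real.negMulLog_nonneg h0 (hσ.decreasingEigenvalue_le_one k))
      (sub_nonneg.2 (B.negMulLog_le l hσ k))]
  congr 1
  ring

theorem entropy_limit_ne_top (B : H.Eigenbasis) {l : ℝ} (hl : 0 < l) (hZ : posTrace (H.expNeg l) < ⊤)
    (h : H.ConvergesIn E ρ ρ₀) : entropy ρ₀ ≠ ⊤ := by
  have h1 : H.energy (B.rearrange ρ₀) ≠ ⊤ := ne_top_of_le_ne_top ENNReal.ofReal_ne_top
    ((B.energy_rearrange_le h.2.1).trans (B.energy_limit_le h))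
  have h2 : ENNReal.ofReal l * H.energy (B.rearrange ρ₀)
      + ∑' k, ENNReal.ofReal (B.weight l k) ≠ ⊤ :=
    ENNReal.add_ne_top.2 ⟨ENNReal.mul_ne_top ENNReal.ofReal_ne_top h1, B.tsum_weight_ne_top hl hZ⟩
  rw [← B.entropy_add hl h.2.1] at h2
  exact (ENNReal.add_ne_top.1 h2).1

theorem jump_entropy_le_mul {l : ℝ} (hl : 0 < l) (hZ : posTrace (H.expNeg l) < ⊤)
    (h : H.ConvergesIn E ρ ρ₀) :
    jump entropy ρ ρ₀ ≤ (l : EReal) * jump (fun σ => H.energy (B.rearrange σ)) ρ ρ₀ := by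
  have hfin := ne_top_of_le_ne_top ENNReal.ofReal_ne_top
    ((B.energy_rearrange_le h.2.1).trans (B.energy_limit_le h))
  rw [jump_eq (B.entropy_limit_ne_top hl hZ h), jump_eq (F := fun σ => H.energy (B.rearrange σ)) hfin]
  have h1 := limsup_sub_le (ENNReal.ofReal_ne_top (r := l)) (B.tsum_weight_ne_top hl hZ)
    (ENNReal.ofReal_ne_top (r := E)) (fun n => B.entropy_add hl (h.isState n))
    (B.entropy_add hl h.2.1) (tsum_le_liminf fun k => ?_)
    (fun n => (B.energy_rearrange_le (h.isState n)).trans (h.1 n).2) hfin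
  · rwa [EReal.coe_ennreal_ofReal, max_eq_left hl.le] at h1
  · have h2 := tendsto_decreasingEigenvalue h.isState h.2.1 h.2.2.tendsto k
    refine (ENNReal.continuous_ofReal.tendsto _).comp (Tendsto.sub (Tendsto.add_const _
      (Tendsto.const_mul _ (Tendsto.const_mul _ h2))) ?_)
    exact (Real.continuous_negMulLog.tendsto _).comp h2

/-- Finiteness of this jump allows the limit in `l` to be taken in `ℝ`, away from the
discontinuities of multiplication in `EReal`. -/
theorem jump_energy_rearrange_eq_coe (h : H.ConvergesIn E ρ ρ₀) :
    ∃ j : ℝ, jump (fun σ => H.energy (B.rearrange σ)) ρ ρ₀ = j := by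
  have hfin := ne_top_of_le_ne_top ENNReal.ofReal_ne_top
    ((B.energy_rearrange_le h.2.1).trans (B.energy_limit_le h))
  have hL : limsup (fun n => H.energy (B.rearrange (ρ n))) atTop ≠ ⊤ :=
    ne_top_of_le_ne_top (ENNReal.ofReal_ne_top (r := E)) (limsup_le_of_le (by isBoundedDefault)
      (Eventually.of_forall fun n => (B.energy_rearrange_le (h.isState n)).trans (h.1 n).2))
  rw [jump_eq (F := fun σ => H.energy (B.rearrange σ)) hfin, ← coe_limsup, ← EReal.coe_ennreal_toReal hL, ← EReal.coe_ennreal_toReal hfin,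
    ← EReal.coe_sub]
  exact ⟨_, rfl⟩

end Eigenbasis

theorem exists_of_g_lt {x : ℝ≥0∞} (hx : H.g < x) :
    ∃ l : ℝ, 0 < l ∧ posTrace (H.expNeg l) < ⊤ ∧ ENNReal.ofReal l < x := by
  rw [g] at hx
  simp only [iInf_lt_iff] at hx
  obtain ⟨l, ⟨h1, h2⟩, h3⟩ := hx
  exact ⟨l, h1, h2, h3⟩

theorem posTrace_expNeg_eq_top {l : ℝ} (hl : 0 < l) (h : ENNReal.ofReal l < H.g) :
    posTrace (H.expNeg l) = ⊤ := by
  by_contra hne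
  exact absurd h (not_lt.2 (iInf₂_le (f := fun (l : ℝ) _ => ENNReal.ofReal l) l
    ⟨hl, lt_top_iff_ne_top.2 hne⟩))

theorem Eigenbasis.jump_entropy_le (B : H.Eigenbasis) (hg : H.g < ⊤)
    (h : H.ConvergesIn E ρ ρ₀) :
    jump entropy ρ ρ₀ ≤ (H.g : EReal) * jump (fun σ => H.energy (B.rearrange σ)) ρ ρ₀ := by
  obtain ⟨j, hj⟩ := B.jump_energy_rearrange_eq_coe h
  -- The infimum `g(H)` need not be attained, so it is approached by exponents with finite trace.
  have hex : ∀ n : ℕ, ∃ l : ℝ, 0 < l ∧ posTrace (H.expNeg l) < ⊤ ∧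
      ENNReal.ofReal l < H.g + ENNReal.ofReal (1 / ((n : ℝ) + 1)) := fun n =>
    exists_of_g_lt (ENNReal.lt_add_right hg.ne (by
      rw [ne_eq, ENNReal.ofReal_eq_zero, not_le]; positivity))
  choose l hl0 hlZ hlg using hex
  have hge : ∀ n, H.g.toReal ≤ l n := fun n => by
    refine ENNReal.toReal_le_of_le_ofReal (hl0 n).le ?_
    exact iInf₂_le (f := fun (l : ℝ) _ => ENNReal.ofReal l) (l n) ⟨hl0 n, hlZ n⟩
  have hle : ∀ n, l n ≤ H.g.toReal + 1 / ((n : ℝ) + 1) := fun n => by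
    have h1 := hlg n
    rw [← ENNReal.ofReal_toReal hg.ne, ← ENNReal.ofReal_add ENNReal.toReal_nonneg (by positivity)]
      at h1
    exact (ENNReal.ofReal_lt_ofReal_iff_of_nonneg (hl0 n).le).1 h1 |>.le
  have hlim : Tendsto l atTop (𝓝 H.g.toReal) :=
    tendsto_of_tendsto_of_tendsto_of_le_of_le tendsto_const_nhds
      (by simpa using tendsto_one_div_add_atTop_nhds_zero_nat.const_add H.g.toReal) hge hle
  have hbd : ∀ n, jump entropy ρ ρ₀ ≤ ((l n * j : ℝ) : EReal) := fun n => by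
    have h1 := B.jump_entropy_le_mul (hl0 n) (hlZ n) h
    rwa [hj, ← EReal.coe_mul] at h1
  have h2 := ge_of_tendsto' ((continuous_coe_real_ereal.tendsto _).comp (hlim.mul_const j)) hbd
  rwa [EReal.coe_mul, EReal.coe_ennreal_toReal hg.ne, ← hj] at h2

end Hamiltonian

/-! ### Mixtures of orthogonal pure states -/

/-- The operator `∑ wᵢ |vᵢ⟩⟨vᵢ|`. -/
def mixture {ι : Type*} [Fintype ι] (v : ι → 𝓗) (w : ι → ℝ) : 𝓗 →L[ℂ] 𝓗 :=
  ∑ i, (w i : ℂ) • InnerProductSpace.rankOne ℂ (v i) (v i)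

section Mixture

variable {ι : Type*} [Fintype ι] {v : ι → 𝓗} {w w' : ι → ℝ}

theorem mixture_sub (v : ι → 𝓗) (w w' : ι → ℝ) :
    mixture v w - mixture v w' = mixture v (w - w') := by
  simp only [mixture, ← Finset.sum_sub_distrib, ← sub_smul]
  simp

theorem mixture_apply (v : ι → 𝓗) (w : ι → ℝ) (x : 𝓗) :
    mixture v w x = ∑ i, (w i : ℂ) • ⟪v i, x⟫_ℂ • v i := by
  simp [mixture]

theorem mixture_isSelfAdjoint (v : ι → 𝓗) (w : ι → ℝ) : IsSelfAdjoint (mixture v w) := by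
  rw [ContinuousLinearMap.isSelfAdjoint_iff_isSymmetric]
  intro x y
  change ⟪mixture v w x, y⟫_ℂ = ⟪x, mixture v w y⟫_ℂ
  rw [mixture_apply, mixture_apply, sum_inner, inner_sum]
  refine Finset.sum_congr rfl fun i _ => ?_
  rw [inner_smul_left, inner_smul_left, inner_smul_right, inner_smul_right, inner_conj_symm,
    Complex.conj_ofReal]
  ring

theorem mixture_isPositive (v : ι → 𝓗) (hw : ∀ i, 0 ≤ w i) : (mixture v w).IsPositive := by
  refine ContinuousLinearMap.isPositive_sum _ fun i _ => ?_
  exact (InnerProductSpace.isPositive_rankOne_self (v i)).smul_of_nonneg (by exact_mod_cast hw i)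

theorem exists_hilbertBasis_mixture (hv : Orthonormal ℂ v) :
    ∃ (s : Set 𝓗) (b : HilbertBasis s ℂ 𝓗) (j : ι → s), Function.Injective j ∧
      (∀ i, b (j i) = v i) ∧
      ∀ w k, mixture v w (b k) = ((Function.extend j w 0 k : ℝ) : ℂ) • b k := by
  classical
  obtain ⟨s, b, j, hj, hb⟩ := exists_hilbertBasis_extending hv
  refine ⟨s, b, j, hj, hb, fun w k => ?_⟩
  rw [mixture_apply]
  by_cases hk : ∃ i, j i = k
  · obtain ⟨i, rfl⟩ := hk
    rw [hj.extend_apply, hb, Finset.sum_eq_single i]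
    · rw [orthonormal_iff_ite.1 hv i i, if_pos rfl, one_smul]
    · intro l _ hl
      rw [orthonormal_iff_ite.1 hv l i, if_neg hl, zero_smul, smul_zero]
    · exact fun h => absurd (Finset.mem_univ i) h
  · rw [Function.extend_apply' _ _ _ hk, Finset.sum_eq_zero]
    · simp
    · intro l _
      rw [← hb, b.orthonormal.2 fun h => hk ⟨l, h⟩, zero_smul, smul_zero]

theorem tsum_extend {κ : Type*} {j : ι → κ} (hj : Function.Injective j) (f : ℝ → κ → ℝ≥0∞)
    (hf : ∀ k, f 0 k = 0) (w : ι → ℝ) :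
    ∑' k, f (Function.extend j w 0 k) k = ∑ i, f (w i) (j i) := by
  rw [← hj.tsum_eq (f := fun k => f (Function.extend j w 0 k) k), tsum_fintype]
  · simp only [hj.extend_apply]
  · intro k hk
    by_contra h
    refine hk ?_
    beta_reduce
    rw [Function.extend_apply' _ _ _ h]
    exact hf k

theorem mixture_isState (hv : Orthonormal ℂ v) (hw : ∀ i, 0 ≤ w i) (hw1 : ∑ i, w i = 1) :
    IsState (mixture v w) := by
  obtain ⟨s, b, j, hj, -, h⟩ := exists_hilbertBasis_mixture hv
  refine ⟨mixture_isPositive v hw, ?_⟩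
  rw [posTrace_eq_tsum_eigenvalue b (mixture_isPositive v hw) (h w),
    tsum_extend hj (fun x _ => ENNReal.ofReal x) fun _ => ENNReal.ofReal_zero,
    ← ENNReal.ofReal_sum_of_nonneg fun i _ => hw i, hw1, ENNReal.ofReal_one]

theorem entropy_mixture (hv : Orthonormal ℂ v) (hw : ∀ i, 0 ≤ w i) (hw1 : ∑ i, w i = 1) :
    entropy (mixture v w) = ∑ i, ENNReal.ofReal (Real.negMulLog (w i)) := by
  obtain ⟨s, b, j, hj, -, h⟩ := exists_hilbertBasis_mixture hv
  rw [entropy_eq_tsum (b := b) ⟨mixture_isState hv hw hw1, h w⟩,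
    tsum_extend hj (fun x _ => ENNReal.ofReal (Real.negMulLog x)) fun _ => by simp]

theorem traceNorm_mixture (hv : Orthonormal ℂ v) (w : ι → ℝ) :
    traceNorm (mixture v w) = ∑ i, ENNReal.ofReal |w i| := by
  obtain ⟨s, b, j, hj, -, h⟩ := exists_hilbertBasis_mixture hv
  rw [traceNorm_eq_tsum b (mixture_isSelfAdjoint v w) (h w),
    tsum_extend hj (fun x _ => ENNReal.ofReal |x|) fun _ => by simp]

/-- The form bound on `Pₙ H` holds uniformly in `n`, so no eigenbasis is required; this matters when
`H` may have infinite-dimensional spectral subspaces. -/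
theorem Hamiltonian.energy_mixture_le (H : Hamiltonian 𝓗) {v : ι → H.op.domain}
    (hv : Orthonormal ℂ fun i => (v i : 𝓗)) (hw : ∀ i, 0 ≤ w i) (hw1 : ∑ i, w i = 1)
    {ε : ι → ℝ} (hε : ∀ i, (⟪(v i : 𝓗), H.op (v i)⟫_ℂ).re ≤ ε i) :
    H.energy (mixture (fun i => (v i : 𝓗)) w) ≤ ENNReal.ofReal (∑ i, w i * ε i) := by
  obtain ⟨s, b, j, hj, hb, h⟩ := exists_hilbertBasis_mixture hv
  have hd : IsDiagonal b _ _ := ⟨mixture_isState hv hw hw1, h w⟩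
  rw [H.energy_eq_iSup b hd.apply hd.summable hd.nonneg]
  refine iSup_le fun n => ?_
  rw [tsum_extend hj (fun x k => ENNReal.ofReal x
    * ENNReal.ofReal (⟪b k, H.cutoff n (b k)⟫_ℂ).re) fun _ => by simp,
    ENNReal.ofReal_sum_of_nonneg fun i _ => mul_nonneg (hw i) ((H.nonneg _).trans (hε i))]
  refine Finset.sum_le_sum fun i _ => ?_
  rw [hb, ENNReal.ofReal_mul (hw i)]
  gcongr
  exact (H.inner_cutoff_le n (v i)).trans (hε i)

end Mixture

/-! ### Sequences with large entropy jumps -/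

/-- The right side equals `p log d - p log p` when `p, d > 0`, and `-p log p ≥ 0` for `p ≤ 1`. -/
theorem mul_log_le_mul_negMulLog_div {p : ℝ} (hp0 : 0 ≤ p) (hp1 : p ≤ 1) (d : ℕ) :
    p * Real.log d ≤ d * Real.negMulLog (p / d) := by
  rcases hp0.eq_or_lt with rfl | hp
  · simp
  rcases Nat.eq_zero_or_pos d with rfl | hd
  · simp
  have hd' : (0 : ℝ) < d := by exact_mod_cast hd
  rw [Real.negMulLog, Real.log_div hp.ne' hd'.ne']
  have h1 : (d : ℝ) * (-(p / d) * (Real.log p - Real.log d)) = p * Real.log d - p * Real.log p := by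
    field_simp
    ring
  have h2 : p * Real.log p ≤ 0 :=
    mul_nonpos_of_nonneg_of_nonpos hp0 (Real.log_nonpos hp0 hp1)
  rw [h1]
  linarith

namespace Hamiltonian

variable (H : Hamiltonian 𝓗) {E : ℝ}

/-- Mixing a pure state of low energy with a small amount of a uniform mixture of high
energy. -/
theorem exists_convergesIn_entropy_ge (φ : H.op.domain) (hφ : ‖(φ : 𝓗)‖ = 1) {ε : ℝ}
    (hε : (⟪(φ : 𝓗), H.op φ⟫_ℂ).re ≤ ε) {d : ℕ → ℕ} {x p : ℕ → ℝ} (hp0 : ∀ n, 0 ≤ p n)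
    (hp1 : ∀ n, p n ≤ 1) (hp : Tendsto p atTop (𝓝 0)) (hd : ∀ n, d n = 0 → p n = 0)
    (hE : ∀ n, (1 - p n) * ε + p n * x n ≤ E)
    (hv : ∀ n, ∃ v : Fin (d n) → H.op.domain, Orthonormal ℂ (fun i => (v i : 𝓗)) ∧
      (∀ i, ⟪(φ : 𝓗), (v i : 𝓗)⟫_ℂ = 0) ∧ ∀ i, (⟪(v i : 𝓗), H.op (v i)⟫_ℂ).re ≤ x n) :
    ∃ (ρ : ℕ → 𝓗 →L[ℂ] 𝓗) (ρ₀ : 𝓗 →L[ℂ] 𝓗), H.ConvergesIn E ρ ρ₀ ∧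
      limsup (fun n => ((ENNReal.ofReal (p n * Real.log (d n)) : ℝ≥0∞) : EReal)) atTop
        ≤ jump entropy ρ ρ₀ := by
  choose v hvo hvφ hvE using hv
  set V : (n : ℕ) → Option (Fin (d n)) → H.op.domain := fun n o => o.elim φ (v n) with hV
  set W : (n : ℕ) → Option (Fin (d n)) → ℝ := fun n o => o.elim (1 - p n) fun _ => p n / d n
    with hW
  -- The limit state is rewritten over the same vectors as the `n`-th mixture. The difference then
  -- has weights `-pₙ` and `dₙ` times `pₙ/dₙ`, hence trace norm `2 pₙ`.
  set W₀ : (n : ℕ) → Option (Fin (d n)) → ℝ := fun n o => o.elim 1 fun _ => 0 with hW₀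
  have hVo : ∀ n, Orthonormal ℂ fun o => (V n o : 𝓗) := by
    intro n
    refine ⟨fun o => ?_, fun o o' hoo => ?_⟩
    · cases o with
      | none => exact hφ
      | some i => exact (hvo n).1 i
    · cases o with
      | none =>
        cases o' with
        | none => exact absurd rfl hoo
        | some i => exact hvφ n i
      | some i =>
        cases o' with
        | none => rw [← inner_conj_symm]; exact (congrArg _ (hvφ n i)).trans (map_zero _)
        | some i' => exact (hvo n).2 fun h => hoo (congrArg some h)
  -- Division by zero gives `0`, so for `dₙ = 0` this needs `pₙ = 0`.
  have hdp : ∀ n, (d n : ℝ) * (p n / d n) = p n := by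
    intro n
    by_cases h : d n = 0
    · simp [h, hd n h]
    · field_simp
  have hWn : ∀ n o, 0 ≤ W n o := by
    rintro n (_ | i)
    · exact sub_nonneg.2 (hp1 n)
    · exact div_nonneg (hp0 n) (Nat.cast_nonneg _)
  have hsum : ∀ n, ∑ o, W n o = 1 := by
    intro n
    simp [hW, Fintype.sum_option, hdp]
  have hW₀n : ∀ n o, 0 ≤ W₀ n o := by
    rintro n (_ | i)
    · exact zero_le_one
    · exact le_rfl
  have hW₀s : ∀ n, ∑ o, W₀ n o = 1 := fun n => by simp [hW₀, Fintype.sum_option]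
  set ρ₀ : 𝓗 →L[ℂ] 𝓗 := InnerProductSpace.rankOne ℂ (φ : 𝓗) (φ : 𝓗) with hρ₀
  have hρ₀m : ∀ n, ρ₀ = mixture (fun o => (V n o : 𝓗)) (W₀ n) := fun n => by
    simp [mixture, hW₀, hV, Fintype.sum_option, hρ₀]
  refine ⟨fun n => mixture (fun o => (V n o : 𝓗)) (W n), ρ₀, ⟨fun n => ⟨mixture_isState (hVo n)
    (hWn n) (hsum n), ?_⟩, ?_, ?_⟩, ?_⟩
  · refine (H.energy_mixture_le (hVo n) (hWn n) (hsum n)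
      (ε := fun o => o.elim ε fun _ => x n) ?_).trans (ENNReal.ofReal_le_ofReal ?_)
    · rintro (_ | i)
      · exact hε
      · exact hvE n i
    · refine le_trans (le_of_eq ?_) (hE n)
      simp [hW, Fintype.sum_option, ← mul_assoc, hdp]
  · rw [hρ₀m 0]
    exact mixture_isState (hVo 0) (hW₀n 0) (hW₀s 0)
  · have hn : ∀ n, traceNorm (mixture (fun o => (V n o : 𝓗)) (W n) - ρ₀)
        = ENNReal.ofReal (2 * p n) := by
      intro n
      rw [hρ₀m n, mixture_sub, traceNorm_mixture (hVo n),
        ← ENNReal.ofReal_sum_of_nonneg fun _ _ => abs_nonneg _]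
      congr 1
      have h1 : |p n / (d n : ℝ)| = p n / d n :=
        abs_of_nonneg (div_nonneg (hp0 n) (Nat.cast_nonneg _))
      simp [hW, hW₀, Fintype.sum_option, h1, hdp, abs_of_nonneg (hp0 n)]
      ring
    rw [TraceTendsto]
    simp only [hn]
    have h2 : Tendsto (fun n => ENNReal.ofReal (2 * p n)) atTop (𝓝 (ENNReal.ofReal (2 * 0))) :=
      (ENNReal.continuous_ofReal.tendsto _).comp (hp.const_mul 2)
    simpa using h2
  · have h0 : entropy ρ₀ = 0 := by
      rw [hρ₀m 0, entropy_mixture (hVo 0) (hW₀n 0) (hW₀s 0)]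
      simp [hW₀, Fintype.sum_option]
    rw [jump_eq (by rw [h0]; exact ENNReal.zero_ne_top), h0, EReal.coe_ennreal_zero, sub_zero]
    refine limsup_le_limsup (Eventually.of_forall fun n => ?_) (by isBoundedDefault)
      (by isBoundedDefault)
    beta_reduce
    rw [EReal.coe_ennreal_le_coe_ennreal_iff, entropy_mixture (hVo n) (hWn n) (hsum n),
      Fintype.sum_option]
    -- The nonnegative contribution of the weight `1 - pₙ` is discarded.
    refine le_trans ?_ le_add_self
    simp only [hW, Option.elim, Finset.sum_const, Finset.card_univ, Fintype.card_fin, nsmul_eq_mul]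
    rw [← ENNReal.ofReal_natCast, ← ENNReal.ofReal_mul (Nat.cast_nonneg _)]
    exact ENNReal.ofReal_le_ofReal (mul_log_le_mul_negMulLog_div (hp0 n) (hp1 n) _)

/-- If the spectral subspaces of `H` are finite-dimensional, then `H` has an eigenbasis. -/
theorem nonempty_eigenbasis (h : ∀ n, FiniteDimensional ℂ (H.spectralSubspace n)) :
    Nonempty H.Eigenbasis := by
  obtain ⟨w, b, s, hs⟩ := exists_hilbertBasis_eigenvectors H.resolvent_selfAdjoint
    (H.isCompactOperator_resolvent h)
  have hs0 : ∀ i, 0 ≤ s i := eigenvalue_nonneg H.resolvent_isPositive hs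
  -- The resolvent is injective, so `0` is not an eigenvalue; an eigenvalue `s` of `(1 + H)⁻¹`
  -- corresponds to the level `s⁻¹ - 1` of `H`.
  have hne : ∀ i, s i ≠ 0 := by
    intro i hi
    have h1 := H.resolvent_spec (b i)
    have h2 : H.resolvent (b i) = 0 := by rw [hs, hi]; simp
    have h3 : (⟨H.resolvent (b i), H.resolvent_mem (b i)⟩ : H.op.domain) = 0 := Subtype.ext h2
    rw [h3, LinearPMap.map_zero, h2, add_zero] at h1
    exact b.orthonormal.ne_zero i h1.symm
  have hpos : ∀ i, 0 < s i := fun i => (hs0 i).lt_of_ne (hne i).symm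
  have hmem : ∀ i, b i ∈ H.op.domain := by
    intro i
    have h1 := H.op.domain.smul_mem ((s i : ℂ)⁻¹) (H.resolvent_mem (b i))
    rwa [hs, inv_smul_smul₀ (by exact_mod_cast hne i)] at h1
  have heig : ∀ i, H.op ⟨b i, hmem i⟩ = (((s i)⁻¹ - 1 : ℝ) : ℂ) • b i := by
    intro i
    have h1 := H.resolvent_spec (b i)
    have h2 : (⟨H.resolvent (b i), H.resolvent_mem (b i)⟩ : H.op.domain)
        = (s i : ℂ) • ⟨b i, hmem i⟩ := Subtype.ext (hs i)
    rw [h2, LinearPMap.map_smul, hs] at h1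
    have h3 : (s i : ℂ) ≠ 0 := by exact_mod_cast hne i
    have h4 : (s i : ℂ) • H.op ⟨b i, hmem i⟩ = (s i : ℂ) • ((((s i)⁻¹ - 1 : ℝ) : ℂ) • b i) := by
      rw [eq_sub_of_add_eq' h1, smul_smul]
      push_cast
      rw [mul_sub, mul_inv_cancel₀ h3, mul_one, sub_smul, one_smul]
    exact smul_right_injective 𝓗 h3 h4
  have hfin : ∀ x : ℝ, {i | (s i)⁻¹ - 1 ≤ x}.Finite := by
    intro x
    obtain ⟨n, hn⟩ := exists_nat_ge x
    have hK : ∀ i : {i | (s i)⁻¹ - 1 ≤ x}, b i ∈ H.spectralSubspace n := by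
      rintro ⟨i, hi⟩
      have hi' : (s i)⁻¹ ≤ n + 1 := by
        have : (s i)⁻¹ - 1 ≤ x := hi
        linarith
      have hk := cfc_apply_eigenvector (f := fun x : ℝ => max 0 (((n : ℝ) + 1)⁻¹ - x))
        H.resolvent_selfAdjoint (by fun_prop) (hs i)
      have hle : ((n : ℝ) + 1)⁻¹ ≤ s i := inv_le_of_inv_le₀ (hpos i) hi'
      rw [max_eq_left (by linarith), Complex.ofReal_zero, zero_smul] at hk
      exact hk
    have hli : LinearIndependent ℂ
        (fun i : {i | (s i)⁻¹ - 1 ≤ x} => (⟨b i, hK i⟩ : H.spectralSubspace n)) := by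
      refine LinearIndependent.of_comp (H.spectralSubspace n).subtype ?_
      exact b.orthonormal.linearIndependent.comp _ Subtype.val_injective
    have := h n
    have := hli.finite
    exact Set.toFinite _
  obtain ⟨e, he⟩ := exists_monotone_enumeration (fun i => (s i)⁻¹ - 1) hfin
  have hbasis : ⊤ ≤ (Submodule.span ℂ (Set.range fun k => b (e k))).topologicalClosure := by
    have : (Set.range fun k => b (e k)) = Set.range b := e.surjective.range_comp b
    rw [this]
    exact b.dense_span.ge
  have hcoe : ∀ k, HilbertBasis.mk (b.orthonormal.comp e e.injective) hbasis k = b (e k) :=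
    fun k => by rw [HilbertBasis.coe_mk]; rfl
  exact ⟨{
    N := ENat.card w
    basis := HilbertBasis.mk (b.orthonormal.comp e e.injective) hbasis
    level := fun k => (s (e k))⁻¹ - 1
    level_mono := he
    mem_domain := fun k => by rw [hcoe]; exact hmem _
    eigen := fun k => by
      have h1 := heig (e k)
      simp only [hcoe]
      exact h1 }⟩

theorem Eigenbasis.finite_level_le {H : Hamiltonian 𝓗} (B : H.Eigenbasis)
    (h : ∀ n, FiniteDimensional ℂ (H.spectralSubspace n)) (x : ℝ) : {k | B.level k ≤ x}.Finite := by
  obtain ⟨n, hn⟩ := exists_nat_ge x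
  have hli : LinearIndependent ℂ (fun k : {k | B.level k ≤ x} =>
      (⟨B.basis k, B.basis_mem_spectralSubspace (le_trans k.2 hn)⟩ : H.spectralSubspace n)) := by
    refine LinearIndependent.of_comp (H.spectralSubspace n).subtype ?_
    exact B.basis.orthonormal.linearIndependent.comp _ Subtype.val_injective
  have := h n
  have := hli.finite
  exact Set.toFinite _

end Hamiltonian

/-- Applied to `⟨φ|·⟩` on a spectral subspace, it leaves infinitely many dimensions orthogonal to
`φ`. -/
theorem not_finiteDimensional_ker {V : Type*} [AddCommGroup V] [Module ℂ V]
    (hV : ¬ FiniteDimensional ℂ V) (f : V →ₗ[ℂ] ℂ) : ¬ FiniteDimensional ℂ f.ker := by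
  intro h
  have : FiniteDimensional ℂ (V ⧸ f.ker) := Module.Finite.equiv f.quotKerEquivRange.symm
  exact hV (Module.Finite.of_submodule_quotient f.ker)

/-! ### Attaining the bound -/

namespace Hamiltonian

variable (H : Hamiltonian 𝓗) {E : ℝ}

theorem exists_energy_lt [Nontrivial 𝓗] (hE : H.groundEnergy < E) :
    ∃ φ : H.op.domain, ‖(φ : 𝓗)‖ = 1 ∧ (⟪(φ : 𝓗), H.op φ⟫_ℂ).re < E := by
  have := H.nonempty_unit
  obtain ⟨φ, hφ⟩ := exists_lt_of_ciInf_lt hE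
  exact ⟨φ.1, φ.2, hφ⟩

/-- Bounded energy with unlimited dimension: take `pₙ = c/(n+1)` and `dₙ ≥ exp((n+1)²)`, so that `pₙ
log dₙ ≥ c (n+1)` while the energy stays below `E`. -/
theorem exists_jump_eq_top [Nontrivial 𝓗] (hE : H.groundEnergy < E) {m : ℕ}
    (hm : ¬ FiniteDimensional ℂ (H.spectralSubspace m)) :
    ∃ (ρ : ℕ → 𝓗 →L[ℂ] 𝓗) (ρ₀ : 𝓗 →L[ℂ] 𝓗), H.ConvergesIn E ρ ρ₀ ∧
      jump entropy ρ ρ₀ = ⊤ := by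
  obtain ⟨φ, hφ, hφE⟩ := H.exists_energy_lt hE
  set ε := (⟪(φ : 𝓗), H.op φ⟫_ℂ).re with hε
  have hε0 : 0 ≤ ε := H.nonneg φ
  set f : H.spectralSubspace m →ₗ[ℂ] ℂ :=
    ((innerSL ℂ (φ : 𝓗) : 𝓗 →L[ℂ] ℂ) : 𝓗 →ₗ[ℂ] ℂ) ∘ₗ (H.spectralSubspace m).subtype with hf
  have hker := not_finiteDimensional_ker hm f
  -- Keeps `pₙ ≤ 1`, and keeps the added energy, at most `pₙ m`, within the margin `E - ε`.
  set c : ℝ := min 1 ((E - ε) / (m + 1)) with hc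
  have hc0 : 0 < c := lt_min one_pos (div_pos (sub_pos.2 hφE) (by positivity))
  have hcE : c * (m + 1) ≤ E - ε := by
    rw [← le_div_iff₀ (by positivity)]
    exact min_le_right _ _
  have hlog : ∀ n : ℕ, ((n : ℝ) + 1) ^ 2 ≤ Real.log (⌈Real.exp (((n : ℝ) + 1) ^ 2)⌉₊ : ℝ) := by
    intro n
    rw [Real.le_log_iff_exp_le (by exact_mod_cast Nat.ceil_pos.2 (Real.exp_pos _))]
    exact Nat.le_ceil _
  have hpc : ∀ n : ℕ, c / ((n : ℝ) + 1) ≤ c := fun n =>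
    div_le_self hc0.le (by linarith [(Nat.cast_nonneg n : (0 : ℝ) ≤ n)])
  obtain ⟨ρ, ρ₀, h1, h2⟩ := H.exists_convergesIn_entropy_ge (E := E) φ hφ hε.ge
    (d := fun n => ⌈Real.exp (((n : ℝ) + 1) ^ 2)⌉₊) (x := fun _ => m)
    (p := fun n => c / ((n : ℝ) + 1)) (fun n => by positivity)
    (fun n => (hpc n).trans (min_le_left _ _))
    (by simpa [div_eq_mul_one_div c] using
      tendsto_one_div_add_atTop_nhds_zero_nat.const_mul c)
    (fun n hn => absurd hn (Nat.ceil_pos.2 (Real.exp_pos _)).ne')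
    (fun n => by
      have h1 : 0 < c / ((n : ℝ) + 1) := by positivity
      have h2 := hpc n
      have h3 : c / ((n : ℝ) + 1) * m ≤ c * (m + 1) := by gcongr; linarith
      nlinarith)
    (fun n => by
      obtain ⟨u, hu⟩ := exists_orthonormal_fin (V := f.ker) (fun hfin => hker hfin) ⌈Real.exp (((n : ℝ) + 1) ^ 2)⌉₊
      have hu' : Orthonormal ℂ fun i => ((u i : H.spectralSubspace m) : 𝓗) :=
        (hu.comp_linearIsometry f.ker.subtypeₗᵢ).comp_linearIsometry
          (H.spectralSubspace m).subtypeₗᵢ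
      choose hd hle using fun i =>
        H.mem_domain_of_mem_spectralSubspace (u i : H.spectralSubspace m).2
      refine ⟨fun i => ⟨_, hd i⟩, hu', fun i => (u i).2, fun i => (hle i).trans ?_⟩
      rw [hu'.1 i]
      simp)
  refine ⟨ρ, ρ₀, h1, top_le_iff.1 (le_trans ?_ h2)⟩
  rw [← coe_limsup]
  have h3 : Tendsto (fun n : ℕ => ENNReal.ofReal (c / ((n : ℝ) + 1)
      * Real.log (⌈Real.exp (((n : ℝ) + 1) ^ 2)⌉₊ : ℝ))) atTop (𝓝 ⊤) := by
    refine ENNReal.tendsto_ofReal_atTop.comp (tendsto_atTop_mono (f := fun n : ℕ => c * (n : ℝ))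
      (fun n => ?_) (tendsto_natCast_atTop_atTop.const_mul_atTop hc0))
    calc c * (n : ℝ) ≤ c / ((n : ℝ) + 1) * ((n : ℝ) + 1) ^ 2 := by
          rw [sq, ← mul_assoc, div_mul_cancel₀ _ (by positivity)]
          gcongr
          linarith
      _ ≤ _ := by gcongr; exact hlog n
  rw [h3.limsup_eq, EReal.coe_ennreal_top]

namespace Eigenbasis

variable {H} (B : H.Eigenbasis)

/-- If `Tr e^{-l' H} = +∞`, then `log k > l Eₖ` for arbitrarily large `k`, for each `l < l'`. -/
theorem exists_level_lt_log {l l' : ℝ} (hl : 0 < l) (hll : l < l')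
    (hZ : posTrace (H.expNeg l') = ⊤) (K : ℕ) :
    ∃ k : {k : ℕ // (k : ℕ∞) < B.N}, K ≤ k ∧ l * B.level k < Real.log (k : ℕ) := by
  by_contra! hno
  rw [B.posTrace_expNeg (hl.trans hll)] at hZ
  -- If `log k ≤ l Eₖ` from `K` on, then `e^{-l'Eₖ} ≤ k^{-l'/l}` with `l'/l > 1`, which is summable.
  -- The indicator takes care of the first `K + 1` indices, including `k = 0`.
  set G : ℕ → ℝ := fun k => (if k ∈ Finset.range (K + 1) then 1 else 0) + 1 / (k : ℝ) ^ (l' / l)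
    with hG
  have hGs : Summable G := by
    refine (summable_of_hasFiniteSupport ((Finset.range (K + 1)).finite_toSet.subset ?_)).add
      (Real.summable_one_div_nat_rpow.2 ((one_lt_div hl).2 hll))
    intro k hk
    by_contra h
    exact hk (if_neg h)
  have hG0 : ∀ k, 0 ≤ G k := fun k => by
    refine add_nonneg ?_ (by positivity)
    split_ifs <;> norm_num
  have hle : ∀ k : {k : ℕ // (k : ℕ∞) < B.N}, Real.exp (-l' * B.level k) ≤ G k := by
    intro k
    have h0 := B.level_nonneg k
    by_cases hk : (k : ℕ) ∈ Finset.range (K + 1)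
    · rw [hG]
      simp only [if_pos hk]
      have h1 : Real.exp (-l' * B.level k) ≤ 1 := by
        rw [Real.exp_le_one_iff]
        nlinarith
      have h2 : 0 ≤ 1 / ((k : ℕ) : ℝ) ^ (l' / l) := by positivity
      linarith
    · rw [hG]
      simp only [if_neg hk, zero_add]
      have hk' : K + 1 ≤ (k : ℕ) := by simpa using hk
      have h1 := hno k (by omega)
      have hkpos : (0 : ℝ) < (k : ℕ) := by exact_mod_cast (by omega : 0 < (k : ℕ))
      rw [one_div, ← Real.rpow_neg hkpos.le, Real.rpow_def_of_pos hkpos]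
      refine Real.exp_le_exp.2 ?_
      have h2 : Real.log (k : ℕ) * (l' / l) ≤ l * B.level k * (l' / l) := by
        have : 0 ≤ l' / l := div_nonneg (by linarith) hl.le
        gcongr
      have h3 : l * B.level k * (l' / l) = l' * B.level k := by field_simp
      linarith
  have h1 : ∑' k : {k : ℕ // (k : ℕ∞) < B.N}, ENNReal.ofReal (Real.exp (-l' * B.level k))
      ≤ ENNReal.ofReal (∑' k, G k) := by
    rw [ENNReal.ofReal_tsum_of_nonneg hG0 hGs]
    exact (ENNReal.tsum_le_tsum fun k => ENNReal.ofReal_le_ofReal (hle k)).trans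
      (ENNReal.tsum_comp_le_tsum_of_injective Subtype.val_injective
        fun k => ENNReal.ofReal (G k))
  rw [hZ] at h1
  exact ENNReal.ofReal_ne_top (top_le_iff.1 h1)

theorem exists_large_level_lt_log (h : ∀ n, FiniteDimensional ℂ (H.spectralSubspace n)) {l l' : ℝ}
    (hl : 0 < l) (hll : l < l') (hZ : posTrace (H.expNeg l') = ⊤) (x : ℝ) :
    ∃ k : {k : ℕ // (k : ℕ∞) < B.N}, x < B.level k ∧ l * B.level k < Real.log (k : ℕ) := by
  obtain ⟨K, hK⟩ := ((B.finite_level_le h x).image Subtype.val).bddAbove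
  obtain ⟨k, hk, hlog⟩ := B.exists_level_lt_log hl hll hZ (K + 1)
  refine ⟨k, not_le.1 fun hx => ?_, hlog⟩
  have := hK ⟨k, hx, rfl⟩
  omega

theorem exists_jump_ge [Nontrivial 𝓗] (B : H.Eigenbasis) (hE : H.groundEnergy < E)
    (h : ∀ n, FiniteDimensional ℂ (H.spectralSubspace n)) (hg : 0 < H.g) :
    ∃ (ρ : ℕ → 𝓗 →L[ℂ] 𝓗) (ρ₀ : 𝓗 →L[ℂ] 𝓗), H.ConvergesIn E ρ ρ₀ ∧
      (H.g : EReal) * ((E - H.groundEnergy : ℝ) : EReal) ≤ jump entropy ρ ρ₀ := by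
  obtain ⟨u, humono, hu, hulim⟩ := exists_seq_strictMono_tendsto' hg
  have hutop : ∀ n, u n ≠ ⊤ := fun n => ((hu n).2.trans_le le_top).ne
  set E₀ := H.groundEnergy with hE₀
  have hB0 : B.level ⟨0, B.N_pos⟩ = E₀ := by
    rw [hE₀, B.groundEnergy_eq, ← B.extLevel_eq ⟨0, B.N_pos⟩]
  -- The exponent `uₙ₊₁` lies strictly between `uₙ` and `g(H)`, so its trace diverges and gives
  -- levels with `uₙ Eₖ < log k`. Requiring `Eₖ > E + n + 1` makes `pₙ ≤ 1` and `pₙ → 0`.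
  have hex : ∀ n : ℕ, ∃ k : {k : ℕ // (k : ℕ∞) < B.N},
      E + n + 1 < B.level k ∧ (u n).toReal * B.level k < Real.log (k : ℕ) := by
    intro n
    refine B.exists_large_level_lt_log h (l' := (u (n + 1)).toReal) ?_ ?_ ?_ _
    · exact ENNReal.toReal_pos (hu n).1.ne' (hutop n)
    · exact (ENNReal.toReal_lt_toReal (hutop n) (hutop _)).2 (humono n.lt_succ_self)
    · refine posTrace_expNeg_eq_top (ENNReal.toReal_pos (hu _).1.ne' (hutop _)) ?_
      rw [ENNReal.ofReal_toReal (hutop _)]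
      exact (hu _).2
  choose k hkE hklog using hex
  have hden : ∀ n : ℕ, (n : ℝ) + 1 ≤ B.level (k n) - E₀ := fun n => by linarith [hkE n]
  have hden0 : ∀ n : ℕ, 0 < B.level (k n) - E₀ := fun n =>
    lt_of_lt_of_le (by positivity) (hden n)
  -- Chosen to exhaust the energy budget: `(1 - pₙ) E₀ + pₙ Eₖ = E`.
  set p : ℕ → ℝ := fun n => (E - E₀) / (B.level (k n) - E₀) with hp
  have hpE : ∀ n, p n * (B.level (k n) - E₀) = E - E₀ := fun n => div_mul_cancel₀ _ (hden0 n).ne'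
  have hp0 : ∀ n, 0 ≤ p n := fun n => div_nonneg (sub_pos.2 hE).le (hden0 n).le
  have hp1 : ∀ n, p n ≤ 1 := fun n => by
    rw [hp]
    simp only
    rw [div_le_one (hden0 n)]
    linarith [hkE n, (Nat.cast_nonneg n : (0 : ℝ) ≤ n)]
  have hplim : Tendsto p atTop (𝓝 0) := by
    refine squeeze_zero hp0 (fun n => ?_) (by
      simpa using tendsto_one_div_add_atTop_nhds_zero_nat.const_mul (E - E₀))
    rw [← div_eq_mul_inv]
    exact div_le_div_of_nonneg_left (sub_pos.2 hE).le (by positivity) (hden n)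
  have hkpos : ∀ n, 0 < (k n : ℕ) := fun n => by
    by_contra h0
    have h1 : k n = ⟨0, B.N_pos⟩ := Subtype.ext (by simpa using h0)
    have h2 := hden0 n
    rw [h1, hB0] at h2
    linarith
  have hlt : ∀ n (i : Fin (k n)), (((i : ℕ) + 1 : ℕ) : ℕ∞) < B.N := fun n i =>
    lt_of_le_of_lt (by exact_mod_cast i.2) (k n).2
  have hbE : ∀ n (i : Fin (k n)), (⟪B.basis ⟨i + 1, hlt n i⟩,
      H.op ⟨B.basis ⟨i + 1, hlt n i⟩, B.mem_domain _⟩⟫_ℂ).re ≤ B.level (k n) := fun n i => by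
    rw [B.inner_op]
    exact B.level_mono (a := ⟨i + 1, hlt n i⟩) (b := k n) i.2
  -- The `k` vectors `|1⟩, …, |k⟩` have energies at most `Eₖ` and are orthogonal to `|0⟩`, so `dₙ =
  -- k` matches `log k` exactly.
  obtain ⟨ρ, ρ₀, h1, h2⟩ := H.exists_convergesIn_entropy_ge (E := E)
    ⟨B.basis ⟨0, B.N_pos⟩, B.mem_domain _⟩ (B.basis.orthonormal.1 _)
    (ε := E₀) (by rw [B.inner_op, hB0]) (d := fun n => k n) (x := fun n => B.level (k n))
    hp0 hp1 hplim (fun n hn => absurd hn (hkpos n).ne')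
    (fun n => by linarith [hpE n])
    (fun n => by
      refine ⟨fun i => ⟨B.basis ⟨i + 1, hlt n i⟩, B.mem_domain _⟩,
        B.basis.orthonormal.comp (fun i : Fin (k n) => ⟨i + 1, hlt n i⟩) fun i i' hi => ?_,
        fun i => B.basis.orthonormal.2 ?_, hbE n⟩
      · exact Fin.ext (by simpa using hi)
      · exact fun h => absurd (congrArg Subtype.val h) (Nat.succ_ne_zero _).symm)
  refine ⟨ρ, ρ₀, h1, le_trans ?_ h2⟩
  rw [← coe_limsup]
  have hlim : Tendsto (fun n => u n * ENNReal.ofReal (E - E₀)) atTop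
      (𝓝 (H.g * ENNReal.ofReal (E - E₀))) :=
    ENNReal.Tendsto.mul_const hulim (Or.inr ENNReal.ofReal_ne_top)
  have h3 : (H.g : EReal) * ((E - E₀ : ℝ) : EReal)
      = ((H.g * ENNReal.ofReal (E - E₀) : ℝ≥0∞) : EReal) := by
    rw [EReal.coe_ennreal_mul, EReal.coe_ennreal_ofReal, max_eq_left (sub_pos.2 hE).le]
  rw [h3, EReal.coe_ennreal_le_coe_ennreal_iff, ← hlim.limsup_eq]
  refine limsup_le_limsup (Eventually.of_forall fun n => ?_) (by isBoundedDefault)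
    (by isBoundedDefault)
  beta_reduce
  rw [← ENNReal.ofReal_toReal (hutop n), ← ENNReal.ofReal_mul ENNReal.toReal_nonneg]
  refine ENNReal.ofReal_le_ofReal ?_
  have hu0 : 0 ≤ (u n).toReal := ENNReal.toReal_nonneg
  calc (u n).toReal * (E - E₀) = p n * ((u n).toReal * (B.level (k n) - E₀)) := by
        rw [← hpE n]; ring
    _ ≤ p n * ((u n).toReal * B.level (k n)) := by
        have := hp0 n
        gcongr
        linarith [H.groundEnergy_nonneg]
    _ ≤ p n * Real.log (k n : ℕ) := mul_le_mul_of_nonneg_left (hklog n).le (hp0 n)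

end Eigenbasis

/-- There is a converging sequence whose entropy jump is at least `g(H) (E - E₀)`. -/
theorem exists_jump_ge [Nontrivial 𝓗] (hE : H.groundEnergy < E) :
    ∃ (ρ : ℕ → 𝓗 →L[ℂ] 𝓗) (ρ₀ : 𝓗 →L[ℂ] 𝓗), H.ConvergesIn E ρ ρ₀ ∧
      (H.g : EReal) * ((E - H.groundEnergy : ℝ) : EReal) ≤ jump entropy ρ ρ₀ := by
  by_cases h : ∀ n, FiniteDimensional ℂ (H.spectralSubspace n)
  · obtain ⟨B⟩ := H.nonempty_eigenbasis h
    -- For `g(H) = 0` no exponents lie strictly below it; a constant sequence, given by `p = 0`,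
    -- already has a nonnegative jump.
    rcases eq_or_ne H.g 0 with hg | hg
    · obtain ⟨φ, hφ, hφE⟩ := H.exists_energy_lt hE
      obtain ⟨ρ, ρ₀, h1, h2⟩ := H.exists_convergesIn_entropy_ge (E := E) φ hφ le_rfl
        (d := fun _ => 0) (x := fun _ => 0) (p := fun _ => 0) (fun _ => le_rfl)
        (fun _ => zero_le_one) tendsto_const_nhds (fun _ _ => rfl)
        (fun _ => by linarith)
        (fun _ => ⟨fun i => i.elim0, ⟨fun i => i.elim0, fun i => i.elim0⟩, fun i => i.elim0,
          fun i => i.elim0⟩)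
      refine ⟨ρ, ρ₀, h1, le_trans (le_of_eq ?_) h2⟩
      simp [hg]
    · exact B.exists_jump_ge hE h (pos_iff_ne_zero.2 hg)
  · push Not at h
    obtain ⟨m, hm⟩ := h
    obtain ⟨ρ, ρ₀, h1, h2⟩ := H.exists_jump_eq_top hE hm
    exact ⟨ρ, ρ₀, h1, h2 ▸ le_top⟩

end Hamiltonian

end QEntropy

end

/-! ### The theorem -/

theorem proposition4 {𝓗 : Type*} [NormedAddCommGroup 𝓗] [InnerProductSpace ℂ 𝓗]
    [CompleteSpace 𝓗] [TopologicalSpace.SeparableSpace 𝓗] [Nontrivial 𝓗]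
    (H : QEntropy.Hamiltonian 𝓗) (E : ℝ) (hE : H.groundEnergy < E) :
    (H.g < ⊤ →
      Nonempty H.Eigenbasis ∧
      ∀ B : H.Eigenbasis,
        (∀ (ρ : ℕ → 𝓗 →L[ℂ] 𝓗) (ρ₀ : 𝓗 →L[ℂ] 𝓗), H.ConvergesIn E ρ ρ₀ →
          QEntropy.jump QEntropy.entropy ρ ρ₀
              ≤ (H.g : EReal) * QEntropy.jump (fun σ => H.energy (B.rearrange σ)) ρ ρ₀ ∧
          (H.g : EReal) * QEntropy.jump (fun σ => H.energy (B.rearrange σ)) ρ ρ₀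
              ≤ (H.g : EReal) * QEntropy.jump H.energy ρ ρ₀ ∧
          (H.g : EReal) * QEntropy.jump H.energy ρ ρ₀
              ≤ (H.g : EReal) * ((E - H.groundEnergy : ℝ) : EReal)) ∧
        (∃ (ρ : ℕ → 𝓗 →L[ℂ] 𝓗) (ρ₀ : 𝓗 →L[ℂ] 𝓗), H.ConvergesIn E ρ ρ₀ ∧
          QEntropy.jump QEntropy.entropy ρ ρ₀
              = (H.g : EReal) * QEntropy.jump (fun σ => H.energy (B.rearrange σ)) ρ ρ₀ ∧
          (H.g : EReal) * QEntropy.jump (fun σ => H.energy (B.rearrange σ)) ρ ρ₀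
              = (H.g : EReal) * QEntropy.jump H.energy ρ ρ₀ ∧
          (H.g : EReal) * QEntropy.jump H.energy ρ ρ₀
              = (H.g : EReal) * ((E - H.groundEnergy : ℝ) : EReal))) ∧
    (⨆ (ρ : ℕ → 𝓗 →L[ℂ] 𝓗) (ρ₀ : 𝓗 →L[ℂ] 𝓗) (_ : H.ConvergesIn E ρ ρ₀),
        QEntropy.jump QEntropy.entropy ρ ρ₀)
      = (H.g : EReal) * ((E - H.groundEnergy : ℝ) : EReal) := by
  have hE0 : 0 ≤ E := H.groundEnergy_nonneg.trans hE.le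
  have hg0 : (0 : EReal) ≤ (H.g : EReal) := EReal.coe_ennreal_nonneg _
  obtain ⟨ρ', ρ₀', h', hjump⟩ := H.exists_jump_ge hE
  have hchain : H.g < ⊤ → ∀ (B : H.Eigenbasis) (ρ : ℕ → 𝓗 →L[ℂ] 𝓗) (ρ₀ : 𝓗 →L[ℂ] 𝓗),
      H.ConvergesIn E ρ ρ₀ →
        QEntropy.jump QEntropy.entropy ρ ρ₀
            ≤ (H.g : EReal) * QEntropy.jump (fun σ => H.energy (B.rearrange σ)) ρ ρ₀ ∧
        (H.g : EReal) * QEntropy.jump (fun σ => H.energy (B.rearrange σ)) ρ ρ₀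
            ≤ (H.g : EReal) * QEntropy.jump H.energy ρ ρ₀ ∧
        (H.g : EReal) * QEntropy.jump H.energy ρ ρ₀
            ≤ (H.g : EReal) * ((E - H.groundEnergy : ℝ) : EReal) := fun hg B ρ ρ₀ h =>
    ⟨B.jump_entropy_le hg h,
      mul_le_mul_of_nonneg_left (B.jump_energy_rearrange_le h) hg0,
      mul_le_mul_of_nonneg_left (B.jump_energy_le hE0 h) hg0⟩
  have hbasis : H.g < ⊤ → Nonempty H.Eigenbasis := fun hg => by
    obtain ⟨l, hl, hZ, -⟩ := QEntropy.Hamiltonian.exists_of_g_lt hg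
    exact H.nonempty_eigenbasis (H.finiteDimensional_spectralSubspace hl hZ)
  refine ⟨fun hg => ⟨hbasis hg, fun B => ⟨hchain hg B, ρ', ρ₀', h', ?_⟩⟩, le_antisymm ?_ ?_⟩
  · obtain ⟨h1, h2, h3⟩ := hchain hg B ρ' ρ₀' h'
    exact ⟨h1.antisymm (h2.trans (h3.trans hjump)), h2.antisymm (h3.trans (hjump.trans h1)),
      h3.antisymm (hjump.trans (h1.trans h2))⟩
  · refine iSup_le fun ρ => iSup_le fun ρ₀ => iSup_le fun h => ?_
    rcases eq_or_ne H.g ⊤ with hg | hg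
    · rw [hg, EReal.coe_ennreal_top, EReal.top_mul_coe_of_pos (sub_pos.2 hE)]
      exact le_top
    · obtain ⟨B⟩ := hbasis (lt_top_iff_ne_top.2 hg)
      obtain ⟨h1, h2, h3⟩ := hchain (lt_top_iff_ne_top.2 hg) B ρ ρ₀ h
      exact h1.trans (h2.trans h3)
  · exact hjump.trans (le_iSup_of_le ρ' (le_iSup_of_le ρ₀' (le_iSup_of_le h' le_rfl)))
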